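/- **Problem.** Let $\mathcal N$ be a finite ground set with $n\ge 1$ elements, $f:2^{\mathcal N}\to\mathbb R_{\ge 0}$ submodular (not necessarily monotone), $\mathcal M_i(\mathcal N,\mathcal I_i)$, $i\le k$, matroids ($k\ge1$) and $c_j:\mathcal N\to\mathbb R_{\ge0}$, $j\le m$, modular costs ($m\ge 1$). A set $S$ is feasible if $S\in\bigcap_i\mathcal I_i$ and $c_j(S)\le 1$ for all $j$. Let $S_{\mathrm{OPT}}$ be a feasible set of maximum value $\mathrm{OPT}$, $r=|S_{\mathrm{OPT}}|$, and let $e^*$ be a feasible element of maximum value. The algorithm has access to $f$ and to $\bigcap_i\mathcal I_i$ through a value oracle and a membership oracle. **Algorithm SPROUT++** (parameters $\delta,\epsilon',\beta,\gamma,\alpha,\mu,t_c,\ell$). Repeatedly draw a uniformly random feasible element $a$ that was not drawn before, until $t_c$ drawn elements satisfied $f(a)\ge(1-\alpha)f(e^*)$ or no element is left. For each drawn element with $f(a)\ge(1-\alpha)f(e^*)$ put $\mathcal A=\{a\}$, $z(S)=f(S\cup\mathcal A)-f(\mathcal A)$, let $\mathcal N'$ be the set of the other (individually feasible) elements, contract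 the matroids by $\mathcal A$, and decrease the budgets by $c_j(\mathcal A)$ and renormalize them to $1$, which gives costs $c'_j$. Let $V$ be the maximum of $z(e)$ over the elements $e$ of $\mathcal N'$ that are feasible in this reduced instance ($0$ if there is none), $b_1=1$ and $b_0=\lceil\log_2|\mathcal N'|/\delta\rceil$ (with $b_0=0$ if $\mathcal N'=\emptyset$). While $|b_1-b_0|>1$, put $b=\lfloor(b_1+b_0+1)/2\rfloor$, $\rho=\beta V(1+\delta)^b+\gamma f(\mathcal A)$, run the subroutine KnapsackSGS with density ratio $\rho$, and replace $b_E$ by $b+(1-2E)(1-1/\mu)|b_E-b|$ rounded to an integer in the direction of $b$, where $E\in\{0,1\}$ is returned by the subroutine. Let $S_{\mathcal A}$ be the set of maximum $f(\mathcal A\cup S)$ among the sets $S$ returned by the subroutine ($\emptyset$ if the loop is never entered). The output is the best of the sets $\mathcal A\cup S_{\mathcal A}$. *KnapsackSGS* maintains $\ell$ disjoint solutions $S^1,\dots,S^\ell$, initially empty, and a threshold $\tau$, initially $V$. While $\tau>\epsilon' V/n$ it goes once through all pairs $(a,i)$ with $a\in\mathcal N'$ not yet used and $i\le\ell$. If $S^i\cup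 a$ is independent in the contracted matroids and $z(S^i\cup a)-z(S^i)\ge\max\{\tau,\rho\sum_jc_j'(a)\}$, then $a$ is inserted into $S^i$ if $c_j'(S^i\cup a)\le1$ for all $j$; otherwise $E$, initially $0$, is set to $1$. After each pass $\tau$ is multiplied by $1-\epsilon'$. It returns the $S^i$ of maximum $z$, and $E$. **Theorem.** Let $P=\max\{\lceil\sqrt{1+m}\rceil,k\}$. There are universal constants $\kappa\in(0,1]$, $C>0$ and $d\in\mathbb N$ such that the following holds for every such instance, every $\epsilon\in(0,1)$, $\mu\ge1$, integer $t_c\ge1$ and $\alpha\ge0$. Put $\epsilon'=\kappa\epsilon$, and let SPROUT++ be run with $\delta=\epsilon'$, $\ell=P+1$, $p=\max\{\ell-1,k\}=P$, $$\beta=\frac{(1-\epsilon')(1-1/\ell-\epsilon')}{p+1+m(1-\epsilon')},\qquad \gamma=\frac{(1+\alpha)(p+1)}{p+1+m(1-\epsilon')}.$$ Suppose that $$(1+\alpha)f(a)\ge f(e^*)\ \text{ for all } a\in S_{\mathrm{OPT}},\qquad \alpha\le\frac{(1-\epsilon')\left(p+1-(1-\epsilon')^2\right)}{\epsilon'(p+1)+m(1-\epsilon')}.$$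 Then SPROUT++ always terminates with a feasible set $S$. With probability at least $1-e^{-rt_c/n}$, $$(1+\epsilon)\left(k+m+3+2\sqrt{m+1}\right)f(S)\ \ge\ \mathrm{OPT}.$$ It always uses at most $\Lambda\,t_cPn/\epsilon$ oracle calls and at most $\Lambda\,t_cPmn/\epsilon$ arithmetic operations, where $\Lambda=C\,(1+\log(n/\epsilon))^d\,\log^{-1}\!\left(\frac{2\mu}{2\mu-1}\right)$; that is, $\tilde O(\log^{-1}(\frac{2\mu}{2\mu-1})\,t_cPn/\epsilon)$ and $\tilde O(\log^{-1}(\frac{2\mu}{2\mu-1})\,t_cPmn/\epsilon)$. -/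

import Mathlib

noncomputable section

namespace SubmodMax

/-! ### The problem -/

/-- An instance of submodular maximization under the intersection of `k` matroids and `m` knapsacks
on the ground set `Fin n`: a non-negative submodular function `f`, matroids `M 0, …, M (k-1)` on the
whole ground set, and non-negative modular costs `c j`, all budgets being normalized to `1`. -/
structure Instance (n k m : ℕ) where
  f : Finset (Fin n) → ℝ
  f_nonneg : ∀ S, 0 ≤ f S
  submodular : ∀ (A B : Finset (Fin n)) (e : Fin n), A ⊆ B → e ∉ B →
    f (insert e B) - f B ≤ f (insert e A) - f A
  M : Fin k → Matroid (Fin n)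
  ground : ∀ i, (M i).E = Set.univ
  c : Fin m → Fin n → ℝ
  c_nonneg : ∀ j e, 0 ≤ c j e

variable {n k m : ℕ}

/-- `S` is independent in all `k` matroids. -/
def Instance.Indep (I : Instance n k m) (S : Finset (Fin n)) : Prop :=
  ∀ i, (I.M i).Indep (S : Set (Fin n))

/-- The cost of a set with respect to the `j`-th knapsack. -/
def Instance.cost (I : Instance n k m) (j : Fin m) (S : Finset (Fin n)) : ℝ := ∑ e ∈ S, I.c j e

/-- `S` satisfies the `k`-matroid and the `m`-knapsack constraint. -/
def Instance.Feasible (I : Instance n k m) (S : Finset (Fin n)) : Prop :=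
  I.Indep S ∧ ∀ j, I.cost j S ≤ 1

/-- `S` is an optimal solution. -/
def Instance.IsOptimal (I : Instance n k m) (S : Finset (Fin n)) : Prop :=
  I.Feasible S ∧ ∀ T, I.Feasible T → I.f T ≤ I.f S

/-- `e` is a feasible element of maximum value. -/
def Instance.IsBestElement (I : Instance n k m) (e : Fin n) : Prop :=
  I.Feasible {e} ∧ ∀ e', I.Feasible {e'} → I.f {e'} ≤ I.f {e}

/-! ### Deterministic computations with a step count -/

/-- Number of oracle calls and number of arithmetic operations of a computation. -/
structure Cost where
  oracle : ℕ
  arith : ℕ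

/-- Costs of consecutive computations add up. -/
def Cost.add (s t : Cost) : Cost := ⟨s.oracle + t.oracle, s.arith + t.arith⟩

/-- A deterministic computation: `none` if it runs forever, otherwise its result and its cost. -/
def Comp (α : Type) : Type := Option (α × Cost)

/-- Add a cost that was paid before the computation started. -/
def Comp.charge {α : Type} (s : Cost) (x : Comp α) : Comp α :=
  Option.map (fun r => (r.1, s.add r.2)) x

instance : Monad Comp where
  pure a := some (a, ⟨0, 0⟩)
  bind x g :=
    match x with
    | none => none
    | some (a, s) => Comp.charge s (g a)

/-- A result that is obtained by `j` elementary operations on numbers (addition, subtraction,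
multiplication, division, comparison, rounding, logarithm, drawing a random index). -/
def ops {α : Type} (j : ℕ) (x : α) : Comp α := some (x, ⟨0, j⟩)

/-- One call of the value oracle. -/
def askValue (I : Instance n k m) (S : Finset (Fin n)) : Comp ℝ := some (I.f S, ⟨1, 0⟩)

open Classical in
/-- One call of the membership oracle of the `k`-matroid constraint. -/
def askIndep (I : Instance n k m) (S : Finset (Fin n)) : Comp Bool :=
  some (decide (I.Indep S), ⟨1, 0⟩)

/-- A while loop that is cut off (with result `none`) at the given number of guard evaluations. -/
def whileFuel {σ : Type} (guard : σ → Comp Bool) (body : σ → Comp σ) : ℕ → σ → Comp σ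
  | 0, _ => none
  | j + 1, s => do
    let g ← guard s
    if g then
      let s' ← body s
      whileFuel guard body j s'
    else
      pure s

open Classical in
/-- The while loop: `none` if it runs forever, otherwise the outcome of the loop when it is allowed
just as many guard evaluations as it needs. -/
def whileLoop {σ : Type} (guard : σ → Comp Bool) (body : σ → Comp σ) (s : σ) : Comp σ :=
  if h : ∃ j, whileFuel guard body j s ≠ none then whileFuel guard body (Nat.find h) s else none

/-- A subset of the ground set together with a number attached to it (its value). -/
abbrev Valued (n : ℕ) : Type := Finset (Fin n) × ℝ

open Classical in
/-- The entry of largest value in a list, or `d` if the list is empty. -/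
def argmaxD (L : List (Valued n)) (d : Valued n) : Comp (Valued n) :=
  ops L.length ((L.argmax Prod.snd).getD d)

open Classical in
/-- Test of the feasibility of `S`. -/
def checkFeasible (I : Instance n k m) (S : Finset (Fin n)) : Comp Bool := do
  let i ← askIndep I S
  let c ← ops (m * S.card) (decide (∀ j, I.cost j S ≤ 1))
  pure (i && c)

/-! ### The subroutine KnapsackSGS -/

/-- State of KnapsackSGS: the `ℓ` candidate solutions `S^i`, the values `f (A ∪ S^i)`, the normalized
knapsack costs of the `S^i`, the elements that are still available, and the indicator `E` telling
whether an insertion was ever refused only because it violates a knapsack. -/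
structure SGSState (n m ℓ : ℕ) where
  sol : Fin ℓ → Finset (Fin n)
  val : Fin ℓ → ℝ
  load : Fin ℓ → Fin m → ℝ
  avail : Finset (Fin n)
  E : Bool

/-- The cost of `a` in the `j`-th knapsack after the budget was decreased by the cost of `A` and
normalized to `1`. -/
def Instance.ncost (I : Instance n k m) (A : Finset (Fin n)) (j : Fin m) (a : Fin n) : ℝ :=
  I.c j a / (1 - I.cost j A)

/-- All normalized costs of `a` are finite: if nothing is left of a budget, then `a` needs nothing. -/
def Instance.FiniteNCost (I : Instance n k m) (A : Finset (Fin n)) (a : Fin n) : Prop :=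
  ∀ j, I.cost j A = 1 → I.c j a = 0

open Classical in
/-- Treatment of one pair `(a, i)` for the threshold `τ` and the density ratio `ρ`. The objective is
`z S = f (A ∪ S) - f A`, and `S` is independent in the contracted system iff `A ∪ S` is
independent. An infinite normalized cost fails the density test. -/
def sgsPair (I : Instance n k m) {ℓ : ℕ} (A : Finset (Fin n)) (ρ τ : ℝ) (s : SGSState n m ℓ)
    (q : Fin n × Fin ℓ) : Comp (SGSState n m ℓ) :=
  if q.1 ∉ s.avail then pure s else do
    let T := insert q.1 (s.sol q.2)
    let ind ← askIndep I (A ∪ T)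
    if !ind then pure s else
      let v ← askValue I (A ∪ T)
      let gain ← ops 1 (v - s.val q.2)
      let dens ← ops (3 * m) (ρ * ∑ j, I.ncost A j q.1)
      let ok ← ops (m + 2) (decide (I.FiniteNCost A q.1 ∧ max τ dens ≤ gain))
      if !ok then pure s else
        let load' ← ops (2 * m) (fun j => s.load q.2 j + I.ncost A j q.1)
        let fits ← ops m (decide (∀ j, load' j ≤ 1))
        if fits then
          pure { sol := Function.update s.sol q.2 T
                 val := Function.update s.val q.2 v
                 load := Function.update s.load q.2 load'
                 avail := s.avail.erase q.1
                 E := s.E }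
        else
          pure { s with E := true }

open Classical in
/-- KnapsackSGS on the instance reduced by `A`, with ground set `N'`, maximum singleton value `V`, `ℓ`
solutions, density ratio `ρ` and error parameter `ε`; `fA = f A`. The returned set is `S_K` with the
value `f (A ∪ S_K)`, which differs from `z S_K` by a constant; the returned Boolean is `E`. -/
def knapsackSGS (I : Instance n k m) (A : Finset (Fin n)) (N' : List (Fin n)) (V fA : ℝ) (ℓ : ℕ)
    (ρ ε : ℝ) : Comp (Valued n × Bool) := do
  let stopAt ← ops 2 (ε * V / n)
  let init : SGSState n m ℓ :=
    { sol := fun _ => ∅, val := fun _ => fA, load := fun _ _ => 0, avail := N'.toFinset, E := false }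
  let r ← whileLoop
    (fun st : ℝ × SGSState n m ℓ => ops 1 (decide (stopAt < st.1)))
    (fun st => do
      let s ← List.foldlM (sgsPair I A ρ st.1) st.2 (N'.product (List.finRange ℓ))
      let τ ← ops 2 ((1 - ε) * st.1)
      pure (τ, s))
    (V, init)
  let best ← argmaxD ((List.finRange ℓ).map fun i => (r.2.sol i, r.2.val i)) (∅, fA)
  pure (best, r.2.E)

/-! ### SPROUT++ -/

/-- The parameters of SPROUT++: error parameters `δ`, `ε`, correction parameters `β`, `γ`,
acceleration parameter `α`, smooth parameter `μ`, counter `tc`, number `ℓ` of solutions. -/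
structure Params where
  δ : ℝ
  ε : ℝ
  β : ℝ
  γ : ℝ
  α : ℝ
  μ : ℝ
  tc : ℕ
  ℓ : ℕ

/-- State of the search for the density ratio: the endpoints and the solutions found so far. -/
structure SearchState (n : ℕ) where
  b₁ : ℤ
  b₀ : ℤ
  found : List (Valued n)

/-- One round of the smoothed binary search. The endpoint `b_E` moves to
`b + (1 - 2E) (1 - 1/μ) |b_E - b|`, rounded to an integer in the direction of `b`. -/
def searchStep (I : Instance n k m) (par : Params) (A : Finset (Fin n)) (N' : List (Fin n))
    (V fA : ℝ) (s : SearchState n) : Comp (SearchState n) := do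
  let b : ℤ ← ops 3 ((s.b₁ + s.b₀ + 1) / 2)
  let ρ : ℝ ← ops (b.natAbs + 5) (par.β * V * (1 + par.δ) ^ b + par.γ * fA)
  let r ← knapsackSGS I A N' V fA par.ℓ ρ par.ε
  let found := s.found ++ [r.1]
  if r.2 then
    let b₁ : ℤ ← ops 7 ⌈(b : ℝ) - (1 - 1 / par.μ) * |(s.b₁ : ℝ) - b|⌉
    pure { b₁ := b₁, b₀ := s.b₀, found := found }
  else
    let b₀ : ℤ ← ops 7 ⌊(b : ℝ) + (1 - 1 / par.μ) * |(s.b₀ : ℝ) - b|⌋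
    pure { b₁ := s.b₁, b₀ := b₀, found := found }

/-- The maximum of `z {e} = f (A ∪ {e}) - f A` over the elements `e` of `N'` that are feasible in the
reduced instance (`0` if there is none). -/
def maxGain (I : Instance n k m) (A : Finset (Fin n)) (N' : List (Fin n)) (fA : ℝ) : Comp ℝ := do
  let L ← List.foldlM (fun (acc : List (Valued n)) e => do
    let ok ← checkFeasible I (insert e A)
    if ok then
      let v ← askValue I (insert e A)
      let g ← ops 1 (v - fA)
      pure (acc ++ [({e}, g)])
    else
      pure acc) [] N'
  let best ← argmaxD L (∅, 0)
  pure best.2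

/-- The work done for one enumerated set `A`, with `fA = f A`: the result is `A ∪ S_A` with its
value. The initial range of the search uses the binary logarithm. -/
def enumerated (I : Instance n k m) (par : Params) (A : Finset (Fin n)) (fA : ℝ)
    (N' : List (Fin n)) : Comp (Valued n) := do
  let V ← maxGain I A N' fA
  let b₀ : ℤ ← ops 3 ⌈Real.logb 2 N'.length / par.δ⌉
  let s ← whileLoop
    (fun s : SearchState n => ops 3 (decide (1 < |s.b₁ - s.b₀|)))
    (searchStep I par A N' V fA)
    { b₁ := 1, b₀ := b₀, found := [] }
  let best ← argmaxD s.found (∅, fA)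
  pure (A ∪ best.1, best.2)

/-- The feasible elements, as singletons with their values. -/
def feasibleElements (I : Instance n k m) : Comp (List (Fin n × Valued n)) :=
  List.foldlM (fun (acc : List (Fin n × Valued n)) e => do
    let ok ← checkFeasible I {e}
    if ok then
      let v ← askValue I {e}
      pure (acc ++ [(e, ({e}, v))])
    else
      pure acc) [] (List.finRange n)

/-- A randomized computation: a distribution on runs. -/
def RComp (α : Type) : Type := PMF (Comp α)

/-- A deterministic computation as a randomized one. -/
def RComp.lift {α : Type} (x : Comp α) : RComp α := PMF.pure x

instance : Monad RComp where
  pure a := RComp.lift (pure a)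
  bind x g := PMF.bind x fun r =>
    match r with
    | none => PMF.pure none
    | some (a, s) => PMF.map (Comp.charge s) (g a)

/-- A uniformly random element of a non-empty finite set. -/
def draw {β : Type} (s : Finset β) (h : s.Nonempty) : RComp β :=
  PMF.map (ops 1) (PMF.uniformOfFinset s h)

open Classical in
/-- The main loop. `ground` lists the feasible elements, `bar` is `(1 - α) f(e*)`, `t` is the current
counter, `rest` is the set of feasible elements that were not drawn yet and `found` contains the
solutions `A ∪ S_A` obtained so far. The loop ends when the counter is `0` or when no element is
left. The first numerical argument bounds the number of draws; as no element is drawn twice, `n`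
is enough. -/
def mainLoop (I : Instance n k m) (par : Params) (ground : List (Fin n)) (bar : ℝ) :
    ℕ → ℕ → Finset (Fin n) → List (Valued n) → RComp (List (Valued n))
  | 0, _, _, found => pure found
  | j + 1, t, rest, found =>
    if h : 0 < t ∧ rest.Nonempty then do
      let e ← draw rest h.2
      let fA ← RComp.lift (askValue I {e})
      let good ← RComp.lift (ops 1 (decide (bar ≤ fA)))
      if good then
        let r ← RComp.lift (enumerated I par {e} fA (ground.filter (· ≠ e)))
        mainLoop I par ground bar j (t - 1) (rest.erase e) (found ++ [r])
      else
        mainLoop I par ground bar j t (rest.erase e) found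
    else
      pure found

/-- SPROUT++. Elements that are infeasible by themselves belong to no feasible set and are left out of
the reduced ground sets. -/
def sproutPP (I : Instance n k m) (par : Params) : RComp (Finset (Fin n)) := do
  let L ← RComp.lift (feasibleElements I)
  let eStar ← RComp.lift (argmaxD (L.map Prod.snd) (∅, 0))
  let bar ← RComp.lift (ops 2 ((1 - par.α) * eStar.2))
  let ground := L.map Prod.fst
  let found ← mainLoop I par ground bar n par.tc ground.toFinset []
  let best ← RComp.lift (argmaxD found (∅, 0))
  pure best.1

/-! ### The choice of the parameters -/

/-- `P = max {⌈√(1+m)⌉, k}`. -/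
def bigP (k m : ℕ) : ℕ := max ⌈Real.sqrt (1 + m)⌉₊ k

/-- `p = max {ℓ - 1, k}` for `ℓ` solutions and `k` matroids. -/
def smallP (k ℓ : ℕ) : ℕ := max (ℓ - 1) k

/-- The parameters used in the analysis: `δ = ε`, `ℓ = P + 1`, and the correction parameters for which
the searched density ratios have the form
`((1-ε)(1-1/ℓ-ε) V (1+δ)^b + (1+α)(p+1) f A) / (p+1+m(1-ε))`. -/
def analysisParams (k m : ℕ) (ε α μ : ℝ) (tc : ℕ) : Params :=
  let ℓ := bigP k m + 1
  let p := smallP k ℓ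
  { δ := ε
    ε := ε
    β := (1 - ε) * (1 - 1 / (ℓ : ℝ) - ε) / ((p : ℝ) + 1 + m * (1 - ε))
    γ := (1 + α) * ((p : ℝ) + 1) / ((p : ℝ) + 1 + m * (1 - ε))
    α := α
    μ := μ
    tc := tc
    ℓ := ℓ }

/-- The bound on the acceleration parameter:
`(1-ε)(p+1-(1-ε)²) / (ε(p+1)+m(1-ε))` with `p` as for the parameters above. -/
def alphaBound (k m : ℕ) (ε : ℝ) : ℝ :=
  let p : ℝ := smallP k (bigP k m + 1)
  (1 - ε) * (p + 1 - (1 - ε) ^ 2) / (ε * (p + 1) + m * (1 - ε))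

end SubmodMax

end

/-! Fix an element `e` of the optimum and put `A = {e}`, `F = f A`, `O = Sopt \ A`, `X = OPT - F`,
`v = f(e*) ≤ (1+α)F`; `W` is the value found for `A`. It suffices to bound `OPT` by `W` for such an
`e`: a draw hits the optimum with chance at least `r/n`, a hit always passes the test because
`(1-α)(1+α) ≤ 1`, and a miss uses at most one unit of the counter, so all draws fail with
probability at most `(1-r/n)^tc ≤ exp(-r tc/n)` (`mainLoop_fail_le`).

For a density ratio `ρ`, KnapsackSGS yields one of two certificates. If a knapsack refused an
element, the solution together with that element has total cost above 1 at density at least `ρ`, and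
dropping the element loses at most `v`; so `W ≥ F + ρ - v` (`SGSInv.set_E`). If none did, a charging
argument compares the solutions with `O`. The gain of `o ∈ O` over a solution is split into a part
paid by its density, at most `ρm` in total, and an excess. An insertion gains at least `τ`; if the
element lies in `O`, it is lost to the `ℓ-1` other solutions, and otherwise each of the `k` matroids
may block one more element of `O`. Each loss costs about `τ`, so the total loss is at most `p` times
the total gain (`potential`, `OptInv.step`). Disjointness of the solutions replaces monotonicity at
the price of a factor `1-1/ℓ` (`sum_f_union_ge`), which gives `(1-ε)(1-1/ℓ)OPT ≤ (1-ε)W + p(W-F) +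
(1-ε)mρ + εV` (`OptInv.guarantee`).

The first certificate wants `ρ` large, the second wants it small; the ideal choice has `V(1+δ)^b`
close to `X`. The search keeps a violation certificate at or above `b₁` and a density certificate at
or below `b₀`, or else the trivial initial bounds. When the endpoints are adjacent, one certificate
sits on the useful side of `X`, or `X ≤ (1+δ)²V` and `A` alone is good enough
(`SearchInv.guarantee`). Smoothing by `μ` still shrinks the range by a factor `1-1/(2μ)` per round.

The constants `β`, `γ` are such that both certificates give `a·OPT ≤ (1+ε)(p+1+m+m/(p+1)²)W` with `a
= (1-ε)(1-1/ℓ-ε)` (`bound_of_density`, `bound_of_violation`). Taking `p` about `max(√(m+1), k)`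
balances `p` against `(m+1)/p` and leads to `k+m+3+2√(m+1)` (`bigP_bound`). -/

namespace SubmodMax

/-! ### Total correctness of computations with bounds on the costs -/

/-- The computation ends with a result satisfying `Q`, after at most `o` oracle calls and `a`
arithmetic operations. -/
def Comp.Sat {α : Type} (x : Comp α) (o a : ℕ) (Q : α → Prop) : Prop :=
  ∃ r c, x = some (r, c) ∧ c.oracle ≤ o ∧ c.arith ≤ a ∧ Q r

namespace Comp.Sat

variable {α β σ : Type} {n k m : ℕ}

theorem mono {x : Comp α} {o a o' a' : ℕ} {Q Q' : α → Prop} (h : x.Sat o a Q)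
    (ho : o ≤ o') (ha : a ≤ a') (hQ : ∀ r, Q r → Q' r) : x.Sat o' a' Q' := by
  obtain ⟨r, c, rfl, h1, h2, h3⟩ := h
  exact ⟨r, c, rfl, h1.trans ho, h2.trans ha, hQ r h3⟩

theorem pure {r : α} {o a : ℕ} {Q : α → Prop} (h : Q r) :
    Comp.Sat (Pure.pure r : Comp α) o a Q :=
  ⟨r, ⟨0, 0⟩, rfl, Nat.zero_le _, Nat.zero_le _, h⟩

theorem charge {x : Comp α} {o a : ℕ} {Q : α → Prop} (s : Cost) (h : x.Sat o a Q) :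
    (Comp.charge s x).Sat (s.oracle + o) (s.arith + a) Q := by
  obtain ⟨r, c, rfl, h1, h2, h3⟩ := h
  exact ⟨r, s.add c, rfl, Nat.add_le_add_left h1 _, Nat.add_le_add_left h2 _, h3⟩

theorem bind {x : Comp α} {g : α → Comp β} {o a o' a' : ℕ} {Q : α → Prop} {Q' : β → Prop}
    (hx : x.Sat o a Q) (hg : ∀ r, Q r → (g r).Sat o' a' Q') :
    Comp.Sat (x >>= g) (o + o') (a + a') Q' := by
  obtain ⟨r, c, rfl, h1, h2, h3⟩ := hx
  exact ((hg r h3).charge c).mono (by omega) (by omega) fun _ h => h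

theorem ops_bind {x : α} {g : α → Comp β} {j o a : ℕ} {Q : β → Prop} (h : (g x).Sat o a Q) :
    Comp.Sat (ops j x >>= g) o (j + a) Q :=
  (h.charge ⟨0, j⟩).mono (by simp) le_rfl fun _ h => h

theorem askIndep_bind {I : Instance n k m} {S : Finset (Fin n)} {g : Bool → Comp β} {o a : ℕ}
    {Q : β → Prop} (h : ∀ b : Bool, (b = true ↔ I.Indep S) → (g b).Sat o a Q) :
    Comp.Sat (askIndep I S >>= g) (1 + o) a Q := by
  classical
  exact ((h (decide (I.Indep S)) (by simp)).charge ⟨1, 0⟩).mono le_rfl (by simp) fun _ h => h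

theorem askValue_bind {I : Instance n k m} {S : Finset (Fin n)} {g : ℝ → Comp β} {o a : ℕ}
    {Q : β → Prop} (h : (g (I.f S)).Sat o a Q) : Comp.Sat (askValue I S >>= g) (1 + o) a Q :=
  (h.charge ⟨1, 0⟩).mono le_rfl (by simp) fun _ h => h

theorem foldlM {f : σ → α → Comp σ} {o a : ℕ} (P : List α → σ → Prop) (l : List α) (s : σ)
    (h0 : P [] s)
    (hstep : ∀ pre x s, x ∈ l → P pre s → (f s x).Sat o a (P (pre ++ [x]))) :
    Comp.Sat (List.foldlM f s l) (l.length * o) (l.length * a) (P l) := by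
  suffices H : ∀ (suf pre : List α) (s : σ), (∀ x ∈ suf, x ∈ l) → P pre s →
      Comp.Sat (List.foldlM f s suf) (suf.length * o) (suf.length * a) (P (pre ++ suf)) by
    simpa using H l [] s (fun _ h => h) h0
  intro suf
  induction suf with
  | nil => intro pre s _ h; simpa using Comp.Sat.pure h
  | cons x suf ih =>
    intro pre s hmem h
    rw [List.foldlM_cons]
    have := Comp.Sat.bind (hstep pre x s (hmem x (by simp)) h) fun s' hs' =>
      ih (pre ++ [x]) s' (fun y hy => hmem y (by simp [hy])) hs'
    refine this.mono ?_ ?_ ?_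
    · simp only [List.length_cons]; linarith
    · simp only [List.length_cons]; linarith
    · intro r hr; simpa using hr

end Comp.Sat

/-! ### While loops: termination and independence of the fuel. -/

theorem whileFuel_succ_of_eq_some {σ : Type} {guard : σ → Comp Bool} {body : σ → Comp σ}
    (j : ℕ) : ∀ (s : σ) (r : σ × Cost), whileFuel guard body j s = some r →
      whileFuel guard body (j + 1) s = some r := by
  induction j with
  | zero => intro s r h; simp [whileFuel] at h
  | succ j ih =>
    intro s r h
    rw [whileFuel] at h ⊢
    rcases hg : guard s with _ | ⟨g, c⟩
    · rw [hg] at h; cases h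
    · rw [hg] at h
      cases g with
      | false => exact h
      | true =>
        rcases hb : body s with _ | ⟨s', c'⟩
        · simp only [hb] at h; cases h
        · simp only [hb] at h ⊢
          change Comp.charge c (Comp.charge c' (whileFuel guard body j s')) = some r at h
          change Comp.charge c (Comp.charge c' (whileFuel guard body (j + 1) s')) = some r
          rcases hw : whileFuel guard body j s' with _ | r'
          · rw [hw] at h; cases h
          · rw [ih s' r' hw, ← hw]; exact h

/-- Extra fuel never changes an outcome, so the least sufficient fuel used in `whileLoop` gives the
same result and cost as any other sufficient one. Hence an upper bound on the rounds is enough to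
analyse a loop. -/
theorem whileLoop_eq_of_eq_some {σ : Type} {guard : σ → Comp Bool} {body : σ → Comp σ}
    {j : ℕ} {s : σ} {r : σ × Cost} (h : whileFuel guard body j s = some r) :
    whileLoop guard body s = some r := by
  classical
  have hne : whileFuel guard body j s ≠ none := fun h' => Option.some_ne_none r (h.symm.trans h')
  have hex : ∃ j, whileFuel guard body j s ≠ none := ⟨j, hne⟩
  have hle : Nat.find hex ≤ j := Nat.find_min' hex hne
  have heq : whileLoop guard body s = whileFuel guard body (Nat.find hex) s := by
    unfold whileLoop
    exact dif_pos hex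
  rw [heq]
  obtain ⟨r', hr'⟩ := Option.ne_none_iff_exists'.mp (Nat.find_spec hex)
  have hmono : ∀ i, whileFuel guard body (Nat.find hex + i) s = some r' := by
    intro i
    induction i with
    | zero => exact hr'
    | succ i ih => exact whileFuel_succ_of_eq_some _ _ _ ih
  have h2 := hmono (j - Nat.find hex)
  rw [Nat.add_sub_cancel' hle] at h2
  exact hr'.trans (h2.symm.trans h)

/-- Total correctness of a while loop: `Inv j` is an invariant which guarantees that at most `j` more
rounds are needed. -/
theorem Comp.Sat.whileLoop {σ : Type} {guard : σ → Comp Bool} {body : σ → Comp σ} {og ag ob ab : ℕ}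
    (Inv : ℕ → σ → Prop) (Post : σ → Prop)
    (hguard : ∀ j s, Inv j s →
      (guard s).Sat og ag fun g => if g then j ≠ 0 else Post s)
    (hbody : ∀ j s, Inv (j + 1) s → (guard s).Sat og ag (fun g => g = true) →
      (body s).Sat ob ab (Inv j))
    (j : ℕ) (s : σ) (h : Inv j s) :
    (SubmodMax.whileLoop guard body s).Sat ((j + 1) * og + j * ob) ((j + 1) * ag + j * ab)
      Post := by
  suffices H : (whileFuel guard body (j + 1) s).Sat ((j + 1) * og + j * ob)
      ((j + 1) * ag + j * ab) Post by
    obtain ⟨r, c, h1, h2⟩ := H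
    exact ⟨r, c, whileLoop_eq_of_eq_some h1, h2⟩
  induction j generalizing s with
  | zero =>
    rw [whileFuel]
    obtain ⟨g, c, hg, ho, ha, hQ⟩ := hguard 0 s h
    cases g with
    | true => simp at hQ
    | false =>
      refine (Comp.Sat.bind (o := og) (a := ag) (o' := 0) (a' := 0)
        (Q := fun g => g = false ∧ Post s) ⟨false, c, hg, ho, ha, rfl, by simpa using hQ⟩ ?_).mono
        (by omega) (by omega) fun _ h => h
      rintro _ ⟨rfl, hp⟩
      exact Comp.Sat.pure hp
  | succ j ih =>
    rw [whileFuel]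
    obtain ⟨g, c, hg, ho, ha, hQ⟩ := hguard (j + 1) s h
    refine (Comp.Sat.bind (o := og) (a := ag) (o' := ob + ((j + 1) * og + j * ob))
      (a' := ab + ((j + 1) * ag + j * ab))
      (Q := fun g' => g' = g) ⟨g, c, hg, ho, ha, rfl⟩ ?_).mono
        (by ring_nf; omega) (by ring_nf; omega) fun _ h => h
    intro g' hg'
    subst hg'
    cases g' with
    | true =>
      rw [if_pos rfl]
      exact Comp.Sat.bind (hbody j s h ⟨true, c, hg, ho, ha, rfl⟩) fun s' hs' => ih s' hs'
    | false => exact Comp.Sat.pure (by simpa using hQ)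

/-- A while loop whose guard is a test on numbers. -/
theorem Comp.Sat.whileLoop_ops {σ : Type} {G : σ → Prop} [DecidablePred G] {body : σ → Comp σ}
    {i ob ab : ℕ} (Inv : ℕ → σ → Prop) (Post : σ → Prop)
    (hzero : ∀ s, Inv 0 s → ¬ G s) (hpost : ∀ j s, Inv j s → ¬ G s → Post s)
    (hbody : ∀ j s, Inv (j + 1) s → G s → (body s).Sat ob ab (Inv j))
    (j : ℕ) (s : σ) (h : Inv j s) :
    (SubmodMax.whileLoop (fun s => ops i (decide (G s))) body s).Sat (j * ob)
      ((j + 1) * i + j * ab) Post := by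
  refine (Comp.Sat.whileLoop (og := 0) (ag := i) (ob := ob) (ab := ab) Inv Post ?_ ?_ j s h).mono
    (by simp) le_rfl fun _ h => h
  · intro j s hs
    refine ⟨_, _, rfl, le_rfl, le_rfl, ?_⟩
    beta_reduce
    by_cases hG : G s
    · rw [if_pos (decide_eq_true hG)]
      rintro rfl
      exact hzero s hs hG
    · rw [if_neg (by simpa using hG)]
      exact hpost j s hs hG
  · rintro j s hs ⟨g, c, hg, -, -, hgt⟩
    refine hbody j s hs ?_
    have h1 : g = decide (G s) := by
      have h2 := congrArg (Option.map Prod.fst) hg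
      simpa [ops] using h2.symm
    exact of_decide_eq_true (h1.symm.trans hgt)

section Argmax

variable {n : ℕ}

theorem argmaxD_sat (L : List (Valued n)) (d : Valued n) :
    (argmaxD L d).Sat 0 L.length fun r =>
      (∀ x ∈ L, x.2 ≤ r.2) ∧ (r ∈ L ∨ L = [] ∧ r = d) := by
  classical
  refine ⟨_, _, rfl, le_rfl, le_rfl, ?_⟩
  rcases hL : L.argmax Prod.snd with _ | r
  · have hnil : L = [] := List.argmax_eq_none.mp hL
    subst hnil
    simp
  · have hmem : r ∈ L.argmax Prod.snd := by rw [hL]; rfl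
    exact ⟨fun x hx => List.le_of_mem_argmax hx hmem, Or.inl (List.argmax_mem hmem)⟩

end Argmax

theorem checkFeasible_sat {n k m : ℕ} (I : Instance n k m) (S : Finset (Fin n)) :
    (checkFeasible I S).Sat 1 (m * S.card) fun b => b = true ↔ I.Feasible S := by
  classical
  refine (Comp.Sat.askIndep_bind (o := 0) (a := m * S.card + 0) fun b hb => ?_).mono le_rfl le_rfl
    fun _ h => h
  refine Comp.Sat.ops_bind (Comp.Sat.pure ?_)
  rw [Bool.and_eq_true, hb, decide_eq_true_iff]
  exact Iff.rfl

/-! ### Submodular functions and matroids -/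

namespace Instance

variable {n k m : ℕ} (I : Instance n k m)

theorem f_insert_sub_le_of_subset {S T : Finset (Fin n)} {e : Fin n} (h : S ⊆ T) (he : e ∉ T) :
    I.f (insert e T) - I.f T ≤ I.f (insert e S) - I.f S :=
  I.submodular S T e h he

/-- Insert the elements of `O` one by one; by submodularity each gains at most what it gains over
`S` alone. -/
theorem f_union_le (S O : Finset (Fin n)) :
    I.f (S ∪ O) ≤ I.f S + ∑ o ∈ O, (I.f (insert o S) - I.f S) := by
  induction O using Finset.induction_on with
  | empty => simp
  | insert o O ho ih =>
    rw [Finset.sum_insert ho, Finset.union_insert]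
    by_cases hS : o ∈ S
    · rw [Finset.insert_eq_of_mem (Finset.mem_union_left O hS), Finset.insert_eq_of_mem hS]
      linarith
    · have h := I.f_insert_sub_le_of_subset (S := S) (T := S ∪ O) (e := o)
        Finset.subset_union_left (by simp [hS, ho])
      linarith

/-- The lattice form of submodularity: add the elements of `T \ S` one at a time to `S` and to its
subset `S ∩ T`, and compare the gains. -/
theorem f_union_add_f_inter_le (S T : Finset (Fin n)) :
    I.f (S ∪ T) + I.f (S ∩ T) ≤ I.f S + I.f T := by
  suffices H : ∀ D : Finset (Fin n), Disjoint D S →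
      I.f (S ∪ D) + I.f (S ∩ T) ≤ I.f S + I.f (S ∩ T ∪ D) by
    have h := H (T \ S) Finset.sdiff_disjoint
    rwa [Finset.union_sdiff_self_eq_union, Finset.inter_comm, Finset.union_comm (T ∩ S),
      Finset.sdiff_union_inter, Finset.inter_comm] at h
  intro D
  induction D using Finset.induction_on with
  | empty => intro _; simp
  | insert d D hd ih =>
    intro hdis
    rw [Finset.disjoint_insert_left] at hdis
    rw [Finset.union_insert, Finset.union_insert]
    have h := I.f_insert_sub_le_of_subset (S := S ∩ T ∪ D) (T := S ∪ D) (e := d)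
      (Finset.union_subset_union_left Finset.inter_subset_left) (by simp [hd, hdis.1])
    linarith [ih hdis.2]

/-- The marginal gain is largest over `∅`, and `f ∅ ≥ 0` may be dropped. -/
theorem f_singleton_le (S : Finset (Fin n)) (e : Fin n) :
    I.f (insert e S) - I.f S ≤ I.f {e} := by
  by_cases he : e ∈ S
  · rw [Finset.insert_eq_of_mem he, sub_self]; exact I.f_nonneg _
  · have h := I.f_insert_sub_le_of_subset (Finset.empty_subset S) he
    have := I.f_nonneg ∅
    rw [insert_empty_eq] at h
    linarith

/-- Adding pairwise disjoint sets to `T` decreases the value by at most `f T` in total. -/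
theorem sum_f_union_ge {ι : Type*} (J : Finset ι) (T : Finset (Fin n))
    (S : ι → Finset (Fin n)) (hS : ∀ i ∈ J, ∀ j ∈ J, i ≠ j → Disjoint (S i) (S j)) :
    ((J.card : ℝ) - 1) * I.f T ≤ ∑ i ∈ J, I.f (T ∪ S i) := by
  classical
  -- Keeping the value of the full union on the left makes the induction work: the sets `T ∪ S i`
  -- and `T ∪ J.biUnion S` meet exactly in `T`. Nonnegativity removes this term at the end.
  suffices H : (J.card : ℝ) * I.f T + I.f (T ∪ J.biUnion S) ≤ ∑ i ∈ J, I.f (T ∪ S i) + I.f T by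
    linarith [I.f_nonneg (T ∪ J.biUnion S)]
  induction J using Finset.induction_on with
  | empty => simp
  | insert i J hi ih =>
    have h1 := ih fun a ha b hb => hS a (by simp [ha]) b (by simp [hb])
    have h2 := I.f_union_add_f_inter_le (T ∪ S i) (T ∪ J.biUnion S)
    have h3 : (T ∪ S i) ∩ (T ∪ J.biUnion S) = T := by
      rw [← Finset.union_inter_distrib_left]
      have : Disjoint (S i) (J.biUnion S) := by
        rw [Finset.disjoint_biUnion_right]
        intro j hj
        exact hS i (by simp) j (by simp [hj]) (fun h => hi (h ▸ hj))
      rw [Finset.disjoint_iff_inter_eq_empty.mp this, Finset.union_empty]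
    have h4 : T ∪ S i ∪ (T ∪ J.biUnion S) = T ∪ (insert i J).biUnion S := by
      ext x; simp only [Finset.mem_union, Finset.biUnion_insert]; tauto
    rw [h3, h4] at h2
    rw [Finset.sum_insert hi, Finset.card_insert_of_notMem hi]
    push_cast
    linarith

/-! ### Downward closure, and budgets after normalization. -/

theorem Indep.subset {I : Instance n k m} {S T : Finset (Fin n)} (h : I.Indep T) (hST : S ⊆ T) :
    I.Indep S :=
  fun i => (h i).subset (by exact_mod_cast hST)

theorem cost_mono (j : Fin m) {S T : Finset (Fin n)} (hST : S ⊆ T) : I.cost j S ≤ I.cost j T :=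
  Finset.sum_le_sum_of_subset_of_nonneg hST fun e _ _ => I.c_nonneg j e

theorem Feasible.subset {I : Instance n k m} {S T : Finset (Fin n)} (h : I.Feasible T)
    (hST : S ⊆ T) : I.Feasible S :=
  ⟨h.1.subset hST, fun j => (I.cost_mono j hST).trans (h.2 j)⟩

theorem ncost_nonneg {A : Finset (Fin n)} (hA : I.Feasible A) (j : Fin m) (e : Fin n) :
    0 ≤ I.ncost A j e :=
  div_nonneg (I.c_nonneg j e) (sub_nonneg.mpr (hA.2 j))

theorem cost_union_of_disjoint (j : Fin m) {S T : Finset (Fin n)} (h : Disjoint S T) :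
    I.cost j (S ∪ T) = I.cost j S + I.cost j T :=
  Finset.sum_union h

theorem sum_ncost_eq (A S : Finset (Fin n)) (j : Fin m) :
    ∑ e ∈ S, I.ncost A j e = I.cost j S / (1 - I.cost j A) := by
  simp only [ncost, cost, Finset.sum_div]

/-- Normalized costs at most `1` mean that the budgets are respected. -/
theorem cost_union_le_one {A S : Finset (Fin n)} (hA : I.Feasible A) (hdis : Disjoint A S)
    (hfin : ∀ e ∈ S, I.FiniteNCost A e) {j : Fin m} (h : ∑ e ∈ S, I.ncost A j e ≤ 1) :
    I.cost j (A ∪ S) ≤ 1 := by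
  rw [I.cost_union_of_disjoint j hdis]
  rcases (hA.2 j).eq_or_lt with h1 | h1
  · have : I.cost j S = 0 := Finset.sum_eq_zero fun e he => hfin e he j h1
    linarith
  · rw [sum_ncost_eq, div_le_one (by linarith)] at h
    linarith

theorem sum_ncost_le_one {A S : Finset (Fin n)} (hdis : Disjoint A S) (h : I.Feasible (A ∪ S))
    (j : Fin m) : ∑ e ∈ S, I.ncost A j e ≤ 1 := by
  have h1 := h.2 j
  rw [I.cost_union_of_disjoint j hdis] at h1
  have h0 : 0 ≤ I.cost j S := Finset.sum_nonneg fun e _ => I.c_nonneg j e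
  rw [sum_ncost_eq]
  rcases eq_or_lt_of_le (show I.cost j A ≤ 1 by linarith) with h2 | h2
  -- With an exhausted budget all the quotients are `0` by the convention for division by zero; the
  -- intended infinite costs are handled by `FiniteNCost`.
  · simp [h2]
  · rw [div_le_one (by linarith)]; linarith

theorem finiteNCost_of_feasible {A S : Finset (Fin n)} (hdis : Disjoint A S)
    (h : I.Feasible (A ∪ S)) {e : Fin n} (he : e ∈ S) : I.FiniteNCost A e := by
  intro j hj
  have h1 := h.2 j
  rw [I.cost_union_of_disjoint j hdis, hj] at h1
  have h2 : I.c j e ≤ I.cost j S :=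
    Finset.single_le_sum (f := fun e => I.c j e) (fun e _ => I.c_nonneg j e) he
  exact le_antisymm (by linarith) (I.c_nonneg j e)

/-! ### Matroid exchange between a solution and the optimum. -/

open Classical in
/-- The elements of `O` that cannot be added to `A ∪ S` because of the `h`-th matroid. -/
noncomputable def blocked (A O S : Finset (Fin n)) (h : Fin k) : Finset (Fin n) :=
  O.filter fun o => ¬ (I.M h).Indep ((insert o (A ∪ S) : Finset (Fin n)) : Set (Fin n))

/-- If more than `|S \ O|` elements were blocked, then `A ∪ (O ∩ S)` with the blocked elements would
be an independent set larger than `A ∪ S`. Augmentation would then add one of the blocked elements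
to `A ∪ S`, a contradiction. -/
theorem card_blocked_le {A O S : Finset (Fin n)} (hAO : Disjoint A O) (hAS : Disjoint A S)
    (hopt : I.Indep (A ∪ O)) (hS : I.Indep (A ∪ S)) (h : Fin k) :
    (I.blocked A O S h).card ≤ (S \ O).card := by
  classical
  set B := I.blocked A O S h with hB
  have hBO : B ⊆ O := Finset.filter_subset _ _
  have hBind : ∀ b ∈ B, ¬ (I.M h).Indep ((insert b (A ∪ S) : Finset (Fin n)) : Set (Fin n)) :=
    fun b hb => (Finset.mem_filter.mp hb).2
  have hBS : Disjoint B (A ∪ S) := by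
    rw [Finset.disjoint_left]
    intro b hb hbS
    apply hBind b hb
    rw [Finset.insert_eq_of_mem hbS]
    exact hS h
  by_contra! hlt
  have hX : (I.M h).Indep ((A ∪ (O ∩ S ∪ B) : Finset (Fin n)) : Set (Fin n)) :=
    (hopt h).subset (by
      exact_mod_cast Finset.union_subset_union_right
        (Finset.union_subset Finset.inter_subset_left hBO))
  have hcard : (A ∪ S).card < (A ∪ (O ∩ S ∪ B)).card := by
    rw [Finset.card_union_of_disjoint hAS, Finset.card_union_of_disjoint,
      Finset.card_union_of_disjoint]
    · have := Finset.card_sdiff_add_card_inter S O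
      rw [Finset.inter_comm] at this
      omega
    · exact (Finset.disjoint_of_subset_right
        (Finset.inter_subset_right.trans Finset.subset_union_right) hBS).symm
    · exact hAO.mono_right (Finset.union_subset Finset.inter_subset_left hBO)
  obtain ⟨e, he, hins⟩ := (hS h).augment hX (by
    rw [Set.encard_coe_eq_coe_finsetCard, Set.encard_coe_eq_coe_finsetCard]
    exact_mod_cast hcard)
  have he' : e ∈ A ∪ (O ∩ S ∪ B) ∧ e ∉ A ∪ S := by simpa using he
  have heB : e ∈ B := by
    have h1 := he'.1
    have h2 := he'.2
    simp only [Finset.mem_union, Finset.mem_inter, not_or] at h1 h2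
    tauto
  apply hBind e heB
  rw [Finset.coe_insert]
  exact hins

end Instance

/-! ### The potential of a candidate solution -/

section Potential

variable {n k m : ℕ} (I : Instance n k m) (A O : Finset (Fin n)) (ρ : ℝ)

/-- The part of the gain of `o` over `A ∪ S` that is not paid by its density. -/
noncomputable def excess (S : Finset (Fin n)) (o : Fin n) : ℝ :=
  max 0 (I.f (insert o (A ∪ S)) - I.f (A ∪ S) - ρ * ∑ j, I.ncost A j o)

theorem excess_nonneg (S : Finset (Fin n)) (o : Fin n) : 0 ≤ excess I A ρ S o := le_max_left _ _

variable {I A ρ}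

theorem excess_eq_zero_of_mem (hA : I.Feasible A) (hρ : 0 ≤ ρ) {S : Finset (Fin n)} {o : Fin n}
    (ho : o ∈ S) : excess I A ρ S o = 0 := by
  rw [excess, Finset.insert_eq_of_mem (Finset.mem_union_right A ho), sub_self, zero_sub]
  apply max_eq_left
  have : 0 ≤ ρ * ∑ j, I.ncost A j o :=
    mul_nonneg hρ (Finset.sum_nonneg fun j _ => I.ncost_nonneg hA j o)
  linarith

/-- Growing solutions only lower marginal gains while densities stay fixed; thus a rejected element
remains poor, and a bound on its excess survives later insertions. -/
theorem excess_anti (hA : I.Feasible A) (hρ : 0 ≤ ρ) {S T : Finset (Fin n)} (hST : S ⊆ T)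
    {o : Fin n} (hoA : o ∉ A) : excess I A ρ T o ≤ excess I A ρ S o := by
  by_cases ho : o ∈ T
  · rw [excess_eq_zero_of_mem hA hρ ho]; exact excess_nonneg _ _ _ _ _
  · apply max_le_max le_rfl
    have := I.f_insert_sub_le_of_subset (S := A ∪ S) (T := A ∪ T) (e := o)
      (Finset.union_subset_union_right hST) (by simp [ho, hoA])
    linarith

variable (I A ρ)

open Classical in
/-- The excess of `o`, if `o` is used or blocked. -/
noncomputable def lostExcess (avail S : Finset (Fin n)) (o : Fin n) : ℝ :=
  if o ∈ avail ∧ I.Indep (insert o (A ∪ S)) then 0 else excess I A ρ S o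

/-- The loss caused by used and blocked elements, scaled by `c`, together with `τ` times the number of
elements of `O` that the matroids may still block at the expense of `S`. -/
noncomputable def potential (c τ : ℝ) (avail S : Finset (Fin n)) : ℝ :=
  c * ∑ o ∈ O, lostExcess I A ρ avail S o
    + τ * ∑ h, (((S \ O).card : ℝ) - ((I.blocked A O S h).card : ℝ))

variable {I A O ρ}

theorem lostExcess_nonneg (avail S : Finset (Fin n)) (o : Fin n) :
    0 ≤ lostExcess I A ρ avail S o := by
  unfold lostExcess; split_ifs
  · exact le_rfl
  · exact excess_nonneg _ _ _ _ _

theorem sum_card_sub_card_blocked_nonneg {S : Finset (Fin n)} (hAO : Disjoint A O)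
    (hAS : Disjoint A S) (hopt : I.Indep (A ∪ O)) (hS : I.Indep (A ∪ S)) :
    0 ≤ ∑ h, (((S \ O).card : ℝ) - ((I.blocked A O S h).card : ℝ)) :=
  Finset.sum_nonneg fun h _ => sub_nonneg.mpr (by
    exact_mod_cast I.card_blocked_le hAO hAS hopt hS h)

/-- The matroid slack that multiplies `τ` is nonnegative, so lowering the threshold preserves the
charging inequality. -/
theorem potential_anti {c τ τ' : ℝ} (hτ : τ' ≤ τ) {avail S : Finset (Fin n)} (hAO : Disjoint A O)
    (hAS : Disjoint A S) (hopt : I.Indep (A ∪ O)) (hS : I.Indep (A ∪ S)) :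
    potential I A O ρ c τ' avail S ≤ potential I A O ρ c τ avail S := by
  have := mul_le_mul_of_nonneg_right hτ (sum_card_sub_card_blocked_nonneg hAO hAS hopt hS)
  unfold potential
  linarith

/-- The potential of a solution into which the element `a` is not inserted. -/
theorem potential_erase_le {c τ : ℝ} (hτ : 0 ≤ τ) {avail S : Finset (Fin n)} {a : Fin n}
    (ha : a ∈ avail)
    (hunres : ∀ o ∈ O, o ∈ avail → I.Indep (insert o (A ∪ S)) → c * excess I A ρ S o ≤ τ) :
    potential I A O ρ c τ (avail.erase a) S ≤
      potential I A O ρ c τ avail S + if a ∈ O then τ else 0 := by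
  classical
  -- Only `a` can change its status. If it was still a candidate for `S`, its scaled excess was at
  -- most `τ`.
  have key : ∀ o ∈ O, c * lostExcess I A ρ (avail.erase a) S o ≤
      c * lostExcess I A ρ avail S o + if o = a then τ else 0 := by
    intro o ho
    by_cases hoa : o = a
    · subst hoa
      rw [if_pos rfl, lostExcess, lostExcess, if_neg (by simp)]
      split_ifs with h
      · simpa using hunres o ho h.1 h.2
      · linarith
    · have : o ∈ avail.erase a ↔ o ∈ avail := by simp [hoa]
      simp [lostExcess, this, hoa]
  have hsum := Finset.sum_le_sum key
  rw [Finset.sum_add_distrib, Finset.sum_ite_eq', ← Finset.mul_sum, ← Finset.mul_sum] at hsum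
  unfold potential
  linarith

/-- The potential of the solution into which the element `a` is inserted. -/
theorem potential_insert_le {c τ : ℝ} (hc : 0 ≤ c) (hτ : 0 ≤ τ) (hρ : 0 ≤ ρ) (hA : I.Feasible A)
    (hAO : Disjoint A O) {avail S : Finset (Fin n)} {a : Fin n} (haS : a ∉ S)
    (hins : I.Indep (A ∪ insert a S))
    (hunres : ∀ o ∈ O, o ∈ avail → I.Indep (insert o (A ∪ S)) → c * excess I A ρ S o ≤ τ) :
    potential I A O ρ c τ (avail.erase a) (insert a S) ≤
      potential I A O ρ c τ avail S + if a ∈ O then 0 else k * τ := by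
  classical
  -- The elements of `O` that become blocked by this insertion. Each adds at most `τ` to the loss
  -- and uses up at least one unit of the slack weighted by `τ`, so these two effects cancel.
  set N := O.filter fun o => I.Indep (insert o (A ∪ S)) ∧ ¬ I.Indep (insert o (A ∪ insert a S))
    with hN
  have hsub : ∀ o, insert o (A ∪ S) ⊆ insert o (A ∪ insert a S) := fun o =>
    Finset.insert_subset_insert _ (Finset.union_subset_union_right (Finset.subset_insert _ _))
  have hBsub : ∀ h, I.blocked A O S h ⊆ I.blocked A O (insert a S) h := by
    intro h o ho
    rw [Instance.blocked, Finset.mem_filter] at ho ⊢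
    exact ⟨ho.1, fun hi => ho.2 (hi.subset (by exact_mod_cast hsub o))⟩
  have hNle : (N.card : ℝ) ≤ ∑ h, (((I.blocked A O (insert a S) h).card : ℝ) -
      ((I.blocked A O S h).card : ℝ)) := by
    have h1 : N ⊆ Finset.univ.biUnion fun h => I.blocked A O (insert a S) h \ I.blocked A O S h := by
      intro o ho
      obtain ⟨hoO, hi, hni⟩ := Finset.mem_filter.mp ho
      simp only [Instance.Indep, not_forall] at hni
      obtain ⟨h, hh⟩ := hni
      refine Finset.mem_biUnion.mpr ⟨h, Finset.mem_univ _, ?_⟩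
      rw [Finset.mem_sdiff, Instance.blocked, Instance.blocked, Finset.mem_filter,
        Finset.mem_filter]
      exact ⟨⟨hoO, hh⟩, fun hc => hc.2 (hi h)⟩
    have h2 := (Finset.card_le_card h1).trans Finset.card_biUnion_le
    have h3 : (N.card : ℝ) ≤ ((∑ h, (I.blocked A O (insert a S) h \ I.blocked A O S h).card : ℕ) : ℝ) :=
      Nat.cast_le.mpr h2
    refine h3.trans ?_
    push_cast
    refine Finset.sum_le_sum fun h _ => ?_
    rw [Finset.card_sdiff_of_subset (hBsub h), Nat.cast_sub (Finset.card_le_card (hBsub h))]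
  have key : ∀ o ∈ O, c * lostExcess I A ρ (avail.erase a) (insert a S) o ≤
      c * lostExcess I A ρ avail S o + if o ∈ N then τ else 0 := by
    intro o ho
    have hoA : o ∉ A := fun h => Finset.disjoint_left.mp hAO h ho
    have h0 := mul_nonneg hc (lostExcess_nonneg (I := I) (A := A) (ρ := ρ) avail S o)
    have hite : (0 : ℝ) ≤ if o ∈ N then τ else 0 := by split_ifs <;> simp [hτ]
    have hmono : c * excess I A ρ (insert a S) o ≤ c * excess I A ρ S o :=
      mul_le_mul_of_nonneg_left (excess_anti hA hρ (Finset.subset_insert a S) hoA) hc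
    rw [lostExcess]
    split_ifs with h hn hn
    · simp only [mul_zero]; linarith
    · simp only [mul_zero]; linarith
    · by_cases hav : o ∈ avail
      · have := hunres o ho hav (Finset.mem_filter.mp hn).2.1
        linarith
      · rw [lostExcess, if_neg (by simp [hav])]; linarith
    · by_cases hoa : o = a
      · subst hoa
        rw [excess_eq_zero_of_mem hA hρ (Finset.mem_insert_self o S)]
        linarith
      · rw [lostExcess]
        split_ifs with h'
        · exfalso
          apply hn
          refine Finset.mem_filter.mpr ⟨ho, h'.2, fun hi => h ⟨?_, hi⟩⟩
          exact Finset.mem_erase.mpr ⟨hoa, h'.1⟩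
        · linarith
  have hsum := Finset.sum_le_sum key
  have hNO : O ∩ N = N := Finset.inter_eq_right.mpr (Finset.filter_subset _ _)
  rw [Finset.sum_add_distrib, Finset.sum_ite_mem, hNO, Finset.sum_const, nsmul_eq_mul,
    ← Finset.mul_sum, ← Finset.mul_sum] at hsum
  -- This is the source of `k * τ`: an element outside `O` increases `|S \ O|` by one in each of the
  -- `k` matroid terms. An element of `O` increases none of them, and its own excess vanishes once
  -- it is in the solution.
  have hcard : ((insert a S \ O).card : ℝ) = ((S \ O).card : ℝ) + if a ∈ O then 0 else 1 := by
    split_ifs with h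
    · rw [Finset.insert_sdiff_of_mem _ h, add_zero]
    · rw [Finset.insert_sdiff_of_notMem _ h, Finset.card_insert_of_notMem (by simp [haS])]
      push_cast; ring
  have hNτ := mul_le_mul_of_nonneg_left hNle hτ
  unfold potential
  rw [Finset.sum_sub_distrib] at hNτ ⊢
  rw [Finset.sum_sub_distrib, hcard]
  simp only [Finset.sum_const, Finset.card_univ, Fintype.card_fin, nsmul_eq_mul]
  split_ifs at hsum ⊢ <;> nlinarith

end Potential

/-! ### Analysis of KnapsackSGS -/

section SGS

variable {n k m ℓ : ℕ} (I : Instance n k m) (A : Finset (Fin n))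

/-- The state after the insertion of `q.1` into the solution `q.2`. -/
noncomputable def SGSState.insert (s : SGSState n m ℓ) (q : Fin n × Fin ℓ) : SGSState n m ℓ where
  sol := Function.update s.sol q.2 (Insert.insert q.1 (s.sol q.2))
  val := Function.update s.val q.2 (I.f (A ∪ Insert.insert q.1 (s.sol q.2)))
  load := Function.update s.load q.2 fun j => s.load q.2 j + I.ncost A j q.1
  avail := s.avail.erase q.1
  E := s.E

/-- The element `q.1` is available and passes the tests of the `q.2`-th solution except for the
knapsacks. -/
def Acceptable (ρ τ : ℝ) (s : SGSState n m ℓ) (q : Fin n × Fin ℓ) : Prop :=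
  q.1 ∈ s.avail ∧ I.Indep (A ∪ insert q.1 (s.sol q.2)) ∧ I.FiniteNCost A q.1 ∧
    max τ (ρ * ∑ j, I.ncost A j q.1) ≤ I.f (A ∪ insert q.1 (s.sol q.2)) - s.val q.2

theorem sgsPair_sat (ρ τ : ℝ) (s : SGSState n m ℓ) (q : Fin n × Fin ℓ) :
    (sgsPair I A ρ τ s q).Sat 2 (7 * m + 3) fun s' =>
      ¬ Acceptable I A ρ τ s q ∧ s' = s ∨
      Acceptable I A ρ τ s q ∧
        ((∀ j, s.load q.2 j + I.ncost A j q.1 ≤ 1) ∧ s' = s.insert I A q ∨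
         (¬ ∀ j, s.load q.2 j + I.ncost A j q.1 ≤ 1) ∧ s' = { s with E := true }) := by
  classical
  unfold sgsPair
  by_cases hav : q.1 ∈ s.avail
  · rw [if_neg (not_not.mpr hav)]
    refine (Comp.Sat.askIndep_bind (o := 1) (a := 7 * m + 3) fun b hb => ?_).mono le_rfl le_rfl
      fun _ h => h
    cases b with
    | false =>
      refine Comp.Sat.pure (Or.inl ⟨fun h => ?_, rfl⟩)
      exact absurd (hb.mpr h.2.1) (by simp)
    | true =>
      have hind := hb.mp rfl
      refine (Comp.Sat.askValue_bind (o := 0) (a := 7 * m + 3) ?_).mono le_rfl le_rfl fun _ h => h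
      refine (Comp.Sat.ops_bind (a := 7 * m + 2) ?_).mono le_rfl (by omega) fun _ h => h
      refine (Comp.Sat.ops_bind (a := 4 * m + 2) ?_).mono le_rfl (by omega) fun _ h => h
      refine (Comp.Sat.ops_bind (a := 3 * m) ?_).mono le_rfl (by omega) fun _ h => h
      split_ifs with hok
      · refine Comp.Sat.pure (Or.inl ⟨fun h => ?_, rfl⟩)
        simp only [Bool.not_eq_true', decide_eq_false_iff_not] at hok
        exact hok h.2.2
      · simp only [Bool.not_eq_true', decide_eq_false_iff_not, not_not] at hok
        have hacc : Acceptable I A ρ τ s q := ⟨hav, hind, hok⟩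
        refine (Comp.Sat.ops_bind (a := m) ?_).mono le_rfl (by omega) fun _ h => h
        refine (Comp.Sat.ops_bind (a := 0) ?_).mono le_rfl (by omega) fun _ h => h
        split_ifs with hfit
        · exact Comp.Sat.pure (Or.inr ⟨hacc, Or.inl ⟨of_decide_eq_true hfit, rfl⟩⟩)
        · exact Comp.Sat.pure (Or.inr ⟨hacc, Or.inr ⟨by simpa using hfit, rfl⟩⟩)
  · rw [if_pos hav]
    exact Comp.Sat.pure (Or.inl ⟨fun h => hav h.1, rfl⟩)

/-- What holds during KnapsackSGS, where `N` is the ground set and `v` bounds the values of its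
elements. -/
structure SGSInv (N : Finset (Fin n)) (ρ v : ℝ) (s : SGSState n m ℓ) : Prop where
  val_eq : ∀ i, s.val i = I.f (A ∪ s.sol i)
  val_ge : ∀ i, I.f A ≤ s.val i
  load_eq : ∀ i j, s.load i j = ∑ e ∈ s.sol i, I.ncost A j e
  load_le : ∀ i j, s.load i j ≤ 1
  dens : ∀ i, ρ * ∑ j, s.load i j ≤ s.val i - I.f A
  finite : ∀ i, ∀ e ∈ s.sol i, I.FiniteNCost A e
  indep : ∀ i, I.Indep (A ∪ s.sol i)
  sol_subset : ∀ i, s.sol i ⊆ N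
  avail_subset : s.avail ⊆ N
  disjoint_avail : ∀ i, Disjoint (s.sol i) s.avail
  disjoint : ∀ i i', i ≠ i' → Disjoint (s.sol i) (s.sol i')
  of_E : s.E = true → ∃ i, I.f A + ρ - v ≤ s.val i

/-- What holds during KnapsackSGS with respect to a set `O` as long as no knapsack was violated. -/
structure OptInv (O : Finset (Fin n)) (p : ℕ) (ρ c τ : ℝ) (s : SGSState n m ℓ) : Prop where
  unresolved : ∀ i, ∀ o ∈ O, o ∈ s.avail → I.Indep (insert o (A ∪ s.sol i)) →
    c * excess I A ρ (s.sol i) o ≤ τ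
  potential_le : ∑ i, potential I A O ρ c τ s.avail (s.sol i) ≤ p * ∑ i, (s.val i - I.f A)

/-- The pairs of the list `L` were rejected unless their elements are used or blocked. -/
def Processed (O : Finset (Fin n)) (ρ τ : ℝ) (L : List (Fin n × Fin ℓ)) (s : SGSState n m ℓ) :
    Prop :=
  ∀ q ∈ L, q.1 ∈ O → q.1 ∈ s.avail → I.Indep (insert q.1 (A ∪ s.sol q.2)) →
    excess I A ρ (s.sol q.2) q.1 ≤ τ

variable {I A} {N O : Finset (Fin n)} {ρ τ v c : ℝ} {p : ℕ} {s : SGSState n m ℓ}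
  {q : Fin n × Fin ℓ}

theorem SGSInv.dens_insert (h : SGSInv I A N ρ v s) (hq : Acceptable I A ρ τ s q) :
    ρ * ∑ j, (s.load q.2 j + I.ncost A j q.1) ≤
      I.f (A ∪ insert q.1 (s.sol q.2)) - I.f A := by
  have h1 := h.dens q.2
  have h2 := (le_max_right _ _).trans hq.2.2.2
  rw [Finset.sum_add_distrib, mul_add]
  linarith

theorem SGSInv.step (h : SGSInv I A N ρ v s) (hτ : 0 ≤ τ) (hq : Acceptable I A ρ τ s q)
    (hfit : ∀ j, s.load q.2 j + I.ncost A j q.1 ≤ 1) : SGSInv I A N ρ v (s.insert I A q) := by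
  have hgain := (le_max_left _ _).trans hq.2.2.2
  have hqS : ∀ i, q.1 ∉ s.sol i := fun i hi =>
    Finset.disjoint_left.mp (h.disjoint_avail i) hi hq.1
  have hval : ∀ i, s.val i ≤ (s.insert I A q).val i := by
    intro i
    by_cases hi : i = q.2
    · subst hi; simp only [SGSState.insert, Function.update_self]; linarith
    · simp [SGSState.insert, Function.update_of_ne hi]
  refine ⟨?_, fun i => (h.val_ge i).trans (hval i), ?_, ?_, ?_, ?_, ?_, ?_, ?_, ?_, ?_, ?_⟩
  · intro i
    by_cases hi : i = q.2
    · subst hi; simp [SGSState.insert]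
    · simpa [SGSState.insert, Function.update_of_ne hi] using h.val_eq i
  · intro i j
    by_cases hi : i = q.2
    · subst hi
      simp only [SGSState.insert, Function.update_self]
      rw [Finset.sum_insert (hqS _), h.load_eq, add_comm]
    · simpa [SGSState.insert, Function.update_of_ne hi] using h.load_eq i j
  · intro i j
    by_cases hi : i = q.2
    · subst hi; simpa only [SGSState.insert, Function.update_self] using hfit j
    · simpa [SGSState.insert, Function.update_of_ne hi] using h.load_le i j
  · intro i
    by_cases hi : i = q.2
    · subst hi
      simpa only [SGSState.insert, Function.update_self] using h.dens_insert hq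
    · simpa [SGSState.insert, Function.update_of_ne hi] using h.dens i
  · intro i
    by_cases hi : i = q.2
    · subst hi
      simp only [SGSState.insert, Function.update_self]
      intro e he
      rcases Finset.mem_insert.mp he with rfl | he
      · exact hq.2.2.1
      · exact h.finite _ e he
    · simpa [SGSState.insert, Function.update_of_ne hi] using h.finite i
  · intro i
    by_cases hi : i = q.2
    · subst hi; simpa only [SGSState.insert, Function.update_self] using hq.2.1
    · simpa [SGSState.insert, Function.update_of_ne hi] using h.indep i
  · intro i
    by_cases hi : i = q.2
    · subst hi
      simp only [SGSState.insert, Function.update_self]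
      exact Finset.insert_subset (h.avail_subset hq.1) (h.sol_subset _)
    · simpa [SGSState.insert, Function.update_of_ne hi] using h.sol_subset i
  · exact (Finset.erase_subset _ _).trans h.avail_subset
  · intro i
    by_cases hi : i = q.2
    · subst hi
      simp only [SGSState.insert, Function.update_self]
      rw [Finset.disjoint_insert_left]
      exact ⟨Finset.notMem_erase _ _, (h.disjoint_avail _).mono_right (Finset.erase_subset _ _)⟩
    · simpa [SGSState.insert, Function.update_of_ne hi] using
        (h.disjoint_avail i).mono_right (Finset.erase_subset _ _)
  · intro i i' hii
    by_cases hi : i = q.2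
    · subst hi
      simp only [SGSState.insert, Function.update_self, Function.update_of_ne hii.symm]
      rw [Finset.disjoint_insert_left]
      exact ⟨hqS _, h.disjoint _ _ hii⟩
    · by_cases hi' : i' = q.2
      · subst hi'
        simp only [SGSState.insert, Function.update_self, Function.update_of_ne hi]
        rw [Finset.disjoint_insert_right]
        exact ⟨hqS _, h.disjoint _ _ hii⟩
      · simpa [SGSState.insert, Function.update_of_ne hi, Function.update_of_ne hi'] using
          h.disjoint _ _ hii
  · intro hE
    obtain ⟨i, hi⟩ := h.of_E hE
    exact ⟨i, hi.trans (hval i)⟩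

/-- One overfull knapsack makes the total normalized cost of the enlarged solution exceed 1, hence
its gain is at least `ρ`. The refused element itself is worth at most `v`. -/
theorem SGSInv.set_E (h : SGSInv I A N ρ v s) (hA : I.Feasible A) (hρ : 0 ≤ ρ)
    (hv : ∀ e ∈ N, I.f {e} ≤ v) (hq : Acceptable I A ρ τ s q)
    (hfit : ¬ ∀ j, s.load q.2 j + I.ncost A j q.1 ≤ 1) :
    SGSInv I A N ρ v { s with E := true } := by
  refine ⟨h.val_eq, h.val_ge, h.load_eq, h.load_le, h.dens, h.finite, h.indep, h.sol_subset,
    h.avail_subset, h.disjoint_avail, h.disjoint, fun _ => ⟨q.2, ?_⟩⟩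
  push Not at hfit
  obtain ⟨j, hj⟩ := hfit
  have h1 := h.dens_insert hq
  have h2 : 1 ≤ ∑ j, (s.load q.2 j + I.ncost A j q.1) := by
    refine hj.le.trans (Finset.single_le_sum
      (f := fun j => s.load q.2 j + I.ncost A j q.1) (fun j _ => ?_) (Finset.mem_univ j))
    rw [h.load_eq]
    exact add_nonneg (Finset.sum_nonneg fun e _ => I.ncost_nonneg hA j e) (I.ncost_nonneg hA j _)
  have h3 := mul_le_mul_of_nonneg_left h2 hρ
  have h4 := I.f_singleton_le (A ∪ s.sol q.2) q.1
  have h5 := hv _ (h.avail_subset hq.1)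
  have h6 := h.val_eq q.2
  rw [← Finset.union_insert] at h4
  change _ ≤ s.val q.2
  linarith

/-- The total gain rises by at least `τ`, so the right side rises by at least `pτ`. The potential
rises by at most `(ℓ-1)τ` if the element is in `O` and by at most `kτ` otherwise; this is why `p`
must dominate both `ℓ-1` and `k`. -/
theorem OptInv.step (h : OptInv I A O p ρ c τ s) (hs : SGSInv I A N ρ v s) (hA : I.Feasible A)
    (hc : 0 ≤ c) (hτ : 0 ≤ τ) (hρ : 0 ≤ ρ) (hAO : Disjoint A O) (hk : k ≤ p) (hℓ : ℓ ≤ p + 1)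
    (hq : Acceptable I A ρ τ s q) : OptInv I A O p ρ c τ (s.insert I A q) := by
  have hgain := (le_max_left _ _).trans hq.2.2.2
  have hqS : q.1 ∉ s.sol q.2 := fun hi =>
    Finset.disjoint_left.mp (hs.disjoint_avail _) hi hq.1
  constructor
  · intro i o ho hav hind
    have hav' := Finset.mem_of_mem_erase hav
    have hoA : o ∉ A := fun h => Finset.disjoint_left.mp hAO h ho
    by_cases hi : i = q.2
    · subst hi
      simp only [SGSState.insert, Function.update_self] at hind ⊢
      have hsub : s.sol q.2 ⊆ Insert.insert q.1 (s.sol q.2) := Finset.subset_insert _ _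
      refine (mul_le_mul_of_nonneg_left (excess_anti hA hρ hsub hoA) hc).trans ?_
      exact h.unresolved _ o ho hav' (hind.subset
        (Finset.insert_subset_insert _ (Finset.union_subset_union_right hsub)))
    · simp only [SGSState.insert, Function.update_of_ne hi] at hind ⊢
      exact h.unresolved i o ho hav' hind
  · have hpot : ∀ i, potential I A O ρ c τ (s.insert I A q).avail ((s.insert I A q).sol i) ≤
        potential I A O ρ c τ s.avail (s.sol i) +
          ((if q.1 ∈ O then τ else 0) +
            if i = q.2 then ((if q.1 ∈ O then 0 else k * τ) - if q.1 ∈ O then τ else 0) else 0) := by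
      intro i
      by_cases hi : i = q.2
      · subst hi
        simp only [SGSState.insert, Function.update_self, if_true]
        have := potential_insert_le (avail := s.avail) hc hτ hρ hA hAO hqS hq.2.1
          (h.unresolved q.2)
        linarith
      · simp only [SGSState.insert, Function.update_of_ne hi, if_neg hi]
        have := potential_erase_le hτ hq.1 (h.unresolved i)
        linarith
    have hsum := Finset.sum_le_sum fun i (_ : i ∈ Finset.univ) => hpot i
    rw [Finset.sum_add_distrib, Finset.sum_add_distrib, Finset.sum_ite_eq' Finset.univ q.2,
      if_pos (Finset.mem_univ _), Finset.sum_const, Finset.card_univ, Fintype.card_fin,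
      nsmul_eq_mul] at hsum
    have hval : ∀ i, s.val i - I.f A + (if i = q.2 then τ else 0) ≤
        (s.insert I A q).val i - I.f A := by
      intro i
      by_cases hi : i = q.2
      · subst hi; simp only [SGSState.insert, Function.update_self, if_true]; linarith
      · simp [SGSState.insert, hi]
    have hvsum := Finset.sum_le_sum fun i (_ : i ∈ Finset.univ) => hval i
    rw [Finset.sum_add_distrib, Finset.sum_ite_eq' Finset.univ q.2,
      if_pos (Finset.mem_univ _)] at hvsum
    have hpv := mul_le_mul_of_nonneg_left hvsum (Nat.cast_nonneg (α := ℝ) p)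
    have h1 := h.potential_le
    have hkτ : (k : ℝ) * τ ≤ p * τ := mul_le_mul_of_nonneg_right (by exact_mod_cast hk) hτ
    have hℓτ : (ℓ : ℝ) * τ ≤ (p + 1) * τ := mul_le_mul_of_nonneg_right (by exact_mod_cast hℓ) hτ
    rw [mul_add] at hpv
    refine (hsum.trans ?_).trans hpv
    split_ifs <;> linarith

/-- After a full pass every surviving candidate was rejected, so its excess is at most `τ`. Scaling
by `c = 1-ε`, the decay of the threshold, gives the bound required for the next threshold `cτ`. -/
theorem OptInv.next (h : OptInv I A O p ρ c τ s) (hs : SGSInv I A N ρ v s) (hAN : Disjoint A N)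
    (hAO : Disjoint A O) (hopt : I.Indep (A ∪ O)) (hc : 0 ≤ c) (hc1 : c ≤ 1) (hτ : 0 ≤ τ)
    {L : List (Fin n × Fin ℓ)} (hL : Processed I A O ρ τ L s)
    (hall : ∀ o ∈ O, ∀ i, o ∈ s.avail → (o, i) ∈ L) : OptInv I A O p ρ c (c * τ) s := by
  constructor
  · intro i o ho hav hind
    exact mul_le_mul_of_nonneg_left (hL (o, i) (hall o ho i hav) ho hav hind) hc
  · refine le_trans (Finset.sum_le_sum fun i _ => ?_) h.potential_le
    exact potential_anti (by nlinarith) hAO (hAN.mono_right (hs.sol_subset i)) hopt (hs.indep i)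

/-- The invariants of one pass of KnapsackSGS. -/
theorem sgsPair_inv (hA : I.Feasible A) (hρ : 0 ≤ ρ) (hτ : 0 ≤ τ) (hc : 0 ≤ c)
    (hv : ∀ e ∈ N, I.f {e} ≤ v) (hAO : Disjoint A O) (hfin : ∀ o ∈ O, I.FiniteNCost A o)
    (hk : k ≤ p) (hℓ : ℓ ≤ p + 1) {L : List (Fin n × Fin ℓ)} (hs : SGSInv I A N ρ v s)
    (hopt : s.E = false → OptInv I A O p ρ c τ s ∧ Processed I A O ρ τ L s) :
    (sgsPair I A ρ τ s q).Sat 2 (7 * m + 3) fun s' => SGSInv I A N ρ v s' ∧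
      (s'.E = false → OptInv I A O p ρ c τ s' ∧ Processed I A O ρ τ (L ++ [q]) s') := by
  refine (sgsPair_sat I A ρ τ s q).mono le_rfl le_rfl ?_
  rintro s' (⟨hq, rfl⟩ | ⟨hq, ⟨hfit, rfl⟩ | ⟨hfit, rfl⟩⟩)
  · refine ⟨hs, fun hE => ⟨(hopt hE).1, fun q' hq' => ?_⟩⟩
    rcases List.mem_append.mp hq' with hq' | hq'
    · exact (hopt hE).2 q' hq'
    · rw [List.mem_singleton] at hq'
      subst hq'
      intro ho hav hind
      have hd : 0 ≤ ρ * ∑ j, I.ncost A j q'.1 :=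
        mul_nonneg hρ (Finset.sum_nonneg fun j _ => I.ncost_nonneg hA j _)
      have hlt : I.f (A ∪ insert q'.1 (s'.sol q'.2)) - s'.val q'.2 <
          max τ (ρ * ∑ j, I.ncost A j q'.1) := by
        by_contra! hle
        exact hq ⟨hav, by rwa [Finset.union_insert], hfin _ ho, hle⟩
      rw [hs.val_eq, Finset.union_insert] at hlt
      -- The element failed the density test, which makes its excess zero, or the threshold test,
      -- which bounds its gain by `τ`.
      refine max_le hτ ?_
      rcases lt_max_iff.mp hlt with h | h <;> linarith
  · refine ⟨hs.step hτ hq hfit, fun hE => ?_⟩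
    obtain ⟨ho, hp⟩ := hopt hE
    refine ⟨ho.step hs hA hc hτ hρ hAO hk hℓ hq, fun q' hq' => ?_⟩
    rcases List.mem_append.mp hq' with hq' | hq'
    · intro hoO hav hind
      have hav' := Finset.mem_of_mem_erase hav
      have hoA : q'.1 ∉ A := fun h => Finset.disjoint_left.mp hAO h hoO
      by_cases hi : q'.2 = q.2
      · have hsol : (s.insert I A q).sol q'.2 = insert q.1 (s.sol q'.2) := by
          simp [SGSState.insert, hi]
        rw [hsol] at hind ⊢
        have hsub : s.sol q'.2 ⊆ insert q.1 (s.sol q'.2) := Finset.subset_insert _ _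
        refine (excess_anti hA hρ hsub hoA).trans (hp q' hq' hoO hav' (hind.subset
          (Finset.insert_subset_insert _ (Finset.union_subset_union_right hsub))))
      · simp only [SGSState.insert, Function.update_of_ne hi] at hind ⊢
        exact hp q' hq' hoO hav' hind
    · rw [List.mem_singleton] at hq'
      subst hq'
      intro _ hav
      exact absurd hav (Finset.notMem_erase _ _)
  · exact ⟨hs.set_E hA hρ hv hq hfit, fun hE => by simp at hE⟩

/-- The guarantee for the solutions when no knapsack was violated. -/
theorem OptInv.guarantee (h : OptInv I A O p ρ c τ s) (hs : SGSInv I A N ρ v s)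
    (hAN : Disjoint A N) (hAO : Disjoint A O) (hopt : I.Feasible (A ∪ O)) (hc : 0 ≤ c)
    (hρ : 0 ≤ ρ) (hτ : 0 ≤ τ) {W δ : ℝ} (hW : ∀ i, s.val i ≤ W) (hδ : n * τ ≤ δ) :
    c * ((ℓ : ℝ) - 1) * I.f (A ∪ O) ≤
      ℓ * (c * W + p * (W - I.f A) + c * m * ρ + δ) := by
  have hdisj := I.sum_f_union_ge Finset.univ (A ∪ O) s.sol
    fun i _ i' _ hii => hs.disjoint i i' hii
  rw [Finset.card_univ, Fintype.card_fin] at hdisj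
  have hcard : (O.card : ℝ) ≤ n := by
    have := Finset.card_le_univ O
    rw [Fintype.card_fin] at this
    exact_mod_cast this
  -- Since `O` fits into each of the `m` budgets, densities account for at most `ρm`. Excesses of
  -- used or blocked elements are in the potential; each of the others is at most `τ` after scaling.
  have hone : ∀ i, c * I.f (A ∪ O ∪ s.sol i) ≤
      c * s.val i + c * (ρ * m) + n * τ + potential I A O ρ c τ s.avail (s.sol i) := by
    intro i
    have h1 := I.f_union_le (A ∪ s.sol i) O
    have h2 : ∑ o ∈ O, (I.f (insert o (A ∪ s.sol i)) - I.f (A ∪ s.sol i)) ≤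
        ∑ o ∈ O, (ρ * ∑ j, I.ncost A j o + excess I A ρ (s.sol i) o) := by
      refine Finset.sum_le_sum fun o _ => ?_
      have := le_max_right 0
        (I.f (insert o (A ∪ s.sol i)) - I.f (A ∪ s.sol i) - ρ * ∑ j, I.ncost A j o)
      unfold excess
      linarith
    have h3 : ∑ o ∈ O, ρ * ∑ j, I.ncost A j o ≤ ρ * m := by
      rw [← Finset.mul_sum, Finset.sum_comm]
      refine mul_le_mul_of_nonneg_left ?_ hρ
      calc ∑ j, ∑ o ∈ O, I.ncost A j o ≤ ∑ _j : Fin m, (1 : ℝ) :=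
            Finset.sum_le_sum fun j _ => I.sum_ncost_le_one hAO hopt j
        _ = m := by simp
    have h4 : ∑ o ∈ O, c * excess I A ρ (s.sol i) o ≤
        ∑ o ∈ O, (c * lostExcess I A ρ s.avail (s.sol i) o + τ) := by
      refine Finset.sum_le_sum fun o ho => ?_
      unfold lostExcess
      split_ifs with hr
      · simpa using h.unresolved i o ho hr.1 hr.2
      · linarith
    rw [Finset.sum_add_distrib, Finset.sum_const, nsmul_eq_mul, ← Finset.mul_sum,
      ← Finset.mul_sum] at h4
    have h5 := mul_nonneg hτ (sum_card_sub_card_blocked_nonneg hAO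
      (hAN.mono_right (hs.sol_subset i)) hopt.1 (hs.indep i))
    have h6 := mul_le_mul_of_nonneg_right hcard hτ
    have h7 : A ∪ O ∪ s.sol i = A ∪ s.sol i ∪ O := by
      rw [Finset.union_assoc, Finset.union_comm O, Finset.union_assoc]
    rw [Finset.sum_add_distrib] at h2
    rw [h7]
    have h8 : I.f (A ∪ s.sol i ∪ O) ≤
        s.val i + ρ * m + ∑ o ∈ O, excess I A ρ (s.sol i) o := by
      rw [hs.val_eq]; linarith
    have h9 := mul_le_mul_of_nonneg_left h8 hc
    unfold potential
    linarith
  have hsum := Finset.sum_le_sum fun i (_ : i ∈ Finset.univ) => hone i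
  rw [← Finset.mul_sum, Finset.sum_add_distrib] at hsum
  have hval : ∑ i, (c * s.val i + c * (ρ * m) + n * τ) + p * ∑ i, (s.val i - I.f A) ≤
      ℓ * (c * W + p * (W - I.f A) + c * m * ρ + δ) := by
    rw [Finset.mul_sum, ← Finset.sum_add_distrib]
    calc _ ≤ ∑ _i : Fin ℓ, (c * W + p * (W - I.f A) + c * m * ρ + δ) := by
          refine Finset.sum_le_sum fun i _ => ?_
          have e1 := mul_le_mul_of_nonneg_left (hW i) hc
          have e2 := mul_le_mul_of_nonneg_left (hW i) (Nat.cast_nonneg (α := ℝ) p)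
          linarith
      _ = _ := by rw [Finset.sum_const, Finset.card_univ, Fintype.card_fin, nsmul_eq_mul]
  have := mul_le_mul_of_nonneg_left hdisj hc
  linarith [h.potential_le]

/-- What KnapsackSGS guarantees. -/
structure SGSPost (I : Instance n k m) (A O : Finset (Fin n)) (p ℓ : ℕ) (V ρ ε v : ℝ)
    (r : Valued n × Bool) : Prop where
  feasible : I.Feasible (A ∪ r.1.1)
  value_eq : r.1.2 = I.f (A ∪ r.1.1)
  value_ge : I.f A ≤ r.1.2
  of_true : 0 < V → r.2 = true → I.f A + ρ - v ≤ r.1.2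
  of_false : 0 < V → r.2 = false → (1 - ε) * ((ℓ : ℝ) - 1) * I.f (A ∪ O) ≤
    ℓ * ((1 - ε) * r.1.2 + p * (r.1.2 - I.f A) + (1 - ε) * m * ρ + ε * V)

theorem knapsackSGS_sat (hn : 1 ≤ n) (hA : I.Feasible A) {N' : List (Fin n)}
    (hAN : Disjoint A N'.toFinset) {V ε : ℝ} (hε : 0 < ε) (hε1 : ε < 1) (hρ : 0 < V → 0 ≤ ρ)
    (hv : ∀ e ∈ N', I.f {e} ≤ v) (hON : O ⊆ N'.toFinset) (hopt : I.Feasible (A ∪ O))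
    (hV : ∀ o ∈ O, I.f (insert o A) - I.f A ≤ V) (hk : k ≤ p) (hℓ : ℓ ≤ p + 1) (hℓ0 : 0 < ℓ)
    {T : ℕ} (hT : (1 - ε) ^ T ≤ ε / n) :
    (knapsackSGS I A N' V (I.f A) ℓ ρ ε).Sat (T * (N'.length * ℓ * 2))
      (2 + ((T + 1) + T * (N'.length * ℓ * (7 * m + 3) + 2)) + ℓ)
      (SGSPost I A O p ℓ V ρ ε v) := by
  classical
  have hAO : Disjoint A O := hAN.mono_right hON
  have hn0 : (0 : ℝ) < n := by exact_mod_cast hn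
  have hn1 : (1 : ℝ) ≤ n := by exact_mod_cast hn
  have hfin : ∀ o ∈ O, I.FiniteNCost A o := fun o ho => I.finiteNCost_of_feasible hAO hopt ho
  set cutoff : ℝ := ε * V / n with hcutoff
  have hlen : (N'.product (List.finRange ℓ)).length = N'.length * ℓ := by
    have h := List.length_product N' (List.finRange ℓ)
    rwa [List.length_finRange] at h
  -- For `V ≤ 0` the cutoff `εV/n` is at least `V`, so no pass is made and the solutions stay empty.
  have hVneg : ∀ τ, τ = V → ¬ 0 < V → ¬ cutoff < τ := by
    rintro τ rfl hV0
    rw [not_lt, hcutoff, le_div_iff₀ hn0]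
    nlinarith
  -- Here `j` counts the passes that still suffice: `j` further decays bring the threshold down to
  -- the cutoff.
  let Inv : ℕ → ℝ × SGSState n m ℓ → Prop := fun j st =>
    SGSInv I A N'.toFinset ρ v st.2 ∧ (V ≤ 0 → st.1 = V) ∧
      (0 < V → 0 < st.1 ∧ st.1 * (1 - ε) ^ j ≤ cutoff ∧
        (st.2.E = false → OptInv I A O p ρ (1 - ε) st.1 st.2))
  unfold knapsackSGS
  refine (Comp.Sat.ops_bind (o := T * (N'.length * ℓ * 2))
    (a := ((T + 1) + T * (N'.length * ℓ * (7 * m + 3) + 2)) + ℓ) ?_).mono le_rfl (by omega)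
    fun _ h => h
  refine (Comp.Sat.bind (Q := fun st : ℝ × SGSState n m ℓ => SGSInv I A N'.toFinset ρ v st.2 ∧
      (0 < V → 0 < st.1 ∧ st.1 ≤ cutoff ∧
        (st.2.E = false → OptInv I A O p ρ (1 - ε) st.1 st.2)))
    (o := T * (N'.length * ℓ * 2)) (o' := 0)
    (a := (T + 1) + T * (N'.length * ℓ * (7 * m + 3) + 2)) (a' := ℓ) ?_ ?_)
  · refine (Comp.Sat.whileLoop_ops (ob := N'.length * ℓ * 2)
      (ab := N'.length * ℓ * (7 * m + 3) + 2) Inv _ ?_ ?_ ?_ T _ ?_).mono le_rfl (by simp)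
      fun _ h => h
    · rintro ⟨τ, s⟩ ⟨h1, h2, h3⟩
      by_cases hV0 : 0 < V
      · have := (h3 hV0).2.1
        simp only [pow_zero, mul_one] at this
        exact not_lt.mpr this
      · exact hVneg τ (h2 (not_lt.mp hV0)) hV0
    · rintro j ⟨τ, s⟩ ⟨h1, h2, h3⟩ hlt
      exact ⟨h1, fun hV0 => ⟨(h3 hV0).1, not_lt.mp hlt, (h3 hV0).2.2⟩⟩
    · rintro j ⟨τ, s⟩ ⟨h1, h2, h3⟩ hlt
      have hV0 : 0 < V := by
        by_contra hV0
        exact hVneg τ (h2 (not_lt.mp hV0)) hV0 hlt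
      obtain ⟨hτ, hj, ho⟩ := h3 hV0
      simp only at hτ hj ho h1
      refine (Comp.Sat.bind (o := N'.length * ℓ * 2) (a := N'.length * ℓ * (7 * m + 3)) (o' := 0)
        (a' := 2) (Q := fun s' => SGSInv I A N'.toFinset ρ v s' ∧
          (s'.E = false → OptInv I A O p ρ (1 - ε) τ s' ∧
            Processed I A O ρ τ (N'.product (List.finRange ℓ)) s')) ?_ ?_)
      · refine (Comp.Sat.foldlM (o := 2) (a := 7 * m + 3) (fun L s' => SGSInv I A N'.toFinset ρ v s' ∧
          (s'.E = false → OptInv I A O p ρ (1 - ε) τ s' ∧ Processed I A O ρ τ L s'))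
          (N'.product (List.finRange ℓ)) s ⟨h1, fun hE => ⟨ho hE, fun q hq => ?_⟩⟩ ?_).mono
          ?_ ?_ fun _ h => h
        · simp at hq
        · rintro pre q s' - ⟨hs1, hs2⟩
          exact sgsPair_inv hA (hρ hV0) hτ.le (by linarith) (by simpa using hv) hAO hfin hk hℓ hs1
            hs2
        · rw [hlen]
        · rw [hlen]
      · rintro s' ⟨hs1, hs2⟩
        refine (Comp.Sat.ops_bind (a := 0) (Comp.Sat.pure ⟨hs1, fun h => absurd h (by linarith),
          fun _ => ⟨?_, ?_, fun hE => ?_⟩⟩))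
        · exact mul_pos (by linarith) hτ
        · simp only
          calc (1 - ε) * τ * (1 - ε) ^ j = τ * (1 - ε) ^ (j + 1) := by ring
            _ ≤ cutoff := hj
        · obtain ⟨h4, h5⟩ := hs2 hE
          refine h4.next hs1 hAN hAO hopt.1 (by linarith) (by linarith) hτ.le h5 ?_
          intro o ho i hav
          exact List.pair_mem_product.mpr
            ⟨List.mem_toFinset.mp (hs1.avail_subset hav), List.mem_finRange i⟩
    · refine ⟨⟨?_, ?_, ?_, ?_, ?_, ?_, ?_, ?_, ?_, ?_, ?_, ?_⟩, fun _ => rfl, fun hV0 =>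
        ⟨hV0, ?_, fun _ => ⟨?_, ?_⟩⟩⟩
      · simp
      · simp
      · simp
      · simp
      · simp
      · simp
      · exact fun _ => by simpa using hA.1
      · simp
      · exact subset_rfl
      · simp
      · simp
      · simp
      · simp only [hcutoff]
        calc V * (1 - ε) ^ T ≤ V * (ε / n) := mul_le_mul_of_nonneg_left hT hV0.le
          _ = ε * V / n := by ring
      · intro i o ho _ _
        have hd : 0 ≤ ρ * ∑ j, I.ncost A j o :=
          mul_nonneg (hρ hV0) (Finset.sum_nonneg fun j _ => I.ncost_nonneg hA j _)
        have h1 : excess I A ρ ∅ o ≤ V := by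
          refine max_le hV0.le ?_
          have := hV o ho
          rw [Finset.union_empty]
          linarith
        have h2 := excess_nonneg I A ρ ∅ o
        simp only
        nlinarith
      · have hz : ∀ o ∈ O, lostExcess I A ρ N'.toFinset ∅ o = 0 := by
          intro o ho
          rw [lostExcess, if_pos]
          refine ⟨hON ho, hopt.1.subset ?_⟩
          rw [Finset.union_empty]
          exact Finset.insert_subset (Finset.mem_union_right _ ho) Finset.subset_union_left
        refine (Finset.sum_nonpos fun i _ => ?_).trans (by simp)
        simp only [potential]
        rw [Finset.sum_eq_zero hz, mul_zero, zero_add]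
        refine mul_nonpos_of_nonneg_of_nonpos hV0.le (Finset.sum_nonpos fun h _ => ?_)
        simp
  · rintro ⟨τ, s⟩ ⟨h1, h2⟩
    refine (Comp.Sat.bind (o := 0) (o' := 0) (a := ℓ) (a' := 0)
      ((argmaxD_sat _ _).mono le_rfl (by simp) fun _ h => h) ?_)
    rintro r ⟨hmax, hr⟩
    have hW : ∀ i, s.val i ≤ r.2 := fun i => hmax (s.sol i, s.val i)
      (List.mem_map.mpr ⟨i, List.mem_finRange i, rfl⟩)
    obtain ⟨i, rfl⟩ : ∃ i, r = (s.sol i, s.val i) := by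
      rcases hr with hr | ⟨hr, -⟩
      · obtain ⟨i, -, hi⟩ := List.mem_map.mp hr
        exact ⟨i, hi.symm⟩
      · exfalso
        have := congrArg List.length hr
        simp at this
        omega
    refine Comp.Sat.pure ⟨⟨h1.indep i, fun j => ?_⟩, h1.val_eq i, h1.val_ge i, fun _ hE => ?_,
      fun hV0 hE => ?_⟩
    · refine I.cost_union_le_one hA (hAN.mono_right (h1.sol_subset i)) (h1.finite i) ?_
      rw [← h1.load_eq]
      exact h1.load_le i j
    · obtain ⟨i', hi'⟩ := h1.of_E hE
      exact hi'.trans (hW i')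
    · obtain ⟨hτ, hst, ho⟩ := h2 hV0
      refine (ho hE).guarantee h1 hAN hAO hopt (by linarith) (hρ hV0) hτ.le hW ?_
      simp only [hcutoff] at hst
      rw [le_div_iff₀ hn0] at hst
      linarith

end SGS

/-! ### Analysis of the search for the density ratio -/

section Search

variable {n k m : ℕ} {I : Instance n k m} {A O : Finset (Fin n)} {N' : List (Fin n)}

theorem maxGain_sat (I : Instance n k m) (A : Finset (Fin n)) (N' : List (Fin n)) :
    (maxGain I A N' (I.f A)).Sat (N'.length * 2)
      (N'.length * (m * (A.card + 1) + 1) + N'.length) fun V =>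
        (∀ e ∈ N', I.Feasible (insert e A) → I.f (insert e A) - I.f A ≤ V) ∧
        (V = 0 ∨ ∃ e ∈ N', I.Feasible (insert e A) ∧ V = I.f (insert e A) - I.f A) := by
  unfold maxGain
  refine (Comp.Sat.bind (o := N'.length * 2) (a := N'.length * (m * (A.card + 1) + 1)) (o' := 0)
    (a' := N'.length)
    (Comp.Sat.foldlM (o := 2) (a := m * (A.card + 1) + 1)
      (fun pre (acc : List (Valued n)) => acc.length ≤ pre.length ∧
      (∀ e ∈ pre, I.Feasible (insert e A) → ({e}, I.f (insert e A) - I.f A) ∈ acc) ∧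
      ∀ x ∈ acc, ∃ e ∈ pre, I.Feasible (insert e A) ∧ x.2 = I.f (insert e A) - I.f A)
      N' [] (by simp) ?_) ?_)
  · rintro pre e acc - ⟨h1, h2, h3⟩
    refine (Comp.Sat.bind (o' := 1) (a' := 1) (checkFeasible_sat I _) fun b hb => ?_).mono le_rfl
      (Nat.add_le_add_right (Nat.mul_le_mul_left m (Finset.card_insert_le _ _)) 1) fun _ h => h
    cases b with
    | true =>
      have hfe := hb.mp rfl
      rw [if_pos rfl]
      refine (Comp.Sat.askValue_bind (o := 0) (Comp.Sat.ops_bind (a := 0) (Comp.Sat.pure ?_)))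
      refine ⟨by simpa using h1, ?_, ?_⟩
      · intro e' he' hf'
        rcases List.mem_append.mp he' with he' | he'
        · exact List.mem_append_left _ (h2 e' he' hf')
        · rw [List.mem_singleton] at he'
          subst he'
          simp
      · intro x hx
        rcases List.mem_append.mp hx with hx | hx
        · obtain ⟨e', he', h⟩ := h3 x hx
          exact ⟨e', List.mem_append_left _ he', h⟩
        · rw [List.mem_singleton] at hx
          subst hx
          exact ⟨e, by simp, hfe, rfl⟩
    | false =>
      have hfe : ¬ I.Feasible (insert e A) := fun h => absurd (hb.mpr h) (by simp)
      refine Comp.Sat.pure ⟨by simp; omega, ?_, ?_⟩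
      · intro e' he' hf'
        rcases List.mem_append.mp he' with he' | he'
        · exact h2 e' he' hf'
        · rw [List.mem_singleton] at he'
          subst he'
          exact absurd hf' hfe
      · intro x hx
        obtain ⟨e', he', h⟩ := h3 x hx
        exact ⟨e', List.mem_append_left _ he', h⟩
  · rintro L ⟨h1, h2, h3⟩
    refine Comp.Sat.bind (o := 0) (o' := 0) (a' := 0)
      ((argmaxD_sat L _).mono le_rfl h1 fun _ h => h) ?_
    rintro r ⟨hmax, hr⟩
    refine Comp.Sat.pure ⟨fun e he hf => hmax _ (h2 e he hf), ?_⟩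
    rcases hr with hr | ⟨-, rfl⟩
    · obtain ⟨e, he, hf, hval⟩ := h3 r hr
      exact Or.inr ⟨e, he, hf, hval⟩
    · exact Or.inl rfl

/-- Because `2^δ ≤ 1+δ` on `[0,1]`, the initial upper exponent already covers `X ≤ N·V`. -/
theorem le_one_add_zpow_ceil_logb {N : ℕ} (hN : 1 ≤ N) {δ : ℝ} (hδ : 0 < δ) (hδ1 : δ ≤ 1) :
    (N : ℝ) ≤ (1 + δ) ^ ⌈Real.logb 2 N / δ⌉ := by
  have hN0 : (0 : ℝ) < N := by exact_mod_cast hN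
  set B := ⌈Real.logb 2 N / δ⌉
  have h1 : Real.logb 2 N ≤ δ * B := by
    have := Int.le_ceil (Real.logb 2 N / δ)
    rwa [div_le_iff₀ hδ, mul_comm] at this
  have hlog : 0 ≤ Real.logb 2 N := Real.logb_nonneg (by norm_num) (by exact_mod_cast hN)
  have hB : (0 : ℝ) ≤ B := by
    by_contra! h
    nlinarith
  -- Bernoulli's inequality for exponents in `[0,1]`.
  have h2 : (2 : ℝ) ^ δ ≤ 1 + δ := by
    have := rpow_one_add_le_one_add_mul_self (s := 1) (by norm_num) hδ.le hδ1
    norm_num at this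
    linarith
  calc (N : ℝ) = 2 ^ Real.logb 2 N := (Real.rpow_logb (by norm_num) (by norm_num) hN0).symm
    _ ≤ 2 ^ (δ * B) := Real.rpow_le_rpow_of_exponent_le (by norm_num) h1
    _ = (2 ^ δ) ^ (B : ℝ) := Real.rpow_mul (by norm_num) _ _
    _ ≤ (1 + δ) ^ (B : ℝ) := Real.rpow_le_rpow (by positivity) h2 hB
    _ = (1 + δ) ^ B := Real.rpow_intCast _ _

/-- Number of oracle calls of KnapsackSGS with at most `T` passes. -/
def sgsOracle (T N ℓ : ℕ) : ℕ := T * (N * ℓ * 2)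

/-- Number of arithmetic operations of KnapsackSGS with at most `T` passes. -/
def sgsArith (T N ℓ m : ℕ) : ℕ := 2 + ((T + 1) + T * (N * ℓ * (7 * m + 3) + 2)) + ℓ

/-- The bound for KnapsackSGS when no knapsack was violated, for a value `W` of the result. -/
def DensityBound (I : Instance n k m) (A O : Finset (Fin n)) (p ℓ : ℕ) (V ρ ε W : ℝ) : Prop :=
  (1 - ε) * ((ℓ : ℝ) - 1) * I.f (A ∪ O) ≤
    ℓ * ((1 - ε) * W + p * (W - I.f A) + (1 - ε) * m * ρ + ε * V)

theorem DensityBound.mono {p ℓ : ℕ} {V ρ ε W W' : ℝ} (hε : ε ≤ 1)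
    (h : DensityBound I A O p ℓ V ρ ε W) (hW : W ≤ W') : DensityBound I A O p ℓ V ρ ε W' := by
  refine le_trans h (mul_le_mul_of_nonneg_left ?_ (Nat.cast_nonneg ℓ))
  have e1 := mul_le_mul_of_nonneg_left hW (sub_nonneg.mpr hε)
  have e2 := mul_le_mul_of_nonneg_left hW (Nat.cast_nonneg (α := ℝ) p)
  linarith

/-- The density ratio that belongs to the exponent `b`. -/
noncomputable def Params.ratio (par : Params) (V fA : ℝ) (b : ℤ) : ℝ :=
  par.β * V * (1 + par.δ) ^ b + par.γ * fA

/-- The invariant of the search: at most `j` more rounds are needed. -/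
structure SearchInv (I : Instance n k m) (par : Params) (A O : Finset (Fin n)) (p : ℕ)
    (V v : ℝ) (B : ℤ) (R : ℕ) (j : ℕ) (s : SearchState n) : Prop where
  length_le : s.found.length + j ≤ R
  found : ∀ x ∈ s.found, I.Feasible (A ∪ x.1) ∧ x.2 = I.f (A ∪ x.1) ∧ I.f A ≤ x.2
  one_le : 1 ≤ s.b₁
  le_bound : s.b₀ ≤ B
  le_add_one : s.b₁ ≤ s.b₀ + 1
  rounds : ((s.b₀ : ℝ) - s.b₁ - 1) * (1 - 1 / (2 * par.μ)) ^ j < 1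
  lower : 0 < V → s.b₁ = 1 ∨ ∃ b, s.b₁ ≤ b ∧ ∃ x ∈ s.found,
    I.f A + par.ratio V (I.f A) b - v ≤ x.2
  upper : 0 < V → I.f (A ∪ O) - I.f A ≤ V * (1 + par.δ) ^ s.b₀ ∨
    ∃ b, 2 ≤ b ∧ b ≤ s.b₀ ∧ ∃ x ∈ s.found,
      DensityBound I A O p par.ℓ V (par.ratio V (I.f A) b) par.ε x.2

/-- The assumptions under which the work done for one enumerated set is analysed. -/
structure SearchSetup (I : Instance n k m) (par : Params) (A O : Finset (Fin n))
    (N' : List (Fin n)) (p T : ℕ) (v : ℝ) : Prop where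
  one_le_n : 1 ≤ n
  feasible : I.Feasible A
  disjoint : Disjoint A N'.toFinset
  subset : O ⊆ N'.toFinset
  feasible_union : I.Feasible (A ∪ O)
  value_le : ∀ e ∈ N', I.f {e} ≤ v
  k_le : k ≤ p
  ℓ_le : par.ℓ ≤ p + 1
  ℓ_pos : 0 < par.ℓ
  ε_pos : 0 < par.ε
  ε_lt : par.ε < 1
  δ_pos : 0 < par.δ
  δ_le : par.δ ≤ 1
  β_nonneg : 0 ≤ par.β
  γ_nonneg : 0 ≤ par.γ
  one_le_μ : 1 ≤ par.μ
  passes : (1 - par.ε) ^ T ≤ par.ε / n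

variable {par : Params} {p T : ℕ} {v V : ℝ} {B : ℤ} {R j : ℕ} {s : SearchState n}

/-- The moved endpoint stops at or before `b`, so the new certificate at `b` lies on the required
side of it; rounding towards `b` guarantees progress. -/
theorem searchStep_sat (hs : SearchSetup I par A O N' p T v)
    (hV : ∀ o ∈ O, I.f (insert o A) - I.f A ≤ V)
    (h : SearchInv I par A O p V v B R (j + 1) s) (hG : 1 < |s.b₁ - s.b₀|) :
    (searchStep I par A N' V (I.f A) s).Sat (sgsOracle T N'.length par.ℓ)
      (15 + B.toNat + sgsArith T N'.length par.ℓ m) (SearchInv I par A O p V v B R j) := by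
  have hgap : s.b₁ + 2 ≤ s.b₀ := by
    have := h.le_add_one
    rcases lt_abs.mp hG with h' | h' <;> omega
  set b : ℤ := (s.b₁ + s.b₀ + 1) / 2 with hb
  have hb1 : s.b₁ + 1 ≤ b := by omega
  have hb0 : b + 1 ≤ s.b₀ := by omega
  -- The midpoint is rounded up, so `b - b₁` is at least half of `b₀ - b₁`, but `b₀ - b` only half
  -- of `b₀ - b₁ - 1`. Measuring the range by `b₀ - b₁ - 1` lets either move shrink it by `1 -
  -- 1/(2μ)`.
  have hbhalf : s.b₁ + s.b₀ ≤ 2 * b := by omega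
  have hbhalf' : 2 * b ≤ s.b₁ + s.b₀ + 1 := by omega
  have hone := h.one_le
  have hB := h.le_bound
  have hb1R : (s.b₁ : ℝ) + 1 ≤ b := by exact_mod_cast hb1
  have hb0R : (b : ℝ) + 1 ≤ s.b₀ := by exact_mod_cast hb0
  have hbhR : (s.b₁ : ℝ) + s.b₀ ≤ 2 * b := by exact_mod_cast hbhalf
  have hbhR' : 2 * (b : ℝ) ≤ s.b₁ + s.b₀ + 1 := by exact_mod_cast hbhalf'
  have hμ : 0 < par.μ := lt_of_lt_of_le one_pos hs.one_le_μ
  set ι : ℝ := 1 / par.μ with hι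
  have hι0 : 0 < ι := by positivity
  have hι1 : ι ≤ 1 := by rw [hι, div_le_one hμ]; exact hs.one_le_μ
  have hιhalf : 1 / (2 * par.μ) = ι / 2 := by rw [hι]; field_simp
  have hrounds := h.rounds
  rw [hιhalf, pow_succ'] at hrounds
  have hq : 0 ≤ (1 - ι / 2) ^ j := pow_nonneg (by linarith) j
  have hρ : 0 < V → 0 ≤ par.ratio V (I.f A) b := by
    intro hV0
    have h1 : 0 < (1 + par.δ) ^ b := zpow_pos (by linarith [hs.δ_pos]) b
    have h2 := I.f_nonneg A
    have h3 := hs.β_nonneg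
    have h4 := hs.γ_nonneg
    unfold Params.ratio
    positivity
  unfold searchStep
  refine (Comp.Sat.ops_bind (o := sgsOracle T N'.length par.ℓ)
    (a := b.natAbs + 5 + (sgsArith T N'.length par.ℓ m + 7)) ?_).mono le_rfl (by omega)
    fun _ h => h
  refine Comp.Sat.ops_bind ?_
  refine (Comp.Sat.bind (o' := 0) (a' := 7) (knapsackSGS_sat (v := v) (p := p) hs.one_le_n hs.feasible
    hs.disjoint hs.ε_pos hs.ε_lt hρ hs.value_le hs.subset hs.feasible_union hV hs.k_le hs.ℓ_le
    hs.ℓ_pos hs.passes) ?_).mono le_rfl le_rfl fun _ h => h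
  rintro ⟨x, E⟩ hx
  have hlen : (s.found ++ [x]).length + j ≤ R := by
    have := h.length_le
    simp only [List.length_append, List.length_singleton]
    omega
  have hfound : ∀ y ∈ s.found ++ [x],
      I.Feasible (A ∪ y.1) ∧ y.2 = I.f (A ∪ y.1) ∧ I.f A ≤ y.2 := by
    intro y hy
    rcases List.mem_append.mp hy with hy | hy
    · exact h.found y hy
    · rw [List.mem_singleton] at hy
      subst hy
      exact ⟨hx.feasible, hx.value_eq, hx.value_ge⟩
  cases E with
  | true =>
    rw [if_pos rfl]
    refine Comp.Sat.ops_bind (a := 0) (Comp.Sat.pure ?_)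
    have habs : |(s.b₁ : ℝ) - b| = b - s.b₁ := by rw [abs_of_neg] <;> linarith
    change SearchInv I par A O p V v B R j
      ⟨⌈(b : ℝ) - (1 - ι) * |(s.b₁ : ℝ) - b|⌉, s.b₀, s.found ++ [x]⟩
    rw [habs]
    have hle : ⌈(b : ℝ) - (1 - ι) * (b - s.b₁)⌉ ≤ b := Int.ceil_le.mpr (by nlinarith)
    have hge := Int.le_ceil ((b : ℝ) - (1 - ι) * (b - s.b₁))
    have hgt : s.b₁ < ⌈(b : ℝ) - (1 - ι) * (b - s.b₁)⌉ := Int.lt_ceil.mpr (by nlinarith)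
    refine ⟨hlen, hfound, ?_, h.le_bound, ?_, ?_, fun hV0 => Or.inr ⟨b, hle, x, by simp,
      hx.of_true hV0 rfl⟩, fun hV0 => ?_⟩
    · change 1 ≤ ⌈(b : ℝ) - (1 - ι) * (b - s.b₁)⌉
      omega
    · change ⌈(b : ℝ) - (1 - ι) * (b - s.b₁)⌉ ≤ s.b₀ + 1
      omega
    · rw [hιhalf]
      refine lt_of_le_of_lt ?_ hrounds
      rw [← mul_assoc]
      refine mul_le_mul_of_nonneg_right ?_ hq
      change (s.b₀ : ℝ) - (⌈(b : ℝ) - (1 - ι) * (b - s.b₁)⌉ : ℤ) - 1 ≤ _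
      nlinarith
    · rcases h.upper hV0 with h' | ⟨b', h2, h3, y, hy, h4⟩
      · exact Or.inl h'
      · exact Or.inr ⟨b', h2, h3, y, List.mem_append_left _ hy, h4⟩
  | false =>
    rw [if_neg (by simp)]
    refine Comp.Sat.ops_bind (a := 0) (Comp.Sat.pure ?_)
    have habs : |(s.b₀ : ℝ) - b| = s.b₀ - b := by rw [abs_of_pos]; linarith
    change SearchInv I par A O p V v B R j
      ⟨s.b₁, ⌊(b : ℝ) + (1 - ι) * |(s.b₀ : ℝ) - b|⌋, s.found ++ [x]⟩
    rw [habs]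
    have hge : b ≤ ⌊(b : ℝ) + (1 - ι) * (s.b₀ - b)⌋ := Int.le_floor.mpr (by nlinarith)
    have hle := Int.floor_le ((b : ℝ) + (1 - ι) * (s.b₀ - b))
    have hlt : ⌊(b : ℝ) + (1 - ι) * (s.b₀ - b)⌋ < s.b₀ := Int.floor_lt.mpr (by nlinarith)
    refine ⟨hlen, hfound, hone, ?_, ?_, ?_, fun hV0 => ?_, fun hV0 => Or.inr ⟨b, by omega, hge, x,
      by simp, hx.of_false hV0 rfl⟩⟩
    · change ⌊(b : ℝ) + (1 - ι) * (s.b₀ - b)⌋ ≤ B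
      omega
    · change s.b₁ ≤ ⌊(b : ℝ) + (1 - ι) * (s.b₀ - b)⌋ + 1
      omega
    · rw [hιhalf]
      refine lt_of_le_of_lt ?_ hrounds
      rw [← mul_assoc]
      refine mul_le_mul_of_nonneg_right ?_ hq
      change ((⌊(b : ℝ) + (1 - ι) * (s.b₀ - b)⌋ : ℤ) : ℝ) - s.b₁ - 1 ≤ _
      nlinarith
    · rcases h.lower hV0 with h' | ⟨b', h2, y, hy, h4⟩
      · exact Or.inl h'
      · exact Or.inr ⟨b', h2, y, List.mem_append_left _ hy, h4⟩

/-- What the work done for one enumerated set guarantees for the value `W` of its result. -/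
def SearchGuarantee (I : Instance n k m) (par : Params) (A O : Finset (Fin n)) (p : ℕ)
    (v W : ℝ) : Prop :=
  I.f (A ∪ O) ≤ I.f A ∨
  ∃ V Y : ℝ, 0 < V ∧ V ≤ I.f (A ∪ O) - I.f A ∧ V ≤ v ∧
    ((1 + par.δ) ^ 2 * V ≤ Y ∧ Y ≤ I.f (A ∪ O) - I.f A ∧
        DensityBound I A O p par.ℓ V (par.β * Y + par.γ * I.f A) par.ε W ∨
      I.f (A ∪ O) - I.f A ≤ (1 + par.δ) * Y ∧
        I.f A + (par.β * Y + par.γ * I.f A) - v ≤ W ∨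
      I.f (A ∪ O) - I.f A ≤ (1 + par.δ) ^ 2 * V)

/-- If the upper endpoint still bounds `X`, a violation at some `b ≥ b₁ ≥ b₀ - 1` is at most a
factor `1+δ` too low, while `b₁ = 1` forces `b₀ ≤ 2`. Otherwise a density certificate at some `b ≤
b₀` has `V(1+δ)^b` below `X`. -/
theorem SearchInv.guarantee (hs : SearchSetup I par A O N' p T v)
    (h : SearchInv I par A O p V v B R j s) (hend : s.b₀ ≤ s.b₁ + 1) (hV0 : 0 < V)
    (hVX : V ≤ I.f (A ∪ O) - I.f A) (hVv : V ≤ v) {W : ℝ} (hW : ∀ x ∈ s.found, x.2 ≤ W) :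
    SearchGuarantee I par A O p v W := by
  have hδ1 : 1 ≤ 1 + par.δ := by linarith [hs.δ_pos]
  have hδ0 : 0 < 1 + par.δ := by linarith
  right
  by_cases hX : I.f (A ∪ O) - I.f A ≤ V * (1 + par.δ) ^ s.b₀
  · rcases h.lower hV0 with h1 | ⟨b, hb, x, hx, hval⟩
    · refine ⟨V, 0, hV0, hVX, hVv, Or.inr (Or.inr (hX.trans ?_))⟩
      rw [mul_comm]
      refine mul_le_mul_of_nonneg_right ?_ hV0.le
      rw [← zpow_natCast]
      exact zpow_le_zpow_right₀ hδ1 (by push_cast; omega)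
    · refine ⟨V, V * (1 + par.δ) ^ b, hV0, hVX, hVv, Or.inr (Or.inl ⟨hX.trans ?_, ?_⟩)⟩
      · have h2 : (1 + par.δ) ^ s.b₀ ≤ (1 + par.δ) ^ (b + 1) :=
          zpow_le_zpow_right₀ hδ1 (by omega)
        rw [zpow_add_one₀ hδ0.ne'] at h2
        calc V * (1 + par.δ) ^ s.b₀ ≤ V * ((1 + par.δ) ^ b * (1 + par.δ)) :=
              mul_le_mul_of_nonneg_left h2 hV0.le
          _ = _ := by ring
      · rw [Params.ratio, mul_assoc] at hval
        exact hval.trans (hW x hx)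
  · rcases h.upper hV0 with h1 | ⟨b, hb2, hb, x, hx, hval⟩
    · exact absurd h1 hX
    · have hY2 : (1 + par.δ) ^ 2 * V ≤ V * (1 + par.δ) ^ b := by
        rw [mul_comm]
        refine mul_le_mul_of_nonneg_left ?_ hV0.le
        rw [← zpow_natCast]
        exact zpow_le_zpow_right₀ hδ1 (by exact_mod_cast hb2)
      have hYX : V * (1 + par.δ) ^ b ≤ I.f (A ∪ O) - I.f A :=
        (mul_le_mul_of_nonneg_left (zpow_le_zpow_right₀ hδ1 hb) hV0.le).trans (not_le.mp hX).le
      rw [Params.ratio, mul_assoc] at hval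
      exact ⟨V, V * (1 + par.δ) ^ b, hV0, hVX, hVv,
        Or.inl ⟨hY2, hYX, hval.mono hs.ε_lt.le (hW x hx)⟩⟩

/-- Number of oracle calls for one enumerated set, with at most `R` rounds of the search. -/
def enumOracle (R T N ℓ : ℕ) : ℕ := N * 2 + R * sgsOracle T N ℓ

/-- Number of arithmetic operations for one enumerated singleton. -/
def enumArith (R T N ℓ m B : ℕ) : ℕ :=
  N * (m * 2 + 1) + N + (3 + ((R + 1) * 3 + R * (15 + B + sgsArith T N ℓ m) + R))

theorem enumerated_sat (hs : SearchSetup I par A O N' p T v) (hA : A.card = 1)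
    {B : ℕ}
    (hB : ⌈Real.logb 2 N'.length / par.δ⌉ ≤ B)
    (hR : (B : ℝ) * (1 - 1 / (2 * par.μ)) ^ R < 1) :
    (enumerated I par A (I.f A) N').Sat (enumOracle R T N'.length par.ℓ)
      (enumArith R T N'.length par.ℓ m B) fun r =>
        I.Feasible r.1 ∧ r.2 = I.f r.1 ∧ I.f A ≤ r.2 ∧
          ((∀ S, I.Feasible S → I.f S ≤ I.f (A ∪ O)) → SearchGuarantee I par A O p v r.2) := by
  classical
  have hAO : Disjoint A O := hs.disjoint.mono_right hs.subset
  unfold enumerated enumOracle enumArith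
  refine Comp.Sat.bind ((maxGain_sat I A N').mono le_rfl (by rw [hA]) fun _ h => h) ?_
  rintro V ⟨hVmax, hVeq⟩
  have hVO : ∀ o ∈ O, I.f (insert o A) - I.f A ≤ V := fun o ho =>
    hVmax o (List.mem_toFinset.mp (hs.subset ho)) (hs.feasible_union.subset
      (Finset.insert_subset (Finset.mem_union_right _ ho) Finset.subset_union_left))
  have hX : I.f (A ∪ O) - I.f A ≤ O.card * V := by
    have h1 := I.f_union_le A O
    have h2 := Finset.sum_le_sum hVO
    rw [Finset.sum_const, nsmul_eq_mul] at h2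
    linarith
  have hVX : (∀ S, I.Feasible S → I.f S ≤ I.f (A ∪ O)) → 0 < V → V ≤ I.f (A ∪ O) - I.f A := by
    intro hmax hV0
    rcases hVeq with rfl | ⟨e, -, hf, rfl⟩
    · exact absurd hV0 (lt_irrefl _)
    · linarith [hmax _ hf]
  have hVv : 0 < V → V ≤ v := by
    intro hV0
    rcases hVeq with rfl | ⟨e, he, hf, rfl⟩
    · exact absurd hV0 (lt_irrefl _)
    · exact (I.f_singleton_le A e).trans (hs.value_le e he)
  set b₀ : ℤ := ⌈Real.logb 2 N'.length / par.δ⌉ with hb₀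
  have hlog : 0 ≤ Real.logb 2 N'.length := by
    -- An empty reduced ground set gives `b₀ = 0`, since `Real.logb 2 0 = 0`; the search is then not
    -- entered.
    rcases Nat.eq_zero_or_pos N'.length with h0 | h0
    · simp [h0]
    · exact Real.logb_nonneg (by norm_num) (by exact_mod_cast h0)
  have hb₀0 : 0 ≤ b₀ := Int.ceil_nonneg (div_nonneg hlog hs.δ_pos.le)
  have hq1 : 0 ≤ (1 - 1 / (2 * par.μ)) ^ R := by
    refine pow_nonneg ?_ R
    have := hs.one_le_μ
    rw [sub_nonneg, div_le_one (by linarith)]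
    linarith
  refine (Comp.Sat.ops_bind (o := R * sgsOracle T N'.length par.ℓ)
    (a := (R + 1) * 3 + R * (15 + B + sgsArith T N'.length par.ℓ m) + R) ?_)
  refine Comp.Sat.bind (o := R * sgsOracle T N'.length par.ℓ) (o' := 0)
    (a := (R + 1) * 3 + R * (15 + B + sgsArith T N'.length par.ℓ m)) (a' := R)
    (Q := fun s => s.b₀ ≤ s.b₁ + 1 ∧ ∃ j, SearchInv I par A O p V v B R j s) ?_ ?_
  · refine Comp.Sat.whileLoop_ops (SearchInv I par A O p V v B R) _ ?_ ?_ ?_ R _ ?_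
    · intro s h
      have h1 := h.rounds
      rw [pow_zero, mul_one] at h1
      have h2 : s.b₀ - s.b₁ - 1 < 1 := by exact_mod_cast h1
      have h3 := h.le_add_one
      rw [not_lt, abs_le]
      constructor <;> omega
    · intro j s h hG
      rw [not_lt, abs_le] at hG
      exact ⟨by omega, j, h⟩
    · intro j s h hG
      exact searchStep_sat hs hVO h hG
    · refine ⟨by simp, by simp, le_rfl, hB, by simp only; omega, ?_, fun _ => Or.inl rfl,
        fun hV0 => Or.inl ?_⟩
      · refine lt_of_le_of_lt (mul_le_mul_of_nonneg_right ?_ hq1) hR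
        have : (b₀ : ℝ) ≤ B := by exact_mod_cast hB
        push_cast
        linarith
      · refine hX.trans ?_
        rw [mul_comm]
        refine mul_le_mul_of_nonneg_left ?_ hV0.le
        have hcard : O.card ≤ N'.length :=
          (Finset.card_le_card hs.subset).trans (List.toFinset_card_le _)
        rcases Nat.eq_zero_or_pos N'.length with h0 | h0
        · have : O.card = 0 := by omega
          rw [this, Nat.cast_zero]
          exact zpow_nonneg (by linarith [hs.δ_pos]) _
        · exact (Nat.cast_le.mpr hcard).trans (le_one_add_zpow_ceil_logb h0 hs.δ_pos hs.δ_le)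
  · rintro s ⟨hend, j, h⟩
    refine Comp.Sat.bind (o := 0) (o' := 0) (a' := 0)
      ((argmaxD_sat s.found _).mono le_rfl (by have := h.length_le; omega) fun _ h => h) ?_
    rintro r ⟨hrmax, hr⟩
    have hr' : I.Feasible (A ∪ r.1) ∧ r.2 = I.f (A ∪ r.1) ∧ I.f A ≤ r.2 := by
      rcases hr with hr | ⟨-, rfl⟩
      · exact h.found r hr
      · simp [hs.feasible]
    refine Comp.Sat.pure ⟨hr'.1, hr'.2.1, hr'.2.2, fun hmax => ?_⟩
    by_cases hV0 : 0 < V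
    · exact h.guarantee hs hend hV0 (hVX hmax hV0) (hVv hV0) hrmax
    -- Without a positive feasible gain, `X ≤ |O|·V ≤ 0`.
    · left
      have : (O.card : ℝ) * V ≤ 0 :=
        mul_nonpos_of_nonneg_of_nonpos (Nat.cast_nonneg _) (not_lt.mp hV0)
      linarith

end Search

/-! ### Randomized computations -/

section Randomized

variable {α β : Type}

/-- Every run ends with a result satisfying `Q`, within the given bounds on the costs. -/
def RComp.AllSat (x : RComp α) (o a : ℕ) (Q : α → Prop) : Prop :=
  ∀ run ∈ PMF.support x, Comp.Sat run o a Q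

/-- The probability that a run does not end with a result satisfying `Q`. -/
noncomputable def RComp.fail (x : RComp α) (Q : α → Prop) : ENNReal :=
  PMF.toOuterMeasure x {run | ¬ ∃ r c, run = some (r, c) ∧ Q r}

theorem toOuterMeasure_le_one {γ : Type*} (p : PMF γ) (s : Set γ) : p.toOuterMeasure s ≤ 1 := by
  refine (p.toOuterMeasure.mono (Set.subset_univ s)).trans_eq ?_
  exact (PMF.toOuterMeasure_apply_eq_one_iff _ _).mpr (Set.subset_univ _)

theorem RComp.fail_le_one (x : RComp α) (Q : α → Prop) : x.fail Q ≤ 1 :=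
  toOuterMeasure_le_one _ _

theorem RComp.AllSat.fail_eq_zero {x : RComp α} {o a : ℕ} {Q : α → Prop} (h : x.AllSat o a Q) :
    x.fail Q = 0 := by
  refine (PMF.toOuterMeasure_apply_eq_zero_iff _ _).mpr (Set.disjoint_left.mpr ?_)
  intro run hrun hf
  obtain ⟨r, c, h1, -, -, h2⟩ := h run hrun
  exact hf ⟨r, c, h1, h2⟩

theorem RComp.AllSat.mono {x : RComp α} {o a o' a' : ℕ} {Q Q' : α → Prop} (h : x.AllSat o a Q)
    (ho : o ≤ o') (ha : a ≤ a') (hQ : ∀ r, Q r → Q' r) : x.AllSat o' a' Q' :=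
  fun run hrun => (h run hrun).mono ho ha hQ

theorem RComp.lift_bind_some (r : α) (c : Cost) (g : α → RComp β) :
    (RComp.lift (some (r, c)) >>= g : RComp β) = PMF.map (Comp.charge c) (g r) :=
  PMF.pure_bind _ _

theorem RComp.draw_bind {s : Finset α} (h : s.Nonempty) (g : α → RComp β) :
    (draw s h >>= g : RComp β) =
      (PMF.uniformOfFinset s h).bind fun e => PMF.map (Comp.charge ⟨0, 1⟩) (g e) :=
  PMF.bind_map _ _ _

theorem RComp.fail_charge (c : Cost) (x : RComp α) (Q : α → Prop) :
    RComp.fail (PMF.map (Comp.charge c) x : PMF (Comp α)) Q = x.fail Q := by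
  refine (PMF.toOuterMeasure_map_apply _ _ _).trans ?_
  unfold RComp.fail
  congr 1
  ext run
  refine not_congr ⟨?_, ?_⟩
  · rintro ⟨r, c', h, hQ⟩
    rcases run with _ | ⟨r', c''⟩
    · cases h
    · obtain ⟨rfl, -⟩ := Prod.mk.inj (Option.some.inj h)
      exact ⟨_, _, rfl, hQ⟩
  · rintro ⟨r, c', rfl, hQ⟩
    exact ⟨r, _, rfl, hQ⟩

theorem RComp.AllSat.charge {x : RComp α} {o a : ℕ} {Q : α → Prop} (c : Cost)
    (h : x.AllSat o a Q) :
    RComp.AllSat (PMF.map (Comp.charge c) x : PMF (Comp α)) (c.oracle + o) (c.arith + a) Q := by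
  intro run hrun
  obtain ⟨run', hrun', rfl⟩ := (PMF.mem_support_map_iff _ _ _).mp hrun
  exact (h run' hrun').charge c

theorem RComp.AllSat.lift_bind {x : Comp α} {g : α → RComp β} {o a o' a' : ℕ} {Q : α → Prop}
    {Q' : β → Prop} (hx : x.Sat o a Q) (hg : ∀ r, Q r → (g r).AllSat o' a' Q') :
    RComp.AllSat (RComp.lift x >>= g) (o + o') (a + a') Q' := by
  obtain ⟨r, c, rfl, h1, h2, h3⟩ := hx
  rw [RComp.lift_bind_some]
  exact ((hg r h3).charge c).mono (by omega) (by omega) fun _ h => h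

theorem RComp.fail_lift_bind_le {x : Comp α} {g : α → RComp β} {o a : ℕ} {Q : α → Prop}
    {Q' : β → Prop} {q : ENNReal} (hx : x.Sat o a Q) (hg : ∀ r, Q r → (g r).fail Q' ≤ q) :
    RComp.fail (RComp.lift x >>= g) Q' ≤ q := by
  obtain ⟨r, c, rfl, h1, h2, h3⟩ := hx
  rw [RComp.lift_bind_some, RComp.fail_charge]
  exact hg r h3

theorem RComp.AllSat.bind {x : RComp α} {g : α → RComp β} {o a o' a' : ℕ} {Q : α → Prop}
    {Q' : β → Prop} (hx : x.AllSat o a Q) (hg : ∀ r, Q r → (g r).AllSat o' a' Q') :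
    RComp.AllSat (x >>= g) (o + o') (a + a') Q' := by
  intro run hrun
  obtain ⟨run', hrun', hrun⟩ := (PMF.mem_support_bind_iff _ _ _).mp hrun
  obtain ⟨r, c, rfl, h1, h2, h3⟩ := hx run' hrun'
  exact (((hg r h3).charge c) run hrun).mono (by omega) (by omega) fun _ h => h

/-- Once the first stage achieves `Q`, every run of the second succeeds; if the first stage fails,
the conditional failure probability is bounded by 1. -/
theorem RComp.fail_bind_le {x : RComp α} {g : α → RComp β} {o a o' a' : ℕ} {P Q : α → Prop}
    {Q' : β → Prop} (hx : x.AllSat o a P) (hg : ∀ r, P r → Q r → (g r).AllSat o' a' Q') :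
    RComp.fail (x >>= g) Q' ≤ x.fail Q := by
  refine (PMF.toOuterMeasure_bind_apply _ _ _).trans_le ?_
  refine le_trans (ENNReal.tsum_le_tsum fun run => ?_) (PMF.toOuterMeasure_apply _ _).ge
  by_cases hrun : run ∈ {run : Comp α | ¬ ∃ r c, run = some (r, c) ∧ Q r}
  · rw [Set.indicator_of_mem hrun]
    exact mul_le_of_le_one_right zero_le (toOuterMeasure_le_one _ _)
  · rw [Set.indicator_of_notMem hrun, nonpos_iff_eq_zero, mul_eq_zero, or_iff_not_imp_left]
    intro h0
    obtain ⟨r, c, hr, hQ⟩ := not_not.mp hrun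
    obtain ⟨r', c', hr', -, -, hP⟩ := hx run ((PMF.mem_support_iff _ _).mpr h0)
    rw [hr] at hr'
    obtain ⟨rfl, rfl⟩ := Prod.mk.inj (Option.some.inj hr')
    subst hr
    exact (RComp.fail_charge c (g r) Q').trans (hg r hP hQ).fail_eq_zero

theorem RComp.AllSat.pure {r : α} {o a : ℕ} {Q : α → Prop} (h : Q r) :
    RComp.AllSat (Pure.pure r : RComp α) o a Q := by
  intro run hrun
  have : run = Pure.pure r := (PMF.mem_support_pure_iff _ _).mp hrun
  rw [this]
  exact Comp.Sat.pure h

theorem RComp.AllSat.draw_bind {s : Finset α} {hs : s.Nonempty} {g : α → RComp β} {o a : ℕ}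
    {Q : β → Prop} (h : ∀ e ∈ s, (g e).AllSat o a Q) :
    RComp.AllSat (draw s hs >>= g) o (1 + a) Q := by
  rw [RComp.draw_bind]
  intro run hrun
  obtain ⟨e, he, hrun⟩ := (PMF.mem_support_bind_iff _ _ _).mp hrun
  rw [PMF.mem_support_uniformOfFinset_iff] at he
  exact ((h e he).charge ⟨0, 1⟩).mono (by simp) le_rfl (fun _ h => h) run hrun

theorem RComp.fail_draw_bind_le [Fintype α] [DecidableEq α] {s : Finset α} {hs : s.Nonempty}
    {g : α → RComp β} {Q : β → Prop} {t : α → ENNReal} (h : ∀ e ∈ s, (g e).fail Q ≤ t e) :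
    RComp.fail (draw s hs >>= g) Q ≤ (s.card : ENNReal)⁻¹ * ∑ e ∈ s, t e := by
  rw [RComp.draw_bind]
  refine (PMF.toOuterMeasure_bind_apply _ _ _).trans_le ?_
  rw [tsum_fintype, ← Finset.sum_subset (Finset.subset_univ s), Finset.mul_sum]
  · refine Finset.sum_le_sum fun e he => ?_
    rw [PMF.uniformOfFinset_apply_of_mem hs he]
    refine mul_le_mul_right ?_ _
    exact (RComp.fail_charge _ _ _).trans_le (h e he)
  · intro e _ he
    rw [PMF.uniformOfFinset_apply_of_notMem hs he, zero_mul]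

end Randomized

/-! ### Analysis of the main loop -/

section MainLoop

variable {n k m : ℕ} {I : Instance n k m} {par : Params} {ground : List (Fin n)} {bar : ℝ}
  {Sopt : Finset (Fin n)} {goal : ℝ} {eo ea : ℕ}

/-- What is needed of the work for one enumerated element. -/
def EnumSat (I : Instance n k m) (par : Params) (ground : List (Fin n)) (Sopt : Finset (Fin n))
    (goal : ℝ) (eo ea : ℕ) : Prop :=
  ∀ e ∈ ground, (enumerated I par {e} (I.f {e}) (ground.filter (· ≠ e))).Sat eo ea fun r =>
    I.Feasible r.1 ∧ r.2 = I.f r.1 ∧ (e ∈ Sopt → goal ≤ r.2)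

/-- The number `j` pays for the draws and tests, the counter `t` for the enumerations. Persistence
of earlier entries makes a single good enumeration decisive. -/
theorem mainLoop_allSat (henum : EnumSat I par ground Sopt goal eo ea) (j : ℕ) :
    ∀ (t : ℕ) (rest : Finset (Fin n)) (found : List (Valued n)), rest ⊆ ground.toFinset →
      (∀ x ∈ found, I.Feasible x.1 ∧ x.2 = I.f x.1) →
      (mainLoop I par ground bar j t rest found).AllSat (j + t * eo) (j * 2 + t * ea) fun L =>
        L.length ≤ found.length + t ∧ (∀ x ∈ L, I.Feasible x.1 ∧ x.2 = I.f x.1) ∧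
          ∀ x ∈ found, x ∈ L := by
  induction j with
  | zero =>
    intro t rest found _ hf
    exact RComp.AllSat.pure ⟨Nat.le_add_right _ _, hf, fun _ h => h⟩
  | succ j ih =>
    intro t rest found hrest hf
    rw [mainLoop]
    split_ifs with h
    · obtain ⟨t, rfl⟩ : ∃ t', t = t' + 1 := Nat.exists_eq_succ_of_ne_zero h.1.ne'
      refine (RComp.AllSat.draw_bind (o := 1 + (j + (t + 1) * eo))
        (a := 0 + (1 + (j * 2 + (t + 1) * ea))) fun e he => ?_).mono (by omega) (by omega)
        fun _ h => h
      refine RComp.AllSat.lift_bind (x := askValue I {e}) (o := 1) (a := 0)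
        (Q := fun v => v = I.f {e}) ⟨_, _, rfl, le_rfl, le_rfl, rfl⟩ ?_
      rintro _ rfl
      refine (RComp.AllSat.lift_bind (x := ops 1 _) (o := 0) (a := 1)
        (Q := fun _ => True) (o' := j + (t + 1) * eo) (a' := j * 2 + (t + 1) * ea)
        ⟨_, _, rfl, le_rfl, le_rfl, trivial⟩ ?_).mono (by omega) le_rfl fun _ h => h
      intro good _
      have hrest' : rest.erase e ⊆ ground.toFinset := (Finset.erase_subset _ _).trans hrest
      split_ifs
      · refine (RComp.AllSat.lift_bind (henum e (List.mem_toFinset.mp (hrest he)))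
          (o' := j + t * eo) (a' := j * 2 + t * ea) ?_).mono (by ring_nf; omega)
          (by ring_nf; omega) fun _ h => h
        rintro r ⟨h1, h2, -⟩
        refine (ih t (rest.erase e) (found ++ [r]) hrest' ?_).mono le_rfl le_rfl ?_
        · intro x hx
          rcases List.mem_append.mp hx with hx | hx
          · exact hf x hx
          · rw [List.mem_singleton] at hx
            subst hx
            exact ⟨h1, h2⟩
        · rintro L ⟨h3, h4, h5⟩
          refine ⟨?_, h4, fun x hx => h5 x (List.mem_append_left _ hx)⟩
          rw [List.length_append, List.length_singleton] at h3
          omega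
      · exact ih (t + 1) (rest.erase e) found hrest' hf
    · exact RComp.AllSat.pure ⟨Nat.le_add_right _ _, hf, fun _ h => h⟩

/-- As long as the optimum was missed, it lies entirely among the undrawn elements, so the next draw
hits it with chance at least `r/n`. Hence each counter unit contributes a factor `1 - r/n`. -/
theorem mainLoop_fail_le (henum : EnumSat I par ground Sopt goal eo ea)
    (hgood : ∀ e ∈ Sopt, bar ≤ I.f {e}) (hne : Sopt.Nonempty) (j : ℕ) :
    ∀ (t : ℕ) (rest : Finset (Fin n)) (found : List (Valued n)), rest ⊆ ground.toFinset →
      (∀ x ∈ found, I.Feasible x.1 ∧ x.2 = I.f x.1) → Sopt ⊆ rest → rest.card ≤ j →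
      (mainLoop I par ground bar j t rest found).fail (fun L => ∃ x ∈ L, goal ≤ x.2) ≤
        ENNReal.ofReal ((1 - Sopt.card / n) ^ t) := by
  have hn0 : 0 < n := by
    obtain ⟨e, -⟩ := hne
    exact e.pos
  have hnR : (0 : ℝ) < n := by exact_mod_cast hn0
  have hcn : (Sopt.card : ℝ) ≤ n := by
    have := Finset.card_le_univ Sopt
    rw [Fintype.card_fin] at this
    exact_mod_cast this
  set q : ℝ := 1 - Sopt.card / n with hq
  have hq0 : 0 ≤ q := by rw [hq, sub_nonneg, div_le_one hnR]; exact hcn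
  have hq1 : q ≤ 1 := by rw [hq]; linarith [show (0 : ℝ) ≤ Sopt.card / n by positivity]
  induction j with
  | zero =>
    intro t rest found _ _ hsub hcard
    rw [Nat.le_zero, Finset.card_eq_zero] at hcard
    subst hcard
    exact absurd (hne.mono hsub) (by simp)
  | succ j ih =>
    intro t rest found hrest hf hsub hcard
    rcases Nat.eq_zero_or_pos t with rfl | ht
    · rw [pow_zero, ENNReal.ofReal_one]
      exact RComp.fail_le_one _ _
    obtain ⟨t, rfl⟩ : ∃ t', t = t' + 1 := Nat.exists_eq_succ_of_ne_zero ht.ne'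
    have hrne : rest.Nonempty := hne.mono hsub
    rw [mainLoop, dif_pos ⟨ht, hrne⟩]
    -- A hit cannot fail; a miss leaves a counter of at least `t`.
    refine (RComp.fail_draw_bind_le
      (t := fun e => if e ∈ Sopt then 0 else ENNReal.ofReal (q ^ t)) fun e he => ?_).trans ?_
    · refine RComp.fail_lift_bind_le (x := askValue I {e}) (o := 1) (a := 0)
        (Q := fun v => v = I.f {e}) ⟨_, _, rfl, le_rfl, le_rfl, rfl⟩ ?_
      rintro _ rfl
      refine RComp.fail_lift_bind_le (x := ops 1 _) (o := 0) (a := 1)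
        (Q := fun g : Bool => g = true ↔ bar ≤ I.f {e})
        ⟨_, _, rfl, le_rfl, le_rfl, decide_eq_true_iff⟩ ?_
      intro good hg
      have hrest' : rest.erase e ⊆ ground.toFinset := (Finset.erase_subset _ _).trans hrest
      have hcard' : (rest.erase e).card ≤ j := by
        rw [Finset.card_erase_of_mem he]; omega
      have hsub' : e ∉ Sopt → Sopt ⊆ rest.erase e := fun h => Finset.subset_erase.mpr ⟨hsub, h⟩
      split_ifs with hgt heS heS
      · refine RComp.fail_lift_bind_le (henum e (List.mem_toFinset.mp (hrest he))) ?_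
        rintro r ⟨h1, h2, h3⟩
        refine le_of_eq (RComp.AllSat.fail_eq_zero (o := j + t * eo) (a := j * 2 + t * ea) ?_)
        refine (mainLoop_allSat henum j t (rest.erase e) (found ++ [r]) hrest' ?_).mono
          le_rfl le_rfl ?_
        · intro x hx
          rcases List.mem_append.mp hx with hx | hx
          · exact hf x hx
          · rw [List.mem_singleton] at hx
            subst hx
            exact ⟨h1, h2⟩
        · rintro L ⟨-, -, h5⟩
          exact ⟨r, h5 r (by simp), h3 heS⟩
      · refine RComp.fail_lift_bind_le (henum e (List.mem_toFinset.mp (hrest he))) ?_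
        rintro r ⟨h1, h2, -⟩
        refine ih t (rest.erase e) (found ++ [r]) hrest' ?_ (hsub' heS) hcard'
        intro x hx
        rcases List.mem_append.mp hx with hx | hx
        · exact hf x hx
        · rw [List.mem_singleton] at hx
          subst hx
          exact ⟨h1, h2⟩
      · exact absurd (hg.mpr (hgood e heS)) hgt
      -- An element below the bar keeps the counter, which only improves the bound.
      · refine (ih (t + 1) (rest.erase e) found hrest' hf (hsub' heS) hcard').trans ?_
        exact ENNReal.ofReal_le_ofReal (pow_le_pow_of_le_one hq0 hq1 (Nat.le_succ t))
    · have hNpos : (0 : ℝ) < rest.card := by exact_mod_cast hrne.card_pos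
      have hNn : (rest.card : ℝ) ≤ n := by
        have := Finset.card_le_univ rest
        rw [Fintype.card_fin] at this
        exact_mod_cast this
      have hsum : ∑ e ∈ rest, (if e ∈ Sopt then 0 else ENNReal.ofReal (q ^ t)) =
          ENNReal.ofReal ((rest.card - Sopt.card) * q ^ t) := by
        rw [Finset.sum_ite, Finset.sum_const_zero, zero_add, Finset.sum_const, nsmul_eq_mul]
        have h1 : rest.filter (· ∉ Sopt) = rest \ Sopt := by
          ext x; simp
        rw [h1, Finset.card_sdiff_of_subset hsub, ENNReal.ofReal_mul,
          ← Nat.cast_sub (Finset.card_le_card hsub), ENNReal.ofReal_natCast]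
        rw [sub_nonneg]
        exact_mod_cast Finset.card_le_card hsub
      rw [hsum, ← ENNReal.ofReal_natCast, ← ENNReal.ofReal_inv_of_pos hNpos,
        ← ENNReal.ofReal_mul (by positivity)]
      refine ENNReal.ofReal_le_ofReal ?_
      rw [← mul_assoc, pow_succ']
      refine mul_le_mul_of_nonneg_right ?_ (pow_nonneg hq0 t)
      rw [mul_sub, inv_mul_cancel₀ hNpos.ne', hq, inv_mul_eq_div]
      -- Drawing without replacement only increases the chance of a hit.
      have : (Sopt.card : ℝ) / n ≤ Sopt.card / rest.card :=
        div_le_div_of_nonneg_left (by positivity) hNpos hNn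
      linarith

theorem feasibleElements_sat (I : Instance n k m) :
    (feasibleElements I).Sat (n * 2) (n * m) fun L =>
      L.length ≤ n ∧ (L.map Prod.fst).Nodup ∧
      (∀ x ∈ L, I.Feasible {x.1} ∧ x.2 = ({x.1}, I.f {x.1})) ∧
      ∀ e, I.Feasible {e} → (e, ({e}, I.f {e})) ∈ L := by
  unfold feasibleElements
  refine (Comp.Sat.foldlM (o := 2) (a := m)
    (fun pre (L : List (Fin n × Valued n)) => (L.map Prod.fst).Sublist pre ∧
      (∀ x ∈ L, I.Feasible {x.1} ∧ x.2 = ({x.1}, I.f {x.1})) ∧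
      ∀ e ∈ pre, I.Feasible {e} → (e, ({e}, I.f {e})) ∈ L)
    (List.finRange n) [] (by simp) ?_).mono (by simp) (by simp) ?_
  · rintro pre e L - ⟨h1, h2, h3⟩
    refine (Comp.Sat.bind (o' := 1) (a' := 0) (checkFeasible_sat I _) fun b hb => ?_).mono le_rfl
      (by simp) fun _ h => h
    cases b with
    | true =>
      have hfe := hb.mp rfl
      rw [if_pos rfl]
      refine (Comp.Sat.askValue_bind (o := 0) (Comp.Sat.pure ⟨?_, ?_, ?_⟩))
      · rw [List.map_append]
        exact h1.append (by simp)
      · intro x hx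
        rcases List.mem_append.mp hx with hx | hx
        · exact h2 x hx
        · rw [List.mem_singleton] at hx
          subst hx
          exact ⟨hfe, rfl⟩
      · intro e' he' hf'
        rcases List.mem_append.mp he' with he' | he'
        · exact List.mem_append_left _ (h3 e' he' hf')
        · rw [List.mem_singleton] at he'
          subst he'
          simp
    | false =>
      have hfe : ¬ I.Feasible {e} := fun h => absurd (hb.mpr h) (by simp)
      refine Comp.Sat.pure ⟨h1.trans (List.sublist_append_left _ _), h2, ?_⟩
      intro e' he' hf'
      rcases List.mem_append.mp he' with he' | he'
      · exact h3 e' he' hf'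
      · rw [List.mem_singleton] at he'
        subst he'
        exact absurd hf' hfe
  · rintro L ⟨h1, h2, h3⟩
    refine ⟨?_, h1.nodup (List.nodup_finRange n), h2, fun e he => h3 e (List.mem_finRange e) he⟩
    simpa using h1.length_le

/-- Correctness of the whole algorithm, given the analysis for the enumerated elements. -/
theorem sproutPP_spec (hopt : I.IsOptimal Sopt) {eStar : Fin n} (hbest : I.IsBestElement eStar)
    (hgood : ∀ e ∈ Sopt, (1 - par.α) * I.f {eStar} ≤ I.f {e})
    (henum : ∀ ground : List (Fin n), ground.Nodup → (∀ e, e ∈ ground ↔ I.Feasible {e}) →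
      EnumSat I par ground Sopt goal eo ea) :
    (sproutPP I par).AllSat (n * 2 + (n + par.tc * eo))
        (n * m + (n + (2 + (n * 2 + par.tc * ea + par.tc)))) (fun S => I.Feasible S) ∧
      (Sopt.Nonempty → (sproutPP I par).fail (fun S => goal ≤ I.f S) ≤
        ENNReal.ofReal ((1 - Sopt.card / n) ^ par.tc)) := by
  have hstar : ∀ L : List (Fin n × Valued n), L.length ≤ n →
      (∀ x ∈ L, I.Feasible {x.1} ∧ x.2 = ({x.1}, I.f {x.1})) →
      (∀ e, I.Feasible {e} → (e, ({e}, I.f {e})) ∈ L) →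
      (argmaxD (L.map Prod.snd) (∅, 0)).Sat 0 n fun r => r.2 = I.f {eStar} := by
    intro L h1 h2 h3
    refine (argmaxD_sat _ _).mono le_rfl (by simpa using h1) ?_
    rintro r ⟨hmax, hr⟩
    have hmem : (({eStar}, I.f {eStar}) : Valued n) ∈ L.map Prod.snd :=
      List.mem_map.mpr ⟨_, h3 eStar hbest.1, rfl⟩
    refine le_antisymm ?_ (hmax _ hmem)
    rcases hr with hr | ⟨hr, -⟩
    · obtain ⟨x, hx, rfl⟩ := List.mem_map.mp hr
      obtain ⟨h4, h5⟩ := h2 x hx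
      rw [h5]
      exact hbest.2 _ h4
    · rw [hr] at hmem; simp at hmem
  have hgr : ∀ L : List (Fin n × Valued n),
      (∀ x ∈ L, I.Feasible {x.1} ∧ x.2 = ({x.1}, I.f {x.1})) →
      (∀ e, I.Feasible {e} → (e, ({e}, I.f {e})) ∈ L) →
      ∀ e, e ∈ L.map Prod.fst ↔ I.Feasible {e} := by
    intro L h2 h3 e
    refine ⟨fun he => ?_, fun he => List.mem_map.mpr ⟨_, h3 e he, rfl⟩⟩
    obtain ⟨x, hx, rfl⟩ := List.mem_map.mp he
    exact (h2 x hx).1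
  have hempty : I.Feasible ∅ := hbest.1.subset (Finset.empty_subset _)
  constructor
  · unfold sproutPP
    refine RComp.AllSat.lift_bind (feasibleElements_sat I) ?_
    rintro L ⟨h1, hnd, h2, h3⟩
    refine (RComp.AllSat.lift_bind (hstar L h1 h2 h3) (o' := n + par.tc * eo) ?_).mono
      (by omega) le_rfl fun _ h => h
    rintro ⟨_, _⟩ rfl
    refine (RComp.AllSat.lift_bind (x := ops 2 _) (o := 0) (a := 2) (Q := fun _ => True)
      (o' := n + par.tc * eo) ⟨_, _, rfl, le_rfl, le_rfl, trivial⟩ ?_).mono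
      (by omega) le_rfl fun _ h => h
    intro bar _
    have hen := henum _ hnd (hgr L h2 h3)
    have hml := mainLoop_allSat (bar := bar) hen n par.tc (L.map Prod.fst).toFinset [] subset_rfl
      (by simp)
    refine (RComp.AllSat.bind (o' := 0) (a' := par.tc) hml ?_).mono le_rfl le_rfl fun _ h => h
    rintro F ⟨h4, h5, -⟩
    refine (RComp.AllSat.lift_bind (o' := 0) (a' := 0) ((argmaxD_sat F _).mono le_rfl
      (show F.length ≤ par.tc by simpa using h4) fun _ h => h) ?_)
    rintro r ⟨-, hr⟩
    refine RComp.AllSat.pure ?_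
    rcases hr with hr | ⟨-, rfl⟩
    · exact (h5 r hr).1
    · exact hempty
  · intro hne
    unfold sproutPP
    refine RComp.fail_lift_bind_le (feasibleElements_sat I) ?_
    rintro L ⟨h1, hnd, h2, h3⟩
    refine RComp.fail_lift_bind_le (hstar L h1 h2 h3) ?_
    rintro ⟨_, _⟩ rfl
    refine RComp.fail_lift_bind_le (x := ops 2 _) (o := 0) (a := 2)
      (Q := fun bar => bar = (1 - par.α) * I.f {eStar}) ⟨_, _, rfl, le_rfl, le_rfl, rfl⟩ ?_
    rintro _ rfl
    have hg := hgr L h2 h3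
    have hen := henum _ hnd hg
    have hml := mainLoop_allSat (bar := (1 - par.α) * I.f {eStar}) hen n par.tc
      (L.map Prod.fst).toFinset [] subset_rfl (by simp)
    refine le_trans ?_ (mainLoop_fail_le hen hgood hne n par.tc (L.map Prod.fst).toFinset []
      subset_rfl (by simp) ?_ ?_)
    · refine RComp.fail_bind_le (o' := 0 + 0) (a' := par.tc + 0) hml ?_
      rintro F ⟨h4, h5, -⟩ ⟨x, hx, hgoal⟩
      refine RComp.AllSat.lift_bind (o' := 0) (a' := 0) ((argmaxD_sat F _).mono le_rfl
        (show F.length ≤ par.tc by simpa using h4) fun _ h => h) ?_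
      rintro r ⟨hmax, hr⟩
      refine RComp.AllSat.pure ?_
      rcases hr with hr | ⟨rfl, -⟩
      · rw [← (h5 r hr).2]
        exact hgoal.trans (hmax x hx)
      · simp at hx
    · intro e he
      rw [List.mem_toFinset, hg]
      exact hopt.1.subset (Finset.singleton_subset_iff.mpr he)
    · refine (Finset.card_le_univ _).trans ?_
      rw [Fintype.card_fin]

end MainLoop

/-! ### The approximation ratio -/

section Ratio

variable {p m ε α β γ F X V Y W v a Q R : ℝ}

/-- Dropping the term `αε(p+1)` gives `αm(1-ε) ≤ (1-ε)(p+1-(1-ε)²)`, and this is at most `p` because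
`(1-ε)³ ≥ 1-3ε` and `p+1 ≥ 3`. The first conclusion leaves at least one copy of `F` over in both
certificates; the second serves the case of small `X`. -/
theorem one_le_of_alpha_le (hp : 2 ≤ p) (hm : 1 ≤ m) (hε : 0 < ε) (hε1 : ε ≤ 1 / 10)
    (hα0 : 0 ≤ α)
    (hα : α ≤ (1 - ε) * (p + 1 - (1 - ε) ^ 2) / (ε * (p + 1) + m * (1 - ε))) :
    1 ≤ p + 1 - α * (m * (1 - ε)) ∧ α ≤ p + 1 := by
  have hden : 0 < ε * (p + 1) + m * (1 - ε) := by nlinarith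
  rw [le_div_iff₀ hden] at hα
  have h1 : 0 ≤ α * (ε * (p + 1)) := by positivity
  have h2 : α * (m * (1 - ε)) ≤ (1 - ε) * (p + 1 - (1 - ε) ^ 2) := by linarith
  constructor
  · have h3 : (1 - ε) * (p + 1 - (1 - ε) ^ 2) ≤ p := by
      have e1 : 1 - 3 * ε ≤ (1 - ε) ^ 3 := by nlinarith [sq_nonneg ε, mul_pos hε hε]
      have e2 : 3 * ε ≤ ε * (p + 1) := by nlinarith
      nlinarith
    linarith
  · have h3 : α * (1 - ε) ≤ α * (m * (1 - ε)) :=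
      mul_le_mul_of_nonneg_left (by nlinarith) hα0
    have h4 : (1 - ε) * (p + 1 - (1 - ε) ^ 2) ≤ (1 - ε) * (p + 1) :=
      mul_le_mul_of_nonneg_left (by nlinarith [sq_nonneg (1 - ε)]) (by linarith)
    have h5 : α * (1 - ε) ≤ (p + 1) * (1 - ε) := by linarith
    exact le_of_mul_le_mul_right h5 (by linarith)

/-- The case in which no knapsack was violated. -/
theorem bound_of_density (hp : 2 ≤ p) (hm : 1 ≤ m) (hε : 0 < ε) (hε1 : ε ≤ 1 / 10)
    (hT : 1 ≤ p + 1 - α * (m * (1 - ε)))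
    (hQ : Q = p + 1 + m * (1 - ε)) (ha : a = (1 - ε) * (1 - 1 / (p + 1) - ε))
    (hβ : β * Q = a) (hγ : γ * Q = (1 + α) * (p + 1)) (hF : 0 ≤ F) (hW : F ≤ W)
    (hV : (1 + ε) ^ 2 * V ≤ Y) (hV0 : 0 < V) (hY : Y ≤ X)
    (h : (1 - ε) * (p + 1 - 1) * (X + F) ≤ (p + 1) *
      ((1 - ε) * W + p * (W - F) + (1 - ε) * m * (β * Y + γ * F) + ε * V)) :
    a * (X + F) ≤ (p + 1 + m + m / (p + 1) ^ 2) * W := by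
  set L := p + 1 with hL
  set g := 1 / L with hg
  have hL0 : 0 < L := by linarith
  have hg1 : g * L = 1 := by rw [hg]; field_simp
  have hg0 : 0 < g := by positivity
  have hg3 : g ≤ 1 / 3 := by rw [hg, div_le_div_iff₀ hL0 (by norm_num)]; linarith
  have ha0 : 0 ≤ a := by rw [ha]; exact mul_nonneg (by linarith) (by linarith)
  have hm0 : 0 ≤ m := by linarith
  have hQ0 : 0 < Q := by
    rw [hQ]
    linarith [mul_nonneg hm0 (show 0 ≤ 1 - ε by linarith)]
  have hmQ : (1 - ε) * m = Q - L := by rw [hQ]; ring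
  -- Two factors `1+ε` are needed: `(1-ε)(1+ε)² ≥ 1`, whereas `(1-ε)(1+ε) < 1`. Hence density
  -- certificates are kept with exponent at least 2.
  have hVX : V ≤ (1 - ε) * X := by
    have e1 : 1 ≤ (1 - ε) * (1 + ε) ^ 2 := by
      have : ε * ε ≤ 1 / 10 * (1 / 10) := mul_le_mul hε1 hε1 hε.le (by norm_num)
      linarith [mul_nonneg hε.le (show 0 ≤ 1 - ε - ε * ε by linarith)]
    have e2 : (1 - ε) * ((1 + ε) ^ 2 * V) ≤ (1 - ε) * X :=
      mul_le_mul_of_nonneg_left (hV.trans hY) (by linarith)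
    linarith [mul_le_mul_of_nonneg_right e1 hV0.le]
  have h1 : (1 - ε) * (1 - g) * (X + F) ≤
      (1 - ε) * W + p * (W - F) + (1 - ε) * m * (β * Y + γ * F) + ε * V := by
    have e1 := mul_le_mul_of_nonneg_left h hg0.le
    have e2 : g * (L * ((1 - ε) * W + p * (W - F) + (1 - ε) * m * (β * Y + γ * F) + ε * V)) =
        (g * L) * ((1 - ε) * W + p * (W - F) + (1 - ε) * m * (β * Y + γ * F) + ε * V) := by ring
    have e3 : g * ((1 - ε) * (L - 1) * (X + F)) = (1 - ε) * (g * L - g) * (X + F) := by ring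
    rw [e2, e3, hg1, one_mul] at e1
    exact e1
  -- As `(1-ε)m = Q - L`, after multiplication by `Q` the density term contains `(Q-L)aX`, which
  -- cancels against `QaX` and leaves `LaX`; `β` is chosen for this.
  have h2 : Q * ((1 - ε) * m * (β * Y + γ * F)) ≤ (Q - L) * (a * X + (1 + α) * L * F) := by
    have e1 : Q * ((1 - ε) * m * (β * Y + γ * F)) = (Q - L) * (a * Y + (1 + α) * L * F) := by
      rw [hmQ, ← hβ, ← hγ]; ring
    rw [e1]
    have e2 : a * Y ≤ a * X := mul_le_mul_of_nonneg_left hY ha0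
    refine mul_le_mul_of_nonneg_left (by linarith) ?_
    rw [← hmQ]
    exact mul_nonneg (by linarith) hm0
  -- Moving `εV ≤ ε(1-ε)X` to the left turns `(1-ε)(1-1/ℓ)X` into `aX`.
  have h3 : a * X + (1 - ε) * (1 - g) * F ≤
      L * W - (p + ε) * F + (1 - ε) * m * (β * Y + γ * F) := by
    have e1 : ε * V ≤ ε * ((1 - ε) * X) := mul_le_mul_of_nonneg_left hVX hε.le
    have e2 : ε * F ≤ ε * W := mul_le_mul_of_nonneg_left hW hε.le
    rw [ha]
    linear_combination h1 + e1 + e2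
  have h4 : L * (a * X) ≤ L * (Q * W - (1 - (1 - ε) * Q * g ^ 2) * F) := by
    have e1 := mul_le_mul_of_nonneg_left h3 hQ0.le
    have e2 : L * F ≤ L * ((L - α * (m * (1 - ε))) * F) :=
      mul_le_mul_of_nonneg_left (le_mul_of_one_le_left hF hT) hL0.le
    have e3 : α * (m * (1 - ε)) = α * (Q - L) := by rw [← hmQ]; ring
    rw [e3] at e2
    have e4 : L * ((1 - ε) * Q * g ^ 2) = (1 - ε) * Q * g := by
      calc _ = (1 - ε) * Q * g * (g * L) := by ring
        _ = _ := by rw [hg1, mul_one]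
    have e5 : L * (Q * W - (1 - (1 - ε) * Q * g ^ 2) * F) =
        L * (Q * W) - L * F + L * ((1 - ε) * Q * g ^ 2) * F := by ring
    rw [e5, e4]
    have e6 : p = L - 1 := by rw [hL]; ring
    rw [e6] at e1
    linear_combination e1 + h2 + e2
  have h5 := le_of_mul_le_mul_left h4 hL0
  -- The remaining coefficient of `F`. Here `a ≤ 1-g` cancels `L g² = g`, and the rest is the extra
  -- term `m/(p+1)²`.
  have h6 : a - 1 + (1 - ε) * Q * g ^ 2 ≤ m * g ^ 2 := by
    have e1 : a ≤ 1 - g := by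
      have := mul_nonneg hε.le (show 0 ≤ 1 - g - ε by linarith)
      rw [ha]
      linarith
    have e2 : (1 - ε) * Q ≤ L + m := by
      have e3 := mul_nonneg hε.le hL0.le
      have e4 := mul_nonneg (mul_nonneg hm0 hε.le)
        (show 0 ≤ 2 - ε by linarith)
      rw [hQ]
      linarith
    have e3 : (1 - ε) * Q * g ^ 2 ≤ (L + m) * g ^ 2 :=
      mul_le_mul_of_nonneg_right e2 (sq_nonneg g)
    have e4 : L * g ^ 2 = g := by rw [pow_two, ← mul_assoc, mul_comm L, hg1, one_mul]
    linarith
  have h7 : m / L ^ 2 = m * g ^ 2 := by rw [hg]; field_simp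
  rw [h7]
  have hW0 : 0 ≤ W := hF.trans hW
  have h8 : (a - 1 + (1 - ε) * Q * g ^ 2) * F ≤ m * g ^ 2 * W :=
    (mul_le_mul_of_nonneg_right h6 hF).trans
      (mul_le_mul_of_nonneg_left hW (mul_nonneg (by linarith) (sq_nonneg g)))
  have h9 : Q * W ≤ (L + m) * W := by
    refine mul_le_mul_of_nonneg_right ?_ hW0
    have := mul_nonneg hm0 hε.le
    rw [hQ]
    linarith
  linear_combination h5 + h8 + h9

/-- The case in which a knapsack was violated. -/
theorem bound_of_violation (hp : 2 ≤ p) (hm : 1 ≤ m) (hε : 0 < ε) (hε1 : ε ≤ 1 / 10)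
    (hT : 1 ≤ p + 1 - α * (m * (1 - ε)))
    (hQ : Q = p + 1 + m * (1 - ε)) (ha0 : 0 ≤ a) (ha1 : a ≤ 1)
    (hβ : β * Q = a) (hγ : γ * Q = (1 + α) * (p + 1)) (hF : 0 ≤ F) (hv : v ≤ (1 + α) * F)
    (hY : X ≤ (1 + ε) * Y) (h : F + (β * Y + γ * F) - v ≤ W) :
    a * (X + F) ≤ (1 + ε) * (Q * W) := by
  have hQ0 : 0 < Q := by rw [hQ]; nlinarith
  -- With `v ≤ (1+α)F`, the choice of `γ` leaves `p+1-αm(1-ε) ≥ 1` copies of `F`.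
  have h1 : a * Y + F ≤ Q * W := by
    have e1 := mul_le_mul_of_nonneg_left h hQ0.le
    have e2 := mul_le_mul_of_nonneg_left hv hQ0.le
    have e3 : Q * (F + (β * Y + γ * F) - v) =
        Q * F + (β * Q) * Y + (γ * Q) * F - Q * v := by ring
    rw [e3, hβ, hγ] at e1
    have e4 : F ≤ (p + 1 - α * (m * (1 - ε))) * F := by nlinarith
    rw [hQ] at e1 e2 ⊢
    linear_combination e1 + e2 + e4
  have h2 : a * X ≤ a * ((1 + ε) * Y) := mul_le_mul_of_nonneg_left hY ha0
  have h3 := mul_le_mul_of_nonneg_left h1 (show 0 ≤ 1 + ε by linarith)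
  have h4 : a * F ≤ 1 * F := mul_le_mul_of_nonneg_right ha1 hF
  nlinarith

theorem final_ratio (hp : 2 ≤ p) (hε : 0 < ε) (hε1 : ε ≤ 1 / 10)
    (ha : a = (1 - ε) * (1 - 1 / (p + 1) - ε)) (hW : 0 ≤ W) (hX : 0 ≤ X)
    (hR : (p + 1 + m + m / (p + 1) ^ 2) * (p + 1) ≤ R * p) (hR0 : 0 ≤ R)
    (h : a * X ≤ (1 + ε) * ((p + 1 + m + m / (p + 1) ^ 2) * W)) :
    X ≤ (1 + 10 * ε) * R * W := by
  have hp1 : 0 < p + 1 := by linarith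
  -- Uses `p+1 ≤ 3p/2`, that is, `p ≥ 2`.
  have h1 : (1 - ε) * (1 - 3 / 2 * ε) * p ≤ a * (p + 1) := by
    have e1 : a * (p + 1) = (1 - ε) * (p - ε * (p + 1)) := by
      rw [ha]; field_simp; ring
    rw [e1, mul_assoc]
    refine mul_le_mul_of_nonneg_left ?_ (by linarith)
    nlinarith
  have h2 : (1 - ε) * (1 - 3 / 2 * ε) * p * X ≤ (1 + ε) * (R * p * W) := by
    have e1 := mul_le_mul_of_nonneg_right h1 hX
    have e2 := mul_le_mul_of_nonneg_right h hp1.le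
    have e3 := mul_le_mul_of_nonneg_right hR hW
    have e4 := mul_le_mul_of_nonneg_left e3 (show 0 ≤ 1 + ε by linarith)
    linarith
  have h3 : (1 - ε) * (1 - 3 / 2 * ε) * X ≤ (1 + ε) * (R * W) := by
    refine le_of_mul_le_mul_right ?_ (show 0 < p by linarith)
    linarith
  -- All error factors together cost at most `1+10ε` for `ε ≤ 1/10`; this fixes `κ = 1/10`.
  have h4 : 1 + ε ≤ (1 + 10 * ε) * ((1 - ε) * (1 - 3 / 2 * ε)) := by nlinarith [mul_pos hε hε]
  have h5 : (1 + ε) * (R * W) ≤ (1 + 10 * ε) * ((1 - ε) * (1 - 3 / 2 * ε)) * (R * W) :=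
    mul_le_mul_of_nonneg_right h4 (mul_nonneg hR0 hW)
  have h6 : 0 < (1 - ε) * (1 - 3 / 2 * ε) := mul_pos (by linarith) (by linarith)
  refine le_of_mul_le_mul_left (h3.trans (h5.trans_eq ?_)) h6
  ring

/-- With `s = √(m+1) ≤ p`, the left side expands to `p² + 2p + mp + (m+1) + m/(p+1)`, where `m+1 =
s² ≤ sp` and `m/(p+1) ≤ p`. The result `p(p+3+m+s)` is bounded through `p ≤ k+s`, which uses `k ≥ 1`
to absorb the ceiling. -/
theorem bigP_bound (k m : ℕ) (hk : 1 ≤ k) (hm : 1 ≤ m) :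
    2 ≤ bigP k m ∧ k ≤ bigP k m ∧
      ((bigP k m : ℝ) + 1 + m + m / ((bigP k m : ℝ) + 1) ^ 2) * ((bigP k m : ℝ) + 1) ≤
        (k + m + 3 + 2 * Real.sqrt (m + 1)) * bigP k m := by
  have hm1 : (1 : ℝ) ≤ m := by exact_mod_cast hm
  have hk1 : (1 : ℝ) ≤ k := by exact_mod_cast hk
  set s : ℝ := Real.sqrt (m + 1) with hs
  have hss : s * s = m + 1 := Real.mul_self_sqrt (by linarith)
  have hs0 : 0 ≤ s := Real.sqrt_nonneg _
  have hs1 : 1 < s := by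
    rw [hs, Real.lt_sqrt (by norm_num)]; linarith
  have hdef : bigP k m = max ⌈s⌉₊ k := by rw [bigP, hs, add_comm]
  have hceil : s ≤ bigP k m := by
    rw [hdef]
    exact (Nat.le_ceil s).trans (by exact_mod_cast le_max_left _ _)
  have h2 : 2 ≤ bigP k m := by
    rw [hdef]
    refine le_max_of_le_left (Nat.succ_le_of_lt (Nat.lt_ceil.mpr (by simpa using hs1)))
  refine ⟨h2, le_max_right _ _, ?_⟩
  have hsum : (bigP k m : ℝ) ≤ k + s := by
    rcases max_choice ⌈s⌉₊ k with h | h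
    · rw [hdef, h]
      have := (Nat.ceil_lt_add_one hs0).le
      linarith
    · rw [hdef, h]; linarith
  set p : ℝ := (bigP k m : ℝ) with hp
  have hp2 : 2 ≤ p := by rw [hp]; exact_mod_cast h2
  have e1 : (m : ℝ) + 1 ≤ s * p := by rw [← hss]; exact mul_le_mul_of_nonneg_left hceil hs0
  have e2 : (m : ℝ) / (p + 1) ^ 2 * (p + 1) ≤ p := by
    have : (m : ℝ) / (p + 1) ^ 2 * (p + 1) = m / (p + 1) := by field_simp
    rw [this, div_le_iff₀ (by linarith)]
    nlinarith
  nlinarith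

end Ratio

/-- The value of the result for an optimal enumerated element. -/
theorem SearchGuarantee.approx {n k m : ℕ} {I : Instance n k m} {A O : Finset (Fin n)}
    {ε α μ v W : ℝ} {tc : ℕ} (hk : 1 ≤ k) (hm : 1 ≤ m) (hε : 0 < ε) (hε1 : ε ≤ 1 / 10)
    (hα0 : 0 ≤ α) (hα : α ≤ alphaBound k m ε) (hv : v ≤ (1 + α) * I.f A) (hW : I.f A ≤ W)
    (h : SearchGuarantee I (analysisParams k m ε α μ tc) A O (bigP k m) v W) :
    I.f (A ∪ O) ≤ (1 + 10 * ε) * (k + m + 3 + 2 * Real.sqrt (m + 1)) * W := by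
  obtain ⟨hp2, hkp, hR⟩ := bigP_bound k m hk hm
  have hsmall : smallP k (bigP k m + 1) = bigP k m := by
    rw [smallP, Nat.add_sub_cancel]; exact max_eq_left hkp
  set R : ℝ := k + m + 3 + 2 * Real.sqrt (m + 1) with hRdef
  set P := bigP k m with hP
  set p : ℝ := (P : ℝ) with hp
  set F := I.f A with hFdef
  have hp2' : 2 ≤ p := by rw [hp]; exact_mod_cast hp2
  have hm1 : (1 : ℝ) ≤ m := by exact_mod_cast hm
  have hF : 0 ≤ F := I.f_nonneg A
  have hW0 : 0 ≤ W := hF.trans hW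
  have hR0 : 0 ≤ R := by positivity
  -- For the cases in which `OPT` is compared directly with `F ≤ W`.
  have hRp : p + 3 ≤ R := by
    have e1 : 0 ≤ (m : ℝ) / (p + 1) ^ 2 := by positivity
    have e2 : (p + 3) * p ≤ R * p := by
      refine le_trans ?_ hR
      have e3 := mul_nonneg e1 (show 0 ≤ p + 1 by linarith)
      have e4 := mul_le_mul_of_nonneg_right hm1 (show 0 ≤ p + 1 by linarith)
      linarith
    exact le_of_mul_le_mul_right e2 (by linarith)
  have hα' : α ≤ (1 - ε) * (p + 1 - (1 - ε) ^ 2) / (ε * (p + 1) + m * (1 - ε)) := by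
    rw [alphaBound, ← hP, hsmall] at hα
    exact hα
  obtain ⟨hT, hαp⟩ := one_le_of_alpha_le hp2' hm1 hε hε1 hα0 hα'
  set Q : ℝ := p + 1 + m * (1 - ε) with hQ
  have hm0 : (0 : ℝ) ≤ m := by linarith
  have hQ0 : 0 < Q := by
    rw [hQ]
    linarith [mul_nonneg hm0 (show 0 ≤ 1 - ε by linarith)]
  set a : ℝ := (1 - ε) * (1 - 1 / (p + 1) - ε) with ha
  have hg3 : 1 / (p + 1) ≤ 1 / 3 := by
    rw [div_le_div_iff₀ (by linarith) (by norm_num)]; linarith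
  have hg0 : 0 < 1 / (p + 1) := by positivity
  have ha0 : 0 ≤ a := mul_nonneg (by linarith) (by linarith)
  have ha1 : a ≤ 1 := by
    rw [ha]
    exact mul_le_one₀ (by linarith) (by linarith) (by linarith)
  have hβ : (analysisParams k m ε α μ tc).β * Q = a := by
    simp only [analysisParams, ← hP, hsmall]
    push_cast
    rw [← hp, ← hQ, ← ha]
    field_simp
  have hγ : (analysisParams k m ε α μ tc).γ * Q = (1 + α) * (p + 1) := by
    simp only [analysisParams, ← hP, hsmall]
    rw [← hp, ← hQ]
    field_simp
  have hfin : ∀ X, X + F = I.f (A ∪ O) →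
      a * (X + F) ≤ (1 + ε) * ((p + 1 + m + m / (p + 1) ^ 2) * W) →
      I.f (A ∪ O) ≤ (1 + 10 * ε) * R * W := by
    intro X hX h
    rw [hX] at h
    exact final_ratio hp2' hε hε1 ha hW0 (I.f_nonneg _) hR hR0 h
  have hF3 : ∀ c, c ≤ (1 + 10 * ε) * (p + 3) → c * F ≤ (1 + 10 * ε) * R * W := by
    intro c hc
    have e1 : c * F ≤ (1 + 10 * ε) * (p + 3) * F := mul_le_mul_of_nonneg_right hc hF
    have e2 : (1 + 10 * ε) * (p + 3) ≤ (1 + 10 * ε) * R :=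
      mul_le_mul_of_nonneg_left hRp (by linarith)
    exact e1.trans (mul_le_mul e2 hW hF (by positivity))
  have hQm : Q * W ≤ (p + 1 + m + m / (p + 1) ^ 2) * W := by
    refine mul_le_mul_of_nonneg_right ?_ hW0
    have : 0 ≤ (m : ℝ) / (p + 1) ^ 2 := by positivity
    rw [hQ]
    linarith [mul_nonneg hm0 hε.le]
  rcases h with h | ⟨V, Y, hV0, hVX, hVv, ⟨h1, h2, h3⟩ | ⟨h1, h2⟩ | h1⟩
  · have := hF3 1 (by linarith [mul_nonneg hε.le (show 0 ≤ p by linarith)])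
    linarith
  · refine hfin (I.f (A ∪ O) - F) (by ring) ?_
    have h3' : (1 - ε) * (p + 1 - 1) * (I.f (A ∪ O) - F + F) ≤ (p + 1) * ((1 - ε) * W
        + p * (W - F) + (1 - ε) * m * ((analysisParams k m ε α μ tc).β * Y
        + (analysisParams k m ε α μ tc).γ * F) + ε * V) := by
      have e1 : (((analysisParams k m ε α μ tc).ℓ : ℕ) : ℝ) = p + 1 := by
        simp only [analysisParams, ← hP]
        push_cast
        rfl
      rw [DensityBound, e1] at h3
      rw [sub_add_cancel]
      exact h3
    have := bound_of_density hp2' hm1 hε hε1 hT hQ ha hβ hγ hF hW h1 hV0 h2 h3'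
    refine this.trans ?_
    have e2 : 0 ≤ (p + 1 + m + m / (p + 1) ^ 2) * W := by positivity
    linarith [mul_nonneg hε.le e2]
  · refine hfin (I.f (A ∪ O) - F) (by ring) ?_
    have := bound_of_violation hp2' hm1 hε hε1 hT hQ ha0 ha1 hβ hγ hF hv h1 h2
    exact this.trans (mul_le_mul_of_nonneg_left hQm (by linarith))
  · have e1 : (1 + ε) ^ 2 * V ≤ (1 + ε) ^ 2 * ((1 + α) * F) :=
      mul_le_mul_of_nonneg_left (hVv.trans hv) (by positivity)
    have e2 : I.f (A ∪ O) - F ≤ (1 + ε) ^ 2 * V := h1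
    have e3 : (1 + ε) ^ 2 ≤ 1 + 10 * ε := by
      linarith [mul_nonneg hε.le (show 0 ≤ 8 - ε by linarith)]
    -- From `X ≤ (1+ε)²V` and `V ≤ (1+α)F`; the bound `α ≤ p+1` makes `2+α ≤ p+3`.
    have e4 : 1 + (1 + ε) ^ 2 * (1 + α) ≤ (1 + 10 * ε) * (p + 3) := by
      have e5 : (1 + ε) ^ 2 * (1 + α) ≤ (1 + 10 * ε) * (1 + α) :=
        mul_le_mul_of_nonneg_right e3 (by linarith)
      have e6 : 0 ≤ ε * (p + 1 - α) := mul_nonneg hε.le (by linarith)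
      linarith
    have := hF3 _ e4
    linarith

/-! ### The running time -/

/-- The bound `T` on the passes also serves as the bound on the exponents, the last argument of
`enumArith`, since powers are charged by their exponent. -/
theorem sproutPP_cost_le {n m P T R tc ℓ : ℕ} (hn : 1 ≤ n) (hm : 1 ≤ m) (hP : 1 ≤ P) (hT : 1 ≤ T)
    (hR : 1 ≤ R) (htc : 1 ≤ tc) (hℓ : ℓ = P + 1) :
    n * 2 + (n + tc * enumOracle R T n ℓ) ≤ 100 * (tc * (R * T * (n * P))) ∧
    n * m + (n + (2 + (n * 2 + tc * enumArith R T n ℓ m T + tc))) ≤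
      100 * (tc * (R * T * (n * P * m))) := by
  have hℓ2 : ℓ ≤ 2 * P := by omega
  have hnP : n ≤ n * P := Nat.le_mul_of_pos_right n hP
  have hRT : 1 ≤ R * T := Nat.mul_pos hR hT
  constructor
  · set w := n * P with hw
    have h1 : w ≤ R * T * w := Nat.le_mul_of_pos_left w hRT
    have h2 : sgsOracle T n ℓ ≤ 4 * (T * w) := by
      unfold sgsOracle
      calc T * (n * ℓ * 2) ≤ T * (n * (2 * P) * 2) := by gcongr
        _ = 4 * (T * w) := by rw [hw]; ring
    have h3 : enumOracle R T n ℓ ≤ 6 * (R * T * w) := by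
      unfold enumOracle
      have := Nat.mul_le_mul_left R h2
      have e : R * (4 * (T * w)) = 4 * (R * T * w) := by ring
      omega
    have h4 := Nat.mul_le_mul_left tc h3
    have h5 : R * T * w ≤ tc * (R * T * w) := Nat.le_mul_of_pos_left _ htc
    have e : tc * (6 * (R * T * w)) = 6 * (tc * (R * T * w)) := by ring
    omega
  · set w := n * P * m with hw
    have hw1 : n * P ≤ w := Nat.le_mul_of_pos_right _ hm
    have hPw : P ≤ w := (Nat.le_mul_of_pos_left P hn).trans hw1
    have hnm : n * m ≤ w := by
      rw [hw]; exact Nat.mul_le_mul_right m hnP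
    have hTw : w ≤ T * w := Nat.le_mul_of_pos_left w hT
    have hTw' : T ≤ T * w := Nat.le_mul_of_pos_right T (by omega)
    have h2 : sgsArith T n ℓ m ≤ 28 * (T * w) := by
      have e1 : n * ℓ * (7 * m + 3) ≤ 20 * w := by
        calc n * ℓ * (7 * m + 3) ≤ n * (2 * P) * (10 * m) := by
              gcongr; omega
          _ = 20 * w := by rw [hw]; ring
      have e2 : T * (n * ℓ * (7 * m + 3) + 2) ≤ 22 * (T * w) := by
        calc T * (n * ℓ * (7 * m + 3) + 2) ≤ T * (22 * w) := by gcongr; omega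
          _ = _ := by ring
      unfold sgsArith
      omega
    have h3 : R * (15 + T + sgsArith T n ℓ m) ≤ 44 * (R * T * w) := by
      calc R * (15 + T + sgsArith T n ℓ m) ≤ R * (44 * (T * w)) := by gcongr; omega
        _ = _ := by ring
    have hRw : R ≤ R * T * w := by
      rw [mul_assoc]; exact Nat.le_mul_of_pos_right R (by omega)
    have hw3 : w ≤ R * T * w := Nat.le_mul_of_pos_left w hRT
    have h4 : enumArith R T n ℓ m T ≤ 58 * (R * T * w) := by
      have e1 : n * (m * 2 + 1) = 2 * (n * m) + n := by ring
      unfold enumArith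
      omega
    have h5 := Nat.mul_le_mul_left tc h4
    have e : tc * (58 * (R * T * w)) = 58 * (tc * (R * T * w)) := by ring
    have h6 : R * T * w ≤ tc * (R * T * w) := Nat.le_mul_of_pos_left _ htc
    have h7 : tc ≤ tc * (R * T * w) := Nat.le_mul_of_pos_right tc (by omega)
    omega

theorem enumOracle_mono {R T N N' ℓ : ℕ} (h : N ≤ N') : enumOracle R T N ℓ ≤ enumOracle R T N' ℓ := by
  unfold enumOracle sgsOracle; gcongr

theorem enumArith_mono {R T N N' ℓ m B : ℕ} (h : N ≤ N') :
    enumArith R T N ℓ m B ≤ enumArith R T N' ℓ m B := by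
  unfold enumArith sgsArith; gcongr

/-- The number of passes and of rounds of the search. -/
theorem exists_iterations {n : ℕ} (hn : 1 ≤ n) {ε μ : ℝ} (hε : 0 < ε) (hε1 : ε < 1) (hμ : 1 ≤ μ) :
    ∃ T R : ℕ, 1 ≤ T ∧ 1 ≤ R ∧ (1 - ε / 10) ^ T ≤ ε / 10 / n ∧
      (∀ N : ℕ, N ≤ n → ⌈Real.logb 2 N / (ε / 10)⌉ ≤ (T : ℤ)) ∧
      (T : ℝ) * (1 - 1 / (2 * μ)) ^ R < 1 ∧
      (T : ℝ) ≤ 31 * ((1 + Real.log (n / ε)) / ε) ∧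
      (R : ℝ) ≤ 7 * ((1 + Real.log (n / ε)) * (Real.log (2 * μ / (2 * μ - 1)))⁻¹) := by
  have hn1 : (1 : ℝ) ≤ n := by exact_mod_cast hn
  have hn0 : (0 : ℝ) < n := by linarith
  have hlogn : 0 ≤ Real.log n := Real.log_nonneg hn1
  have hlogε : Real.log ε ≤ 0 := Real.log_nonpos hε.le hε1.le
  have hx : Real.log (n / ε) = Real.log n - Real.log ε := Real.log_div hn0.ne' hε.ne'
  set U : ℝ := 1 + Real.log (n / ε) with hU
  have hU1 : 1 ≤ U := by rw [hU, hx]; linarith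
  have hUε : 1 ≤ U / ε := by rw [le_div_iff₀ hε]; linarith
  have hlog2 := Real.log_two_gt_d9
  have hlog2' := Real.log_two_lt_d9
  -- With error `ε/10` the passes need `εT/10 ≥ log(10n/ε)`, covered by `3U` as `log 10 ≤ 3`; the
  -- exponents need `10 log₂ n/ε`, at most `20U/ε`. One `T` serves both.
  set T : ℕ := ⌈30 * (U / ε)⌉₊ with hT
  have hTge : 30 * (U / ε) ≤ T := Nat.le_ceil _
  have hTle : (T : ℝ) ≤ 31 * (U / ε) := by
    have := (Nat.ceil_lt_add_one (show 0 ≤ 30 * (U / ε) by positivity)).le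
    rw [← hT] at this
    linarith
  have hTε : 30 * U ≤ ε * T := by
    have := mul_le_mul_of_nonneg_left hTge hε.le
    have e : ε * (30 * (U / ε)) = 30 * U := by field_simp
    linarith
  have hTpos : 1 ≤ T := by
    have : (1 : ℝ) ≤ T := by linarith
    exact_mod_cast this
  set H : ℝ := (Real.log (2 * μ / (2 * μ - 1)))⁻¹ with hH
  have hμ1 : 0 < 2 * μ - 1 := by linarith
  have hfrac1 : 1 < 2 * μ / (2 * μ - 1) := by rw [lt_div_iff₀ hμ1]; linarith
  have hfrac2 : 2 * μ / (2 * μ - 1) ≤ 2 := by rw [div_le_iff₀ hμ1]; linarith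
  have hlogpos : 0 < Real.log (2 * μ / (2 * μ - 1)) := Real.log_pos hfrac1
  have hH1 : 1 ≤ H := by
    rw [hH]
    refine (one_le_inv₀ hlogpos).mpr ?_
    exact (Real.log_le_log (by linarith) hfrac2).trans (by linarith)
  have hH0 : 0 < H := by linarith
  have hlogT : Real.log (T + 1) ≤ 6 * U := by
    have e1 : (T : ℝ) + 1 ≤ 32 * (U / ε) := by linarith
    have e2 : Real.log (T + 1) ≤ Real.log (32 * (U / ε)) := Real.log_le_log (by positivity) e1
    have e3 : Real.log (32 * (U / ε)) = 5 * Real.log 2 + (Real.log U - Real.log ε) := by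
      rw [Real.log_mul (by norm_num) (by positivity), Real.log_div (by positivity) hε.ne']
      have : (32 : ℝ) = 2 ^ (5 : ℕ) := by norm_num
      rw [this, Real.log_pow]
      norm_num
    have e4 : Real.log U ≤ U := (Real.log_le_sub_one_of_pos (by linarith)).trans (by linarith)
    have e5 : -Real.log ε ≤ U := by rw [hU, hx]; linarith
    linarith
  have hlogT0 : 0 < Real.log (T + 1) := Real.log_pos (by
    have : (1 : ℝ) ≤ T := by exact_mod_cast hTpos
    linarith)
  -- A round multiplies the range by `1 - 1/(2μ) = exp(-1/H)`, so this many rounds bring a range of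
  -- `T` to at most `T/(T+1) < 1`.
  set R : ℕ := ⌈H * Real.log (T + 1)⌉₊ with hR
  have hRge : H * Real.log (T + 1) ≤ R := Nat.le_ceil _
  have hUH : 1 ≤ U * H := by nlinarith
  refine ⟨T, R, hTpos, Nat.ceil_pos.mpr (by positivity), ?_, ?_, ?_, hTle, ?_⟩
  · have e1 : (1 - ε / 10) ^ T ≤ Real.exp (-(ε / 10)) ^ T :=
      pow_le_pow_left₀ (by linarith) (Real.one_sub_le_exp_neg _) T
    refine e1.trans ?_
    rw [← Real.exp_nat_mul]
    have e2 : ε / 10 / n = Real.exp (Real.log (ε / 10 / n)) := (Real.exp_log (by positivity)).symm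
    rw [e2]
    refine Real.exp_le_exp.mpr ?_
    have e3 : Real.log (ε / 10 / n) = Real.log ε - Real.log 10 - Real.log n := by
      rw [Real.log_div (by positivity) hn0.ne', Real.log_div hε.ne' (by norm_num)]
    have e4 : Real.log 10 ≤ 3 := by
      have : Real.log 10 ≤ Real.log (2 ^ (4 : ℕ)) := Real.log_le_log (by norm_num) (by norm_num)
      rw [Real.log_pow] at this
      push_cast at this
      linarith
    rw [e3]
    have e5 : (3 : ℝ) + (Real.log n - Real.log ε) ≤ 3 * U := by rw [hU, hx]; linarith
    linarith
  · intro N hN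
    rw [Int.ceil_le, div_le_iff₀ (by positivity), Int.cast_natCast]
    have e1 : Real.logb 2 N ≤ 2 * Real.log n := by
      rcases Nat.eq_zero_or_pos N with rfl | hN0
      · simp [hlogn]
      · have e2 : Real.log N ≤ Real.log n :=
          Real.log_le_log (by exact_mod_cast hN0) (by exact_mod_cast hN)
        rw [Real.logb, div_le_iff₀ (by linarith)]
        nlinarith
    have e3 : Real.log n ≤ U := by rw [hU, hx]; linarith
    linarith
  · have hqexp : 1 - 1 / (2 * μ) = Real.exp (-(H⁻¹)) := by
      rw [hH, inv_inv, ← Real.log_inv, inv_div, Real.exp_log (by positivity)]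
      field_simp
    rw [hqexp, ← Real.exp_nat_mul]
    have e1 : (R : ℝ) * -H⁻¹ ≤ -Real.log (T + 1) := by
      have := mul_le_mul_of_nonneg_right hRge (inv_nonneg.mpr hH0.le)
      have e : H * Real.log (T + 1) * H⁻¹ = Real.log (T + 1) := by field_simp
      linarith
    have e2 : Real.exp ((R : ℝ) * -H⁻¹) ≤ ((T : ℝ) + 1)⁻¹ := by
      refine (Real.exp_le_exp.mpr e1).trans_eq ?_
      rw [Real.exp_neg, Real.exp_log (by positivity)]
    have hT0 : (0 : ℝ) ≤ T := Nat.cast_nonneg T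
    refine (mul_le_mul_of_nonneg_left e2 hT0).trans_lt ?_
    rw [← div_eq_mul_inv, div_lt_one (by positivity)]
    linarith
  · have e1 := (Nat.ceil_lt_add_one (show 0 ≤ H * Real.log (T + 1) by positivity)).le
    rw [← hR] at e1
    have e2 : H * Real.log (T + 1) ≤ H * (6 * U) := mul_le_mul_of_nonneg_left hlogT hH0.le
    linarith

/-! ### Assembling the guarantees for the chosen parameters. -/

section Main

variable {n k m : ℕ} {I : Instance n k m} {Sopt : Finset (Fin n)} {eStar : Fin n} {ε α μ : ℝ}
  {tc T R : ℕ}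

theorem searchSetup_analysisParams (hn : 1 ≤ n) (hk : 1 ≤ k) (hm : 1 ≤ m) (hε : 0 < ε)
    (hε1 : ε ≤ 1 / 10) (hα0 : 0 ≤ α) (hμ : 1 ≤ μ) (hbest : I.IsBestElement eStar)
    (hT : (1 - ε) ^ T ≤ ε / n) {ground : List (Fin n)} (hground : ∀ e, e ∈ ground ↔ I.Feasible {e})
    {e : Fin n} (he : e ∈ ground) {O : Finset (Fin n)} (hOe : e ∉ O) (hO : I.Feasible ({e} ∪ O)) :
    SearchSetup I (analysisParams k m ε α μ tc) {e} O (ground.filter (· ≠ e)) (bigP k m) T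
      (I.f {eStar}) := by
  obtain ⟨hP2, hkP, -⟩ := bigP_bound k m hk hm
  have hP2' : (2 : ℝ) ≤ bigP k m := by exact_mod_cast hP2
  have hden : 0 < (smallP k (bigP k m + 1) : ℝ) + 1 + m * (1 - ε) := by
    have := mul_nonneg (Nat.cast_nonneg (α := ℝ) m) (show 0 ≤ 1 - ε by linarith)
    positivity
  have hg3 : 1 / (((bigP k m + 1 : ℕ) : ℝ)) ≤ 1 / 3 := by
    rw [div_le_div_iff₀ (by positivity) (by norm_num)]
    push_cast
    linarith
  exact {
    one_le_n := hn
    feasible := (hground e).mp he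
    disjoint := by simp
    subset := by
      intro o ho
      rw [List.mem_toFinset, List.mem_filter]
      refine ⟨(hground o).mpr (hO.subset ?_), ?_⟩
      · exact Finset.singleton_subset_iff.mpr (Finset.mem_union_right _ ho)
      · simpa using fun h : o = e => hOe (h ▸ ho)
    feasible_union := hO
    value_le := fun e' he' => hbest.2 _ ((hground e').mp (List.mem_filter.mp he').1)
    k_le := hkP
    ℓ_le := le_rfl
    ℓ_pos := Nat.succ_pos _
    ε_pos := hε
    ε_lt := show ε < 1 by linarith
    δ_pos := hε
    δ_le := show ε ≤ 1 by linarith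
    β_nonneg := div_nonneg (mul_nonneg (by linarith) (by linarith)) hden.le
    γ_nonneg := div_nonneg (mul_nonneg (by linarith) (by positivity)) hden.le
    one_le_μ := hμ
    passes := hT }

theorem enumSat_analysisParams (hn : 1 ≤ n) (hk : 1 ≤ k) (hm : 1 ≤ m) (hε : 0 < ε)
    (hε1 : ε ≤ 1 / 10) (hα0 : 0 ≤ α) (hα : α ≤ alphaBound k m ε) (hμ : 1 ≤ μ)
    (hopt : I.IsOptimal Sopt) (hbest : I.IsBestElement eStar)
    (hstar : ∀ a ∈ Sopt, I.f {eStar} ≤ (1 + α) * I.f {a}) (hT : (1 - ε) ^ T ≤ ε / n)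
    (hB : ∀ N : ℕ, N ≤ n → ⌈Real.logb 2 N / ε⌉ ≤ (T : ℤ))
    (hR : (T : ℝ) * (1 - 1 / (2 * μ)) ^ R < 1) {ground : List (Fin n)} (hnd : ground.Nodup)
    (hground : ∀ e, e ∈ ground ↔ I.Feasible {e}) :
    EnumSat I (analysisParams k m ε α μ tc) ground Sopt
      (I.f Sopt / ((1 + 10 * ε) * (k + m + 3 + 2 * Real.sqrt (m + 1))))
      (enumOracle R T n (bigP k m + 1)) (enumArith R T n (bigP k m + 1) m T) := by
  intro e he
  have hlen : (ground.filter (· ≠ e)).length ≤ n := by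
    have := (hnd.filter (· ≠ e)).length_le_card
    rwa [Fintype.card_fin] at this
  have hpos : 0 < (1 + 10 * ε) * (k + m + 3 + 2 * Real.sqrt (m + 1)) := by positivity
  by_cases heS : e ∈ Sopt
  · have hun : {e} ∪ Sopt.erase e = Sopt := by
      rw [← Finset.insert_eq, Finset.insert_erase heS]
    have hsetup := searchSetup_analysisParams (tc := tc) hn hk hm hε hε1 hα0 hμ hbest hT hground he
      (Finset.notMem_erase e Sopt) (by rw [hun]; exact hopt.1)
    refine (enumerated_sat hsetup (Finset.card_singleton e) (hB _ hlen) hR).mono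
      (enumOracle_mono hlen) (enumArith_mono hlen) ?_
    rintro r ⟨h1, h2, h3, h4⟩
    refine ⟨h1, h2, fun _ => ?_⟩
    rw [div_le_iff₀ hpos, mul_comm]
    have h5 := (h4 (by rw [hun]; exact hopt.2)).approx hk hm hε hε1 hα0 hα (hstar e heS) h3
    rwa [hun] at h5
  -- For an element outside the optimum only feasibility and cost matter, so `O = ∅` is used.
  · have hsetup := searchSetup_analysisParams (tc := tc) hn hk hm hε hε1 hα0 hμ hbest hT hground he
      (Finset.notMem_empty e) (by rw [Finset.union_empty]; exact (hground e).mp he)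
    refine (enumerated_sat hsetup (Finset.card_singleton e) (hB _ hlen) hR).mono
      (enumOracle_mono hlen) (enumArith_mono hlen) ?_
    rintro r ⟨h1, h2, -, -⟩
    exact ⟨h1, h2, fun h => absurd h heS⟩

/-- The constant is `100·7·31`; of the two logarithmic factors, one comes from the passes and one
from the rounds. -/
theorem cost_bound_of_iterations {T R tc w : ℕ} {U H ε : ℝ}
    (hT : (T : ℝ) ≤ 31 * (U / ε)) (hR : (R : ℝ) ≤ 7 * (U * H)) {c : ℕ}
    (hc : c ≤ 100 * (tc * (R * T * w))) :
    (c : ℝ) ≤ 21700 * U ^ 2 * (H * tc * w / ε) := by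
  have h1 : (c : ℝ) ≤ 100 * (tc * (R * T * w)) := by exact_mod_cast hc
  have h2 : (R : ℝ) * T ≤ 7 * (U * H) * (31 * (U / ε)) :=
    mul_le_mul hR hT (Nat.cast_nonneg T) ((Nat.cast_nonneg R).trans hR)
  have h3 : (100 : ℝ) * (tc * (R * T * w)) ≤
      100 * (tc * (7 * (U * H) * (31 * (U / ε)) * w)) := by gcongr
  refine h1.trans (h3.trans_eq ?_)
  ring

/-- The probability of success from the probability of failure. -/
theorem RComp.le_prob_of_fail_le {α : Type} {x : RComp α} {o a : ℕ} {P Q : α → Prop}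
    (hx : x.AllSat o a P) {δ : ℝ} (hδ : 0 ≤ δ) (hf : x.fail Q ≤ ENNReal.ofReal δ) :
    ENNReal.ofReal (1 - δ) ≤
      PMF.toOuterMeasure x {run | ∃ r c, run = some (r, c) ∧ P r ∧ Q r} := by
  have h1 : 1 ≤ x.fail Q + PMF.toOuterMeasure x {run | ∃ r c, run = some (r, c) ∧ P r ∧ Q r} := by
    refine le_trans (ge_of_eq ?_) (MeasureTheory.measure_union_le _ _)
    refine (PMF.toOuterMeasure_apply_eq_one_iff _ _).mpr fun run hrun => ?_
    obtain ⟨r, c, rfl, -, -, hP⟩ := hx run hrun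
    by_cases hQ : Q r
    · exact Or.inr ⟨r, c, rfl, hP, hQ⟩
    · refine Or.inl ?_
      rintro ⟨r', c', h, hQ'⟩
      obtain ⟨rfl, -⟩ := Prod.mk.inj (Option.some.inj h)
      exact hQ hQ'
  rw [ENNReal.ofReal_sub _ hδ, ENNReal.ofReal_one, tsub_le_iff_left]
  exact h1.trans (by gcongr)

end Main

end SubmodMax

theorem theorem2 :
    ∃ κ : ℝ, 0 < κ ∧ κ ≤ 1 ∧ ∃ C : ℝ, 0 < C ∧ ∃ d : ℕ,
      ∀ (n k m : ℕ), 1 ≤ n → 1 ≤ k → 1 ≤ m →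
      ∀ (I : SubmodMax.Instance n k m) (Sopt : Finset (Fin n)) (eStar : Fin n) (ε α μ : ℝ) (tc : ℕ),
        0 < ε → ε < 1 → 0 ≤ α → 1 ≤ μ → 1 ≤ tc →
        I.IsOptimal Sopt →
        I.IsBestElement eStar →
        α ≤ SubmodMax.alphaBound k m (κ * ε) →
        (∀ a ∈ Sopt, I.f {eStar} ≤ (1 + α) * I.f {a}) →
        (∀ run : SubmodMax.Comp (Finset (Fin n)),
          run ∈ PMF.support
            (SubmodMax.sproutPP I (SubmodMax.analysisParams k m (κ * ε) α μ tc)) →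
          ∃ (S : Finset (Fin n)) (cost : SubmodMax.Cost), run = some (S, cost) ∧
            I.Feasible S ∧
            (cost.oracle : ℝ) ≤ C * (1 + Real.log (n / ε)) ^ d *
              ((Real.log (2 * μ / (2 * μ - 1)))⁻¹ * tc * SubmodMax.bigP k m * n / ε) ∧
            (cost.arith : ℝ) ≤ C * (1 + Real.log (n / ε)) ^ d *
              ((Real.log (2 * μ / (2 * μ - 1)))⁻¹ * tc * SubmodMax.bigP k m * m * n / ε)) ∧
        ENNReal.ofReal (1 - Real.exp (-(Sopt.card * tc / n : ℝ))) ≤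
          PMF.toOuterMeasure
            (SubmodMax.sproutPP I (SubmodMax.analysisParams k m (κ * ε) α μ tc))
            {run | ∃ (S : Finset (Fin n)) (cost : SubmodMax.Cost), run = some (S, cost) ∧
              I.Feasible S ∧
              I.f Sopt ≤ (1 + ε) * (k + m + 3 + 2 * Real.sqrt (m + 1)) * I.f S} := by
  -- `κ = 1/10` turns `1+10ε'` into `1+ε`; `21700` and exponent `2` come from
  -- `cost_bound_of_iterations`.
  refine ⟨1 / 10, by norm_num, by norm_num, 21700, by norm_num, 2, ?_⟩
  intro n k m hn hk hm I Sopt eStar ε α μ tc hε hε1 hα0 hμ htc hopt hbest hα hstar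
  obtain ⟨T, R, hT1, hR1, hpass, hB, hR, hTle, hRle⟩ :=
    SubmodMax.exists_iterations hn hε hε1 hμ
  have h10 : 1 / 10 * ε = ε / 10 := by ring
  rw [h10] at hα ⊢
  have hn1 : (1 : ℝ) ≤ n := by exact_mod_cast hn
  have hU : 0 ≤ 1 + Real.log (n / ε) := by
    have : 0 ≤ Real.log (n / ε) := Real.log_nonneg (by rw [le_div_iff₀ hε]; linarith)
    linarith
  have hP1 : 1 ≤ SubmodMax.bigP k m := by
    have := (SubmodMax.bigP_bound k m hk hm).1
    omega
  -- For `α ≤ 1` this is `(1-α)(1+α) ≤ 1`; for `α ≥ 1` the left side is nonpositive.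
  have hgood : ∀ e ∈ Sopt, (1 - α) * I.f {eStar} ≤ I.f {e} := by
    intro e he
    have h1 := hstar e he
    have h2 := I.f_nonneg {e}
    have h3 := I.f_nonneg {eStar}
    rcases le_total α 1 with h | h
    · have h4 := mul_le_mul_of_nonneg_left h1 (sub_nonneg.mpr h)
      have h5 := mul_nonneg (mul_nonneg hα0 hα0) h2
      linarith
    · have := mul_nonneg (sub_nonneg.mpr h) h3
      linarith
  obtain ⟨hall, hfail⟩ := SubmodMax.sproutPP_spec
    (par := SubmodMax.analysisParams k m (ε / 10) α μ tc) hopt hbest hgood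
    fun ground hnd hground => SubmodMax.enumSat_analysisParams (tc := tc) hn hk hm
      (by linarith) (by linarith) hα0 hα hμ hopt hbest hstar hpass hB hR hnd hground
  obtain ⟨hco, hca⟩ := SubmodMax.sproutPP_cost_le (P := SubmodMax.bigP k m) hn hm hP1 hT1 hR1 htc
    rfl
  refine ⟨fun run hrun => ?_, ?_⟩
  · obtain ⟨S, cost, hrun', ho, ha, hS⟩ := hall run hrun
    refine ⟨S, cost, hrun', hS, ?_, ?_⟩
    · refine (SubmodMax.cost_bound_of_iterations hTle hRle (ho.trans hco)).trans_eq ?_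
      push_cast
      ring
    · refine (SubmodMax.cost_bound_of_iterations hTle hRle (ha.trans hca)).trans_eq ?_
      push_cast
      ring
  · rcases Sopt.eq_empty_or_nonempty with rfl | hne
    -- For an empty optimum the claimed probability is `1 - exp 0 = 0`.
    · simp
    have hcn : (Sopt.card : ℝ) ≤ n := by
      have := Finset.card_le_univ Sopt
      rw [Fintype.card_fin] at this
      exact_mod_cast this
    have hexp : (1 - Sopt.card / n : ℝ) ^ tc ≤ Real.exp (-(Sopt.card * tc / n : ℝ)) := by
      have h1 : (0 : ℝ) ≤ 1 - Sopt.card / n := by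
        rw [sub_nonneg, div_le_one (by linarith)]; exact hcn
      refine (pow_le_pow_left₀ h1 (Real.one_sub_le_exp_neg _) tc).trans_eq ?_
      rw [← Real.exp_nat_mul]
      congr 1
      ring
    have hprob := SubmodMax.RComp.le_prob_of_fail_le hall (Real.exp_pos _).le
      ((hfail hne).trans (ENNReal.ofReal_le_ofReal hexp))
    refine hprob.trans (MeasureTheory.measure_mono ?_)
    rintro run ⟨S, cost, hrun, hS, hval⟩
    refine ⟨S, cost, hrun, hS, ?_⟩
    have hpos : 0 < (1 + 10 * (ε / 10)) * (k + m + 3 + 2 * Real.sqrt (m + 1)) := by positivity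
    rw [div_le_iff₀ hpos] at hval
    refine hval.trans_eq ?_
    ring
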